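/- Let $d,n\ge 1$ and $k$ be integers, $L,\alpha>0$ and $\tau\in\mathbb R$. For polynomials $p,q$ in $u=(u_1,\dots,u_d)$ write $p\preceq q$ if $q-p$ is a sum of squares of polynomials. A probability distribution $\mathcal D$ on $\mathbb R^d$ is called $L$-nice if $v\sim\mathcal D$ has finite $8$th moments, $\mathbb E v=0$, and, as polynomials in $u$, $$\mathbb E\langle v,u\rangle^8\preceq L^2\,(\mathbb E\langle v,u\rangle^2)^4,\qquad \mathbb E\langle v,u\rangle^4\preceq L^2\,(\mathbb E\langle v,u\rangle^2)^2 .$$ Let $\mathcal D$ be $L$-nice with covariance matrix $\Sigma$, and let $v_1,\dots,v_n$ be i.i.d. with law $\mathcal D$. Let $B_1,\dots,B_k$ be a partition of $\{1,\dots,n\}$ into $k$ buckets of equal size $m=n/k$. Put $\tilde v=v\cdot\mathbf 1(\|v\|\le\alpha)$, $\tilde v_j=v_j\cdot\mathbf 1(\|v_j\|\le\alpha)$, $\tilde\Sigma=\mathbb E[\tilde v\tilde v^\top]$ and, for $i\le k$, $$Z_i=\frac1m\sum_{j\in B_i}\tilde v_j\tilde v_j^\top-\tilde\Sigma,\qquad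 \tilde Z_i=Z_i\cdot\mathbf 1(\|Z_i\|_2\le\tau),\qquad p(u)=\sum_{i\le k}\langle u,\tilde Z_iu\rangle^2,$$ where $\|\cdot\|_2$ is the spectral norm of a matrix. A degree-$8$ pseudodistribution in $u$ satisfying $\{\|u\|^2=1\}$ is given by a linear functional $\tilde{\mathbb E}$ on the real polynomials in $u$ of degree at most $8$ with $\tilde{\mathbb E}\,1=1$, $\tilde{\mathbb E}\,q^2\ge0$ whenever $\deg q\le4$, and $\tilde{\mathbb E}\,(\|u\|^2-1)q=0$ whenever $\deg q\le6$. Then the maximum $\max_{\tilde{\mathbb E}}\tilde{\mathbb E}\,p(u)$ over all such $\tilde{\mathbb E}$ is attained for every value of the samples, it is an integrable random variable, and $$\mathbb E_{v_1,\dots,v_n}\Big[\max_{\tilde{\mathbb E}}\tilde{\mathbb E}\,p(u)\Big]\le C\,\frac{k^{3/2}\,L\,\operatorname{Tr}\Sigma\,\|\Sigma\|_2\sqrt{\log d}}{n}+C\,\frac{k^2L\,\|\Sigma\|_2^2}{n}+C\,\tau^2\log d,$$ where $C>0$ is a universal constant, independent of all the data above. -/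

import Mathlib

open MeasureTheory ProbabilityTheory

noncomputable section

/-- `⟨u, M u⟩` as a polynomial in the variables `u = (u₁, …, u_d)`. -/
def quadPoly {d : ℕ} (M : Matrix (Fin d) (Fin d) ℝ) : MvPolynomial (Fin d) ℝ :=
  ∑ a, ∑ b, MvPolynomial.C (M a b) * MvPolynomial.X a * MvPolynomial.X b

/-- `E ⟨X, u⟩ ^ r` as a polynomial in `u`, for `X` with law `D`, obtained by expanding the power:
its coefficients are the mixed moments `E [X_{s₁} ⋯ X_{s_r}]`. -/
def momentPoly {d : ℕ} (D : Measure (EuclideanSpace ℝ (Fin d))) (r : ℕ) :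
    MvPolynomial (Fin d) ℝ :=
  ∑ s : Fin r → Fin d,
    MvPolynomial.C (∫ x, ∏ j, x (s j) ∂D) * ∏ j, MvPolynomial.X (s j)

/-- `p ⪯ q` : the polynomial `q - p` is a sum of squares of polynomials. -/
def SosLE {d : ℕ} (p q : MvPolynomial (Fin d) ℝ) : Prop := IsSumSq (q - p)

/-- A distribution is `L`-certifiably `(2, 2r)`-hypercontractive: it has finite moments of order
`2r` and `E ⟨X, u⟩ ^ (2r) ⪯ L² (E ⟨X, u⟩²) ^ r` as polynomials in `u`. -/
structure IsCertHypercontractive {d : ℕ} (D : Measure (EuclideanSpace ℝ (Fin d)))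
    (L : ℝ) (r : ℕ) : Prop where
  memLp : MemLp (fun x => x) ((2 * r : ℕ) : ENNReal) D
  sosLE : SosLE (momentPoly D (2 * r)) (MvPolynomial.C (L ^ 2) * momentPoly D 2 ^ r)

/-- An `L`-nice distribution: centred, and `L`-certifiably `(2,8)`- and
`(2,4)`-hypercontractive. -/
structure IsNice {d : ℕ} (D : Measure (EuclideanSpace ℝ (Fin d))) (L : ℝ) : Prop where
  mean_zero : ∫ x, x ∂D = 0
  cert_eight : IsCertHypercontractive D L 4
  cert_four : IsCertHypercontractive D L 2

/-- The covariance matrix of a distribution on `ℝ^d`. -/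
def covMatrix {d : ℕ} (D : Measure (EuclideanSpace ℝ (Fin d))) : Matrix (Fin d) (Fin d) ℝ :=
  Matrix.of fun a b => cov[fun x => x a, fun x => x b; D]

/-- The spectral norm (operator norm with respect to the Euclidean norm). -/
def spectralNorm₂ {d : ℕ} (M : Matrix (Fin d) (Fin d) ℝ) : ℝ :=
  ‖Matrix.toEuclideanCLM (n := Fin d) (𝕜 := ℝ) M‖

open Classical in
/-- The truncation `x · 1(‖x‖ ≤ α)` of a vector. -/
def truncVec {d : ℕ} (α : ℝ) (x : EuclideanSpace ℝ (Fin d)) : EuclideanSpace ℝ (Fin d) :=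
  if ‖x‖ ≤ α then x else 0

/-- The second moment matrix `E [ṽ ṽᵀ]` of the truncation `ṽ` of `v ∼ D`. -/
def truncSecondMoment {d : ℕ} (D : Measure (EuclideanSpace ℝ (Fin d))) (α : ℝ) :
    Matrix (Fin d) (Fin d) ℝ :=
  Matrix.of fun a b => ∫ x, truncVec α x a * truncVec α x b ∂D

/-- `B₁, …, B_k` is a partition of `[n]` into buckets of equal size. -/
structure IsEquipartition {n k : ℕ} (B : Fin k → Finset (Fin n)) : Prop where
  existsUnique_mem : ∀ j, ∃! i, j ∈ B i
  card_eq : ∀ i i', (B i).card = (B i').card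

/-- `Z = (1/m) ∑_{j ∈ B} ṽ_j ṽ_jᵀ - E [ṽ ṽᵀ]` for a bucket `B`, with `m = n / k`. -/
def bucketDev {d n : ℕ} (D : Measure (EuclideanSpace ℝ (Fin d))) (α : ℝ) (k : ℕ)
    (B : Finset (Fin n)) (v : Fin n → EuclideanSpace ℝ (Fin d)) : Matrix (Fin d) (Fin d) ℝ :=
  Matrix.of fun a b =>
    1 / ((n : ℝ) / (k : ℝ)) * (∑ j ∈ B, truncVec α (v j) a * truncVec α (v j) b)
      - truncSecondMoment D α a b

open Classical in
/-- The truncation `M · 1(‖M‖₂ ≤ τ)` of a matrix. -/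
def truncMatrix {d : ℕ} (τ : ℝ) (M : Matrix (Fin d) (Fin d) ℝ) : Matrix (Fin d) (Fin d) ℝ :=
  if spectralNorm₂ M ≤ τ then M else 0

/-- The polynomial `p(u) = ∑_{i ≤ k} ⟨u, Z̃_i u⟩²` determined by the samples `v`. -/
def devPoly {d n k : ℕ} (D : Measure (EuclideanSpace ℝ (Fin d))) (α τ : ℝ)
    (B : Fin k → Finset (Fin n)) (v : Fin n → EuclideanSpace ℝ (Fin d)) :
    MvPolynomial (Fin d) ℝ :=
  ∑ i, quadPoly (truncMatrix τ (bucketDev D α k (B i) v)) ^ 2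

/-- `E` is (the expectation of) a degree-`ℓ` pseudodistribution in the variables
`u = (u₁, …, u_d)` satisfying `‖u‖² = 1`. All conditions concern polynomials of degree at most
`ℓ` only; how `E` is continued linearly to polynomials of higher degree plays no role. -/
structure IsSpherePseudoexpectation {d : ℕ} (ℓ : ℕ) (E : MvPolynomial (Fin d) ℝ →ₗ[ℝ] ℝ) :
    Prop where
  map_one : E 1 = 1
  sq_nonneg : ∀ q : MvPolynomial (Fin d) ℝ, 2 * q.totalDegree ≤ ℓ → 0 ≤ E (q ^ 2)
  sphere : ∀ q : MvPolynomial (Fin d) ℝ, q.totalDegree + 2 ≤ ℓ →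
    E ((∑ a, MvPolynomial.X a ^ 2 - 1) * q) = 0

/-- The values at `p` of all degree-`ℓ` pseudodistributions satisfying `‖u‖² = 1`. -/
def pseudoValues {d : ℕ} (ℓ : ℕ) (p : MvPolynomial (Fin d) ℝ) : Set ℝ :=
  {t | ∃ E : MvPolynomial (Fin d) ℝ →ₗ[ℝ] ℝ, IsSpherePseudoexpectation ℓ E ∧ E p = t}

/-- The maximum of `E p` over the degree-`ℓ` pseudodistributions satisfying `‖u‖² = 1`. -/
def pseudoMax {d : ℕ} (ℓ : ℕ) (p : MvPolynomial (Fin d) ℝ) : ℝ := sSup (pseudoValues ℓ p)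

end

/-! The square ⟨u, Z̃_i u⟩² is the quadratic form of A_i = Z̃_i ⊗ Z̃_i at u ⊗ u. So p is the form of
∑ A_i, a sum of independent symmetric d² × d² matrices of norm at most τ². The bound is a matrix
Bernstein argument in which mean and variance are tested only against pseudodistributions and never
measured in operator norm.

Fix η > 0 with ητ² ≤ 1/2 and subtract from A_i the deterministic matrix F_i = E A_i + 2η E A_i².
Then E exp(η(A_i - F_i)) ⪯ I (`Matrix.posSemidef_one_sub_expect_exp`). Because each factor is
dominated by the identity, Golden–Thompson (`Matrix.trace_exp_add_le`), applied to one summand at a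
time, gives E tr exp(η ∑ (A_i - F_i)) ≤ d². A tangent-line bound on the top eigenvalue then controls
the fluctuation for all pseudodistributions at once, by 2 log d / η in expectation. The F_i are not
random, so a pseudoexpectation commutes with the expectation defining them: it suffices to bound ∫
Ẽ⟨u, Z̃u⟩² and ∫ Ẽ⟨u, Z̃²u⟩² for each fixed Ẽ. This is `integral_pseudoMax_formPoly_sum_le`.

Truncation at τ only decreases these two moments. For a bucket, a sum of independent centred
matrices, the first is additive and the second grows quadratically in the number of samples
(`IsSpherePseudoexpectation.integral_map_quadPoly_sum_sq_sq_le`). For one sample both reduce, by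
Cauchy–Schwarz, to ∫ Ẽ⟨v, u⟩⁸ ≤ L²‖Σ‖⁴ and E‖v‖⁸ ≤ L²(Tr Σ)⁴, which come from the eighth-moment
certificate. The certificate may be used inside Ẽ because the squares in it have degree at most 4
(`MvPolynomial.mem_sosDeg_of_isSumSq`). Optimising η gives the three terms.

The maximum is attained because pseudomoments form a compact set, and it is integrable because it is
a continuous function of the bounded matrix ∑ A_i, so it is a bounded measurable function of the
samples. -/

section

open Filter Topology

/-! ### The Lie product formula. -/

section Trotter

variable {𝔸 : Type*} [NormedRing 𝔸] [NormOneClass 𝔸]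

theorem norm_pow_sub_pow_le_of_norm_le {x y : 𝔸} {M : ℝ} (hx : ‖x‖ ≤ M) (hy : ‖y‖ ≤ M) (n : ℕ) :
    ‖x ^ (n + 1) - y ^ (n + 1)‖ ≤ (n + 1) * M ^ n * ‖x - y‖ := by
  have hM : 0 ≤ M := (norm_nonneg x).trans hx
  induction n with
  | zero => simp
  | succ n ih =>
    have h : x ^ (n + 1 + 1) - y ^ (n + 1 + 1)
        = x * (x ^ (n + 1) - y ^ (n + 1)) + (x - y) * y ^ (n + 1) := by
      rw [pow_succ' x (n + 1), pow_succ' y (n + 1)]; noncomm_ring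
    rw [h]
    calc _ ≤ ‖x * (x ^ (n + 1) - y ^ (n + 1))‖ + ‖(x - y) * y ^ (n + 1)‖ := norm_add_le _ _
      _ ≤ ‖x‖ * ‖x ^ (n + 1) - y ^ (n + 1)‖ + ‖x - y‖ * ‖y ^ (n + 1)‖ :=
        add_le_add (norm_mul_le _ _) (norm_mul_le _ _)
      _ ≤ M * ((n + 1) * M ^ n * ‖x - y‖) + ‖x - y‖ * M ^ (n + 1) := by
        gcongr
        exact (norm_pow_le y _).trans (by gcongr)
      _ = _ := by push_cast; ring

variable [NormedAlgebra ℝ 𝔸] [CompleteSpace 𝔸]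

theorem norm_normedSpace_exp_le (X : 𝔸) : ‖NormedSpace.exp X‖ ≤ Real.exp ‖X‖ := by
  have h1 : HasSum (fun n : ℕ => ((n.factorial : ℝ)⁻¹) • X ^ n) (NormedSpace.exp X) :=
    NormedSpace.exp_series_hasSum_exp' (𝕂 := ℝ) X
  have h2 : HasSum (fun n : ℕ => ((n.factorial : ℝ)⁻¹) * ‖X‖ ^ n) (Real.exp ‖X‖) := by
    have := NormedSpace.exp_series_hasSum_exp' (𝕂 := ℝ) ‖X‖
    rwa [← Real.exp_eq_exp_ℝ] at this
  rw [← h1.tsum_eq]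
  refine tsum_of_norm_bounded h2 fun n => ?_
  rw [norm_smul, Real.norm_of_nonneg (by positivity)]
  gcongr
  exact norm_pow_le X n

/-- Both exp(tA)exp(tB) and exp(t(A + B)) have derivative A + B at 0, so at t = 1/(n + 1) they
differ by o(1/n). Passing to (n + 1)-st powers multiplies this by n + 1 and a bounded factor. -/
theorem tendsto_exp_smul_mul_exp_smul_pow (A B : 𝔸) :
    Tendsto (fun n : ℕ => (NormedSpace.exp ((1 / ((n : ℝ) + 1)) • A)
      * NormedSpace.exp ((1 / ((n : ℝ) + 1)) • B)) ^ (n + 1)) atTop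
      (𝓝 (NormedSpace.exp (A + B))) := by
  let _ : NormedAlgebra ℚ 𝔸 := NormedAlgebra.restrictScalars ℚ ℝ 𝔸
  set f : ℝ → 𝔸 := fun t => NormedSpace.exp (t • A) * NormedSpace.exp (t • B) with hf
  set g : ℝ → 𝔸 := fun t => NormedSpace.exp (t • (A + B)) with hg
  have hfd : HasDerivAt f (A + B) 0 := by
    have := (hasDerivAt_exp_smul_const (𝕂 := ℝ) A (0 : ℝ)).mul
      (hasDerivAt_exp_smul_const (𝕂 := ℝ) B (0 : ℝ))
    simp only [zero_smul, NormedSpace.exp_zero, one_mul, mul_one] at this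
    exact this
  have hgd : HasDerivAt g (A + B) 0 := by
    have := hasDerivAt_exp_smul_const (𝕂 := ℝ) (A + B) (0 : ℝ)
    simp only [zero_smul, NormedSpace.exp_zero, one_mul] at this
    exact this
  have hd : HasDerivAt (fun t => f t - g t) 0 0 := by
    have := hfd.sub hgd
    rw [sub_self] at this
    exact this
  have hlim : Tendsto (fun n : ℕ => ((n : ℝ) + 1) *
      ‖f (1 / ((n : ℝ) + 1)) - g (1 / ((n : ℝ) + 1))‖) atTop (𝓝 0) := by
    have h1 := hd.tendsto_slope_zero_right
    have h2 : Tendsto (fun n : ℕ => 1 / ((n : ℝ) + 1)) atTop (𝓝[>] 0) := by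
      refine tendsto_nhdsWithin_iff.2 ⟨tendsto_one_div_add_atTop_nhds_zero_nat, ?_⟩
      exact Eventually.of_forall fun n => by simp only [Set.mem_Ioi]; positivity
    have h3 := (h1.comp h2).norm
    simp only [norm_zero] at h3
    refine h3.congr fun n => ?_
    have h0 : f 0 - g 0 = 0 := by simp [hf, hg]
    have hp : (0 : ℝ) < (n : ℝ) + 1 := by positivity
    simp [norm_smul, h0, abs_of_pos hp]
  have hnorm : ∀ X : 𝔸, ‖NormedSpace.exp X‖ ≤ Real.exp ‖X‖ := fun X =>
    norm_normedSpace_exp_le X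
  have key : ∀ n : ℕ, ‖f (1 / ((n : ℝ) + 1)) ^ (n + 1) - NormedSpace.exp (A + B)‖ ≤
      Real.exp (‖A‖ + ‖B‖) * (((n : ℝ) + 1) *
      ‖f (1 / ((n : ℝ) + 1)) - g (1 / ((n : ℝ) + 1))‖) := by
    intro n
    have hp : (0 : ℝ) < (n : ℝ) + 1 := by positivity
    set t : ℝ := 1 / ((n : ℝ) + 1) with ht
    have ht0 : 0 ≤ t := by positivity
    have hgn : g t ^ (n + 1) = NormedSpace.exp (A + B) := by
      simp only [hg]
      rw [← NormedSpace.exp_nsmul, ← Nat.cast_smul_eq_nsmul ℝ, smul_smul]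
      congr 1
      rw [ht]; push_cast; field_simp; simp
    have hfM : ‖f t‖ ≤ Real.exp (t * (‖A‖ + ‖B‖)) := by
      refine (norm_mul_le _ _).trans ?_
      rw [mul_add, Real.exp_add]
      refine mul_le_mul ((hnorm _).trans ?_) ((hnorm _).trans ?_) (norm_nonneg _)
        (Real.exp_pos _).le
      · rw [norm_smul, Real.norm_of_nonneg ht0]
      · rw [norm_smul, Real.norm_of_nonneg ht0]
    have hgM : ‖g t‖ ≤ Real.exp (t * (‖A‖ + ‖B‖)) := by
      refine (hnorm _).trans (Real.exp_le_exp.2 ?_)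
      rw [norm_smul, Real.norm_of_nonneg ht0]
      gcongr
      exact norm_add_le _ _
    rw [← hgn]
    refine (norm_pow_sub_pow_le_of_norm_le hfM hgM n).trans ?_
    rw [mul_comm ((n : ℝ) + 1), mul_assoc]
    gcongr
    rw [← Real.exp_nat_mul]
    refine Real.exp_le_exp.2 ?_
    rw [← mul_assoc]
    have : (n : ℝ) * t ≤ 1 := by
      rw [ht, mul_one_div, div_le_one hp]; linarith
    calc _ ≤ 1 * (‖A‖ + ‖B‖) := by gcongr
      _ = _ := one_mul _
  rw [tendsto_iff_norm_sub_tendsto_zero]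
  refine squeeze_zero (fun _ => norm_nonneg _) key ?_
  simpa using hlim.const_mul (Real.exp (‖A‖ + ‖B‖))

end Trotter

/-! ### The Golden–Thompson inequality. -/

namespace Matrix

variable {ι : Type*} [Fintype ι] [DecidableEq ι]

omit [DecidableEq ι] in
theorem trace_mul_le_half (A B : Matrix ι ι ℝ) :
    (A * B).trace ≤ ((A * Aᵀ).trace + (B * Bᵀ).trace) / 2 := by
  have h : (B * Bᵀ).trace = ∑ i, ∑ j, B j i * B j i := by
    simp only [trace, diag_apply, mul_apply, transpose_apply]
    exact Finset.sum_comm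
  rw [h]
  simp only [trace, diag_apply, mul_apply, transpose_apply]
  rw [← Finset.sum_add_distrib, Finset.sum_div]
  refine Finset.sum_le_sum fun i _ => ?_
  rw [← Finset.sum_add_distrib, Finset.sum_div]
  refine Finset.sum_le_sum fun j _ => ?_
  nlinarith [sq_nonneg (A i j - B j i)]

theorem trace_mul_pow_comm (A B : Matrix ι ι ℝ) (k : ℕ) :
    ((A * B) ^ k).trace = ((B * A) ^ k).trace := by
  cases k with
  | zero => simp
  | succ k =>
    rw [pow_succ', mul_assoc, trace_mul_comm, pow_succ, ← mul_pow_mul, mul_assoc]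

/-- The two inequalities feed each other. The trace of the square of (PQ)^(2^n) is at most its
squared Frobenius norm, which the second claim bounds by tr (PQ²P)^(2^n) = tr (Q²P²)^(2^n), a case
of the first claim. Conversely, the second claim for Y² produces the product (YYᵀ)(YᵀY), to which
the first applies, and the two Gram matrices have equal power traces. -/
theorem trace_mul_pow_two_pow_le_and (n : ℕ) :
    (∀ P Q : Matrix ι ι ℝ, P.IsSymm → Q.IsSymm →
      ((P * Q) ^ 2 ^ n).trace ≤ (P ^ 2 ^ n * Q ^ 2 ^ n).trace) ∧
    (∀ Y : Matrix ι ι ℝ, (Y ^ 2 ^ n * (Y ^ 2 ^ n)ᵀ).trace ≤ ((Y * Yᵀ) ^ 2 ^ n).trace) := by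
  induction n with
  | zero => simp
  | succ n ih =>
    obtain ⟨hG, hW⟩ := ih
    constructor
    · intro P Q hP hQ
      calc ((P * Q) ^ 2 ^ (n + 1)).trace
          = ((P * Q) ^ 2 ^ n * (P * Q) ^ 2 ^ n).trace := by rw [← pow_add, ← two_mul, ← pow_succ']
        _ ≤ ((P * Q) ^ 2 ^ n * ((P * Q) ^ 2 ^ n)ᵀ).trace := by
          refine (trace_mul_le_half _ _).trans (le_of_eq (by ring))
        _ ≤ ((P * Q * (P * Q)ᵀ) ^ 2 ^ n).trace := hW _
        _ = ((P * (Q * Q * P)) ^ 2 ^ n).trace := by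
          rw [transpose_mul, hP.eq, hQ.eq]; simp only [mul_assoc]
        _ = ((Q ^ 2 * P ^ 2) ^ 2 ^ n).trace := by
          rw [trace_mul_pow_comm, pow_two, pow_two]; simp only [mul_assoc]
        _ ≤ ((Q ^ 2) ^ 2 ^ n * (P ^ 2) ^ 2 ^ n).trace := hG _ _ (hQ.pow 2) (hP.pow 2)
        _ = _ := by rw [trace_mul_comm, ← pow_mul, ← pow_mul, ← pow_succ']
    · intro Y
      have hsP : (Yᵀ * Y).IsSymm := by simp [IsSymm, transpose_mul]
      have hsQ : (Y * Yᵀ).IsSymm := by simp [IsSymm, transpose_mul]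
      calc (Y ^ 2 ^ (n + 1) * (Y ^ 2 ^ (n + 1))ᵀ).trace
          = ((Y ^ 2) ^ 2 ^ n * ((Y ^ 2) ^ 2 ^ n)ᵀ).trace := by rw [← pow_mul, ← pow_succ']
        _ ≤ ((Y ^ 2 * (Y ^ 2)ᵀ) ^ 2 ^ n).trace := hW _
        _ = ((Y * (Y * Yᵀ * Yᵀ)) ^ 2 ^ n).trace := by
          rw [pow_two, transpose_mul]; simp only [mul_assoc]
        _ = (((Y * Yᵀ) * (Yᵀ * Y)) ^ 2 ^ n).trace := by
          rw [trace_mul_pow_comm]; simp only [mul_assoc]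
        _ ≤ ((Y * Yᵀ) ^ 2 ^ n * (Yᵀ * Y) ^ 2 ^ n).trace := hG _ _ hsQ hsP
        _ ≤ _ := trace_mul_le_half _ _
        _ = (((Y * Yᵀ) ^ 2 ^ (n + 1)).trace + ((Yᵀ * Y) ^ 2 ^ (n + 1)).trace) / 2 := by
          rw [(hsQ.pow _).eq, (hsP.pow _).eq, ← pow_add, ← pow_add, ← two_mul, ← pow_succ']
        _ = _ := by rw [trace_mul_pow_comm Yᵀ Y]; ring

section
attribute [local instance] Matrix.linftyOpNormedRing Matrix.linftyOpNormedAlgebra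

/-- The power inequality at exp(A/2^n) and exp(B/2^n) has this right-hand side for every n, and its
left-hand side tends to tr exp(A + B) by the product formula. -/
theorem trace_exp_add_le {A B : Matrix ι ι ℝ} (hA : A.IsSymm) (hB : B.IsSymm) :
    (NormedSpace.exp (A + B)).trace ≤ (NormedSpace.exp A * NormedSpace.exp B).trace := by
  cases isEmpty_or_nonempty ι
  · simp [trace]
  have h1 := tendsto_exp_smul_mul_exp_smul_pow A B
  -- The exponent in the product formula is the index plus one, so the subsequence 2^n - 1 selects
  -- the exponents 2^n.
  have h2 : Tendsto (fun n : ℕ => 2 ^ n - 1) atTop atTop := by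
    refine tendsto_atTop_mono (fun n => ?_) tendsto_id
    have := Nat.lt_two_pow_self (n := n)
    simp only [id]; omega
  have h3 := (continuous_id.matrix_trace.tendsto _).comp (h1.comp h2)
  refine le_of_tendsto h3 (Eventually.of_forall fun n => ?_)
  have h4 : 2 ^ n - 1 + 1 = 2 ^ n := Nat.sub_add_cancel Nat.one_le_two_pow
  have h5 : (((2 ^ n - 1 : ℕ) : ℝ) + 1) = ((2 ^ n : ℕ) : ℝ) := by exact_mod_cast h4
  simp only [Function.comp, id, h4, h5]
  refine ((trace_mul_pow_two_pow_le_and n).1 _ _ (hA.smul _).exp (hB.smul _).exp).trans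
    (le_of_eq ?_)
  have h6 : ∀ X : Matrix ι ι ℝ, NormedSpace.exp ((1 / ((2 ^ n : ℕ) : ℝ)) • X) ^ 2 ^ n
      = NormedSpace.exp X := by
    intro X
    rw [← Matrix.exp_nsmul, ← Nat.cast_smul_eq_nsmul ℝ, smul_smul]
    congr 1
    have : ((2 ^ n : ℕ) : ℝ) ≠ 0 := by positivity
    rw [mul_one_div_cancel this, one_smul]
  rw [h6, h6]

end

end Matrix

end

/-! ### Spectral calculus for real symmetric matrices. -/

section

open Filter Topology

theorem Real.exp_le_one_add_add_sq {x : ℝ} (hx : x ≤ 1) : Real.exp x ≤ 1 + x + x ^ 2 := by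
  rcases le_total (-1) x with h | h
  · have := (abs_le.1 (Real.abs_exp_sub_one_sub_id_le (abs_le.2 ⟨h, hx⟩))).2
    linarith
  · have : Real.exp x ≤ 1 := Real.exp_le_one_iff.2 (by linarith)
    nlinarith

namespace Matrix

variable {ι : Type*} [Fintype ι] [DecidableEq ι]

theorem IsSymm.exists_eq_mul_diagonal_mul {A : Matrix ι ι ℝ} (hA : A.IsSymm) :
    ∃ (U : Matrix ι ι ℝ) (l : ι → ℝ), Uᵀ * U = 1 ∧ U * Uᵀ = 1 ∧ A = U * diagonal l * Uᵀ := by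
  have hH : A.IsHermitian := by rw [IsHermitian, conjTranspose_eq_transpose_of_trivial]; exact hA
  refine ⟨hH.eigenvectorUnitary, hH.eigenvalues, ?_, ?_, ?_⟩
  · have := Unitary.coe_star_mul_self hH.eigenvectorUnitary
    rwa [star_eq_conjTranspose, conjTranspose_eq_transpose_of_trivial] at this
  · have := Unitary.coe_mul_star_self hH.eigenvectorUnitary
    rwa [Unitary.coe_star, star_eq_conjTranspose, conjTranspose_eq_transpose_of_trivial] at this
  · have := hH.spectral_theorem
    rw [Unitary.conjStarAlgAut_apply, star_eq_conjTranspose,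
      conjTranspose_eq_transpose_of_trivial] at this
    exact this

theorem exp_mul_diagonal_mul {U : Matrix ι ι ℝ} (h1 : U * Uᵀ = 1) (l : ι → ℝ) :
    NormedSpace.exp (U * diagonal l * Uᵀ) = U * diagonal (fun i => Real.exp (l i)) * Uᵀ := by
  have h2 : U⁻¹ = Uᵀ := inv_eq_right_inv h1
  have hu : IsUnit U := IsUnit.of_mul_eq_one _ h1
  rw [← h2, exp_conj _ _ hu, exp_diagonal]
  congr 3
  funext i
  rw [Pi.coe_exp, Real.exp_eq_exp_ℝ]

theorem posSemidef_mul_diagonal_mul {U : Matrix ι ι ℝ} {l : ι → ℝ} (hl : ∀ i, 0 ≤ l i) :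
    (U * diagonal l * Uᵀ).PosSemidef := by
  have := (PosSemidef.diagonal (n := ι) (R := ℝ) (d := l) hl).mul_mul_conjTranspose_same U
  rwa [conjTranspose_eq_transpose_of_trivial] at this

theorem nonneg_of_posSemidef_mul_diagonal_mul {U : Matrix ι ι ℝ} {l : ι → ℝ} (h : Uᵀ * U = 1)
    (hp : (U * diagonal l * Uᵀ).PosSemidef) (i : ι) : 0 ≤ l i := by
  have := hp.conjTranspose_mul_mul_same U
  rw [conjTranspose_eq_transpose_of_trivial] at this
  have e : Uᵀ * (U * diagonal l * Uᵀ) * U = diagonal l := by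
    calc _ = (Uᵀ * U) * diagonal l * (Uᵀ * U) := by simp only [mul_assoc]
      _ = _ := by rw [h, one_mul, mul_one]
  rw [e] at this
  exact posSemidef_diagonal_iff.1 this i

theorem posSemidef_one_add_add_sq_sub_exp {X : Matrix ι ι ℝ} (hX : X.IsSymm)
    (h1 : (1 - X).PosSemidef) : (1 + X + X ^ 2 - NormedSpace.exp X).PosSemidef := by
  obtain ⟨U, l, hU, hU', rfl⟩ := hX.exists_eq_mul_diagonal_mul
  have hone : (1 : Matrix ι ι ℝ) = U * diagonal (fun _ => (1 : ℝ)) * Uᵀ := by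
    rw [diagonal_one, mul_one, hU']
  have hle : ∀ i, 0 ≤ 1 - l i := by
    refine nonneg_of_posSemidef_mul_diagonal_mul hU ?_
    rw [hone, ← sub_mul, ← mul_sub, diagonal_sub] at h1
    exact h1
  have hsq : (U * diagonal l * Uᵀ) ^ 2 = U * diagonal (fun i => l i ^ 2) * Uᵀ := by
    calc _ = U * diagonal l * (Uᵀ * U) * diagonal l * Uᵀ := by rw [pow_two]; simp only [mul_assoc]
      _ = _ := by
        rw [hU, mul_one, mul_assoc U, diagonal_mul_diagonal]
        simp only [pow_two]
  rw [hsq, exp_mul_diagonal_mul hU']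
  nth_rw 1 [hone]
  rw [← add_mul, ← add_mul, ← sub_mul, ← mul_add, ← mul_add, ← mul_sub, diagonal_add,
    diagonal_add, diagonal_sub]
  refine posSemidef_mul_diagonal_mul fun i => ?_
  have := Real.exp_le_one_add_add_sq (sub_nonneg.1 (hle i))
  linarith

/-- Each eigenvalue is at most log tr exp Y, and the logarithm lies below its tangent at c. Being
affine in the trace, the bound can be integrated without Jensen's inequality. -/
theorem posSemidef_smul_one_sub_of_trace_exp {Y : Matrix ι ι ℝ} (hY : Y.IsSymm) {c : ℝ}
    (hc : 0 < c) :
    ((Real.log c + (NormedSpace.exp Y).trace / c - 1) • (1 : Matrix ι ι ℝ) - Y).PosSemidef := by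
  obtain ⟨U, l, hU, hU', rfl⟩ := hY.exists_eq_mul_diagonal_mul
  rw [exp_mul_diagonal_mul hU']
  have ht : (U * diagonal (fun i => Real.exp (l i)) * Uᵀ).trace = ∑ i, Real.exp (l i) := by
    rw [trace_mul_comm, ← mul_assoc, hU, one_mul, trace_diagonal]
  set s := Real.log c + (U * diagonal (fun i => Real.exp (l i)) * Uᵀ).trace / c - 1 with hs
  have hone : s • (1 : Matrix ι ι ℝ) = U * diagonal (fun _ => s) * Uᵀ := by
    rw [← smul_one_eq_diagonal, mul_smul_comm, mul_one, smul_mul_assoc, hU']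
  rw [hone, ← sub_mul, ← mul_sub, diagonal_sub]
  refine posSemidef_mul_diagonal_mul fun i => ?_
  have h1 : Real.exp (l i) ≤ ∑ i, Real.exp (l i) :=
    Finset.single_le_sum (f := fun i => Real.exp (l i)) (fun i _ => (Real.exp_pos _).le)
      (Finset.mem_univ i)
  have h2 : l i - Real.log c + 1 ≤ Real.exp (l i) / c := by
    have := Real.add_one_le_exp (l i - Real.log c)
    rwa [Real.exp_sub, Real.exp_log hc] at this
  have h3 : Real.exp (l i) / c ≤ (∑ i, Real.exp (l i)) / c := by gcongr
  rw [hs, ht]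
  linarith

omit [Fintype ι] [DecidableEq ι] in
theorem PosSemidef.isSymm {A : Matrix ι ι ℝ} (hA : A.PosSemidef) : A.IsSymm := by
  have := hA.isHermitian
  rwa [IsHermitian, conjTranspose_eq_transpose_of_trivial] at this

theorem PosSemidef.exists_eq_transpose_mul_self {A : Matrix ι ι ℝ} (hA : A.PosSemidef) :
    ∃ C : Matrix ι ι ℝ, A = Cᵀ * C := by
  obtain ⟨U, l, hU, hU', rfl⟩ := hA.isSymm.exists_eq_mul_diagonal_mul
  have hl := nonneg_of_posSemidef_mul_diagonal_mul hU hA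
  refine ⟨diagonal (fun i => √(l i)) * Uᵀ, ?_⟩
  have h : diagonal l = diagonal (fun i => √(l i)) * diagonal (fun i => √(l i)) := by
    rw [diagonal_mul_diagonal]
    simp only [Real.mul_self_sqrt (hl _)]
  rw [transpose_mul, transpose_transpose, diagonal_transpose, h]
  simp only [mul_assoc]

theorem PosSemidef.trace_mul_nonneg {A B : Matrix ι ι ℝ} (hA : A.PosSemidef) (hB : B.PosSemidef) :
    0 ≤ (A * B).trace := by
  obtain ⟨C, rfl⟩ := hA.exists_eq_transpose_mul_self
  rw [mul_assoc, trace_mul_comm]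
  have := (hB.mul_mul_conjTranspose_same C).trace_nonneg
  rwa [conjTranspose_eq_transpose_of_trivial] at this

theorem PosSemidef.exp {A : Matrix ι ι ℝ} (hA : A.IsSymm) : (NormedSpace.exp A).PosSemidef := by
  obtain ⟨U, l, hU, hU', rfl⟩ := hA.exists_eq_mul_diagonal_mul
  rw [exp_mul_diagonal_mul hU']
  exact posSemidef_mul_diagonal_mul fun i => (Real.exp_pos _).le

end Matrix

end

/-! ### Bounded random matrices and the trace exponential of independent sums. -/

section

open Filter Topology

set_option linter.unusedSectionVars false

instance Matrix.instMeasurableSpace {m n : Type*} : MeasurableSpace (Matrix m n ℝ) :=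
  inferInstanceAs (MeasurableSpace (m → n → ℝ))

instance Matrix.instBorelSpace {m n : Type*} [Countable m] [Countable n] :
    BorelSpace (Matrix m n ℝ) :=
  inferInstanceAs (BorelSpace (m → n → ℝ))

instance Matrix.instSecondCountableTopology {m n : Type*} [Countable m] [Countable n] :
    SecondCountableTopology (Matrix m n ℝ) :=
  inferInstanceAs (SecondCountableTopology (m → n → ℝ))

/-- A random variable with values in a compact set. -/
structure IsCompactRV {Ω β : Type*} [MeasurableSpace Ω] [MeasurableSpace β] [TopologicalSpace β]
    (X : Ω → β) : Prop where
  measurable : Measurable X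
  exists_isCompact : ∃ K, IsCompact K ∧ ∀ ω, X ω ∈ K

namespace IsCompactRV

variable {Ω β γ : Type*} [MeasurableSpace Ω] [MeasurableSpace β] [TopologicalSpace β]
  [MeasurableSpace γ] [TopologicalSpace γ] {X : Ω → β} {Y : Ω → γ}

theorem comp [OpensMeasurableSpace β] [BorelSpace γ] (hX : IsCompactRV X) {g : β → γ}
    (hg : Continuous g) : IsCompactRV (fun ω => g (X ω)) := by
  obtain ⟨hm, K, hK, h⟩ := hX
  exact ⟨hg.measurable.comp hm, g '' K, hK.image hg, fun ω => Set.mem_image_of_mem g (h ω)⟩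

theorem prodMk (hX : IsCompactRV X) (hY : IsCompactRV Y) :
    IsCompactRV (fun ω => (X ω, Y ω)) := by
  obtain ⟨hm, K, hK, h⟩ := hX
  obtain ⟨hm', K', hK', h'⟩ := hY
  exact ⟨hm.prodMk hm', K ×ˢ K', hK.prod hK', fun ω => ⟨h ω, h' ω⟩⟩

theorem pi {ι : Type*} {β : ι → Type*} [∀ i, MeasurableSpace (β i)] [∀ i, TopologicalSpace (β i)]
    {X : ∀ i, Ω → β i} (hX : ∀ i, IsCompactRV (X i)) : IsCompactRV (fun ω i => X i ω) := by
  choose K hK h using fun i => (hX i).exists_isCompact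
  exact ⟨measurable_pi_lambda _ fun i => (hX i).measurable, Set.univ.pi K,
    isCompact_univ_pi hK, fun ω i _ => h i ω⟩

theorem const (b : β) : IsCompactRV (fun _ : Ω => b) :=
  ⟨measurable_const, {b}, isCompact_singleton, fun _ => rfl⟩

theorem integrable {X : Ω → ℝ} (hX : IsCompactRV X) (μ : Measure Ω) [IsFiniteMeasure μ] :
    Integrable X μ := by
  obtain ⟨hm, K, hK, h⟩ := hX
  obtain ⟨b, hb⟩ := hK.isBounded.exists_norm_le
  exact Integrable.of_bound hm.aestronglyMeasurable b (Eventually.of_forall fun ω => hb _ (h ω))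

theorem finsetSum {κ : Type*} [AddCommMonoid β] [ContinuousAdd β] [BorelSpace β]
    [SecondCountableTopology β] {Y : κ → Ω → β} (hY : ∀ j, IsCompactRV (Y j)) (s : Finset κ) :
    IsCompactRV fun ω => ∑ j ∈ s, Y j ω := by
  have := (IsCompactRV.pi fun j : s => hY j).comp (g := fun x : s → β => ∑ j, x j)
    (continuous_finsetSum _ fun j _ => continuous_apply j)
  have e : (fun ω => ∑ j ∈ s, Y j ω) = fun ω => ∑ j : s, Y j ω :=
    funext fun ω => (Finset.sum_coe_sort s fun j => Y j ω).symm
  rw [e]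
  exact this

theorem precomp {Ω' : Type*} [MeasurableSpace Ω'] (hX : IsCompactRV X) {f : Ω' → Ω}
    (hf : Measurable f) : IsCompactRV (fun ω => X (f ω)) :=
  ⟨hX.measurable.comp hf, hX.exists_isCompact.imp fun _ h => ⟨h.1, fun ω => h.2 (f ω)⟩⟩

end IsCompactRV

namespace Matrix

variable {m n ι : Type*} {Ω : Type*} [MeasurableSpace Ω]

/-- Entrywise expectation of a random matrix. -/
noncomputable def expect (μ : Measure Ω) (X : Ω → Matrix m n ℝ) : Matrix m n ℝ :=
  of fun i j => ∫ ω, X ω i j ∂μ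

variable {μ : Measure Ω} [IsFiniteMeasure μ]

theorem continuous_entry (i : m) (j : n) : Continuous fun M : Matrix m n ℝ => M i j :=
  continuous_id.matrix_elem i j

theorem _root_.IsCompactRV.integrable_entry [Countable m] [Countable n] {X : Ω → Matrix m n ℝ}
    (hX : IsCompactRV X) (i : m) (j : n) : Integrable (fun ω => X ω i j) μ :=
  (hX.comp (continuous_entry i j)).integrable μ

variable [Fintype m] [Fintype n] [DecidableEq m] [DecidableEq n]

/-- Besides traces and quadratic forms, this is used for M ↦ Ẽ of the form of M, where it exchanges
a fixed pseudoexpectation with the expectation over samples. -/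
theorem map_expect (l : Matrix m n ℝ →ₗ[ℝ] ℝ) {X : Ω → Matrix m n ℝ} (hX : IsCompactRV X) :
    ∫ ω, l (X ω) ∂μ = l (expect μ X) := by
  have h : ∀ M : Matrix m n ℝ, l M = ∑ i, ∑ j, M i j * l (single i j 1) := by
    intro M
    conv_lhs => rw [matrix_eq_sum_single M]
    simp only [map_sum]
    refine Finset.sum_congr rfl fun i _ => Finset.sum_congr rfl fun j _ => ?_
    rw [← smul_eq_mul, ← map_smul, smul_single, smul_eq_mul, mul_one]
  rw [h]
  simp only [h (X _)]
  have hi : ∀ i j, Integrable (fun ω => X ω i j * l (single i j 1)) μ := fun i j =>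
    (hX.integrable_entry i j).mul_const _
  rw [integral_finsetSum _ fun i _ => integrable_finsetSum _ fun j _ => hi i j]
  refine Finset.sum_congr rfl fun i _ => ?_
  rw [integral_finsetSum _ fun j _ => hi i j]
  refine Finset.sum_congr rfl fun j _ => ?_
  rw [integral_mul_const]
  rfl

variable [Fintype ι] [DecidableEq ι]

theorem posSemidef_expect {X : Ω → Matrix ι ι ℝ} (hX : IsCompactRV X)
    (h : ∀ ω, (X ω).PosSemidef) : (expect μ X).PosSemidef := by
  have hs : (expect μ X).IsHermitian := by
    ext i j
    simp only [conjTranspose_apply, star_trivial, expect, of_apply]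
    congr 1
    funext ω
    exact (h ω).isSymm.apply i j
  refine PosSemidef.of_dotProduct_mulVec_nonneg hs fun x => ?_
  let l : Matrix ι ι ℝ →ₗ[ℝ] ℝ :=
    { toFun := fun M => star x ⬝ᵥ (M *ᵥ x)
      map_add' := fun A B => by rw [add_mulVec, dotProduct_add]
      map_smul' := fun c A => by rw [smul_mulVec, dotProduct_smul]; rfl }
  change 0 ≤ l (expect μ X)
  rw [← map_expect l hX]
  exact integral_nonneg fun ω => (h ω).dotProduct_mulVec_nonneg x

theorem expect_add {X Y : Ω → Matrix ι ι ℝ} (hX : IsCompactRV X) (hY : IsCompactRV Y) :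
    expect μ (fun ω => X ω + Y ω) = expect μ X + expect μ Y := by
  ext i j
  exact integral_add (hX.integrable_entry i j) (hY.integrable_entry i j)

theorem expect_sub {X Y : Ω → Matrix ι ι ℝ} (hX : IsCompactRV X) (hY : IsCompactRV Y) :
    expect μ (fun ω => X ω - Y ω) = expect μ X - expect μ Y := by
  ext i j
  exact integral_sub (hX.integrable_entry i j) (hY.integrable_entry i j)

theorem expect_smul (c : ℝ) (X : Ω → Matrix m n ℝ) :
    expect μ (fun ω => c • X ω) = c • expect μ X := by
  ext i j
  exact integral_const_mul c _

theorem expect_const [IsProbabilityMeasure μ] (M : Matrix ι ι ℝ) :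
    expect μ (fun _ => M) = M := by
  ext i j
  simp [expect]

theorem expect_mul_left (M : Matrix ι ι ℝ) {X : Ω → Matrix ι ι ℝ} (hX : IsCompactRV X) :
    expect μ (fun ω => M * X ω) = M * expect μ X := by
  ext i j
  simp only [expect, of_apply, mul_apply]
  rw [integral_finsetSum _ fun k _ => (hX.integrable_entry k j).const_mul _]
  simp only [integral_const_mul]

theorem expect_mul_right (M : Matrix ι ι ℝ) {X : Ω → Matrix ι ι ℝ} (hX : IsCompactRV X) :
    expect μ (fun ω => X ω * M) = expect μ X * M := by
  ext i j
  simp only [expect, of_apply, mul_apply]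
  rw [integral_finsetSum _ fun k _ => (hX.integrable_entry i k).mul_const _]
  simp only [integral_mul_const]

section
attribute [local instance] Matrix.linftyOpNormedRing Matrix.linftyOpNormedAlgebra

theorem continuous_exp : Continuous fun M : Matrix ι ι ℝ => NormedSpace.exp M := by
  let _ : NormedAlgebra ℚ (Matrix ι ι ℝ) := NormedAlgebra.restrictScalars ℚ ℝ _
  exact NormedSpace.exp_continuous

end

/-- Golden–Thompson separates S from X, independence factorises the expectation, and the trace of
the product of the positive semidefinite matrices E exp S and I - E exp X is nonnegative. Summands
obeying `hE` can thus be removed one after another at no cost. -/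
theorem integral_trace_exp_add_le [IsProbabilityMeasure μ] {S X : Ω → Matrix ι ι ℝ}
    (hS : IsCompactRV S) (hX : IsCompactRV X) (hSs : ∀ ω, (S ω).IsSymm)
    (hXs : ∀ ω, (X ω).IsSymm) (hind : IndepFun S X μ)
    (hE : (1 - expect μ fun ω => NormedSpace.exp (X ω)).PosSemidef) :
    ∫ ω, (NormedSpace.exp (S ω + X ω)).trace ∂μ ≤ ∫ ω, (NormedSpace.exp (S ω)).trace ∂μ := by
  have hSe : IsCompactRV fun ω => NormedSpace.exp (S ω) := hS.comp continuous_exp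
  have hXe : IsCompactRV fun ω => NormedSpace.exp (X ω) := hX.comp continuous_exp
  have hcm : Continuous fun p : Matrix ι ι ℝ × Matrix ι ι ℝ => (p.1 * p.2).trace :=
    (continuous_fst.matrix_mul continuous_snd).matrix_trace
  have hca : Continuous fun p : Matrix ι ι ℝ × Matrix ι ι ℝ => (NormedSpace.exp (p.1 + p.2)).trace :=
    (continuous_exp.comp (continuous_fst.add continuous_snd)).matrix_trace
  calc ∫ ω, (NormedSpace.exp (S ω + X ω)).trace ∂μ
      ≤ ∫ ω, (NormedSpace.exp (S ω) * NormedSpace.exp (X ω)).trace ∂μ := by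
        refine integral_mono (((hS.prodMk hX).comp hca).integrable μ)
          (((hSe.prodMk hXe).comp hcm).integrable μ) fun ω => trace_exp_add_le (hSs ω) (hXs ω)
    _ = (expect μ (fun ω => NormedSpace.exp (S ω)) *
          expect μ (fun ω => NormedSpace.exp (X ω))).trace := by
        simp only [trace, diag_apply, mul_apply, expect, of_apply]
        have hi : ∀ i j, Integrable
            (fun ω => NormedSpace.exp (S ω) i j * NormedSpace.exp (X ω) j i) μ := by
          intro i j
          have hc : Continuous fun p : Matrix ι ι ℝ × Matrix ι ι ℝ => p.1 i j * p.2 j i :=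
            (continuous_fst.matrix_elem i j).mul (continuous_snd.matrix_elem j i)
          exact ((hSe.prodMk hXe).comp hc).integrable μ
        rw [integral_finsetSum _ fun i _ => integrable_finsetSum _ fun j _ => hi i j]
        refine Finset.sum_congr rfl fun i _ => ?_
        rw [integral_finsetSum _ fun j _ => hi i j]
        refine Finset.sum_congr rfl fun j _ => ?_
        have h1 : Measurable fun M : Matrix ι ι ℝ => NormedSpace.exp M i j :=
          (continuous_exp.matrix_elem i j).measurable
        have h2 : Measurable fun M : Matrix ι ι ℝ => NormedSpace.exp M j i :=
          (continuous_exp.matrix_elem j i).measurable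
        exact (hind.comp h1 h2).integral_fun_mul_eq_mul_integral
          (h1.comp hS.measurable).aestronglyMeasurable
          (h2.comp hX.measurable).aestronglyMeasurable
    _ ≤ (expect μ (fun ω => NormedSpace.exp (S ω))).trace := by
        have := PosSemidef.trace_mul_nonneg
          (posSemidef_expect (μ := μ) hSe fun ω => PosSemidef.exp (hSs ω)) hE
        rw [mul_sub, mul_one, trace_sub] at this
        linarith
    _ = _ := (map_expect (traceLinearMap ι ℝ ℝ) hSe).symm

theorem integral_trace_exp_sum_le [IsProbabilityMeasure μ] {κ : Type*}
    {X : κ → Ω → Matrix ι ι ℝ} (hX : ∀ i, IsCompactRV (X i)) (hXs : ∀ i ω, (X i ω).IsSymm)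
    (hind : ∀ (s : Finset κ) (i : κ), i ∉ s → IndepFun (fun ω => ∑ j ∈ s, X j ω) (X i) μ)
    (hE : ∀ i, (1 - expect μ fun ω => NormedSpace.exp (X i ω)).PosSemidef) (s : Finset κ) :
    ∫ ω, (NormedSpace.exp (∑ j ∈ s, X j ω)).trace ∂μ ≤ Fintype.card ι := by
  classical
  induction s using Finset.induction_on with
  | empty => simp
  | insert i s hi ih =>
    refine le_trans ?_ ih
    have hS : IsCompactRV fun ω => ∑ j ∈ s, X j ω := IsCompactRV.finsetSum hX s
    have hSs : ∀ ω, (∑ j ∈ s, X j ω).IsSymm := by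
      intro ω
      simp only [IsSymm, transpose_sum]
      exact Finset.sum_congr rfl fun j _ => hXs j ω
    simp only [Finset.sum_insert hi, add_comm (X i _)]
    exact integral_trace_exp_add_le hS (hX i) hSs (hXs i) (hind s i hi) (hE i)

end Matrix

end

/-! ### The shifted matrix moment generating function. -/

section

open Filter Topology

set_option linter.unusedSectionVars false

namespace Matrix

variable {ι : Type*} [Fintype ι] [DecidableEq ι]

theorem PosSemidef.smul_sub_sq {V : Matrix ι ι ℝ} (hV : V.PosSemidef) {c : ℝ}
    (hc : (c • (1 : Matrix ι ι ℝ) - V).PosSemidef) : (c • V - V ^ 2).PosSemidef := by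
  obtain ⟨U, l, hU, hU', rfl⟩ := hV.isSymm.exists_eq_mul_diagonal_mul
  have hl := nonneg_of_posSemidef_mul_diagonal_mul hU hV
  have hone : c • (1 : Matrix ι ι ℝ) = U * diagonal (fun _ => c) * Uᵀ := by
    rw [← smul_one_eq_diagonal, mul_smul_comm, mul_one, smul_mul_assoc, hU']
  have hle : ∀ i, 0 ≤ c - l i := by
    refine nonneg_of_posSemidef_mul_diagonal_mul hU ?_
    rw [hone, ← sub_mul, ← mul_sub, diagonal_sub] at hc
    exact hc
  have hsq : (U * diagonal l * Uᵀ) ^ 2 = U * diagonal (fun i => l i ^ 2) * Uᵀ := by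
    calc _ = U * diagonal l * (Uᵀ * U) * diagonal l * Uᵀ := by rw [pow_two]; simp only [mul_assoc]
      _ = _ := by
        rw [hU, mul_one, mul_assoc U, diagonal_mul_diagonal]
        simp only [pow_two]
  rw [hsq, ← smul_mul_assoc, ← mul_smul_comm, ← sub_mul, ← mul_sub, ← diagonal_smul, diagonal_sub]
  refine posSemidef_mul_diagonal_mul fun i => ?_
  simp only [Pi.smul_apply, smul_eq_mul]
  nlinarith [mul_nonneg (hl i) (hle i)]

theorem IsSymm.posSemidef_sq {A : Matrix ι ι ℝ} (hA : A.IsSymm) : (A ^ 2).PosSemidef := by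
  have := posSemidef_self_mul_conjTranspose A
  rwa [conjTranspose_eq_transpose_of_trivial, hA.eq, ← pow_two] at this

variable {Ω : Type*} [MeasurableSpace Ω] {μ : Measure Ω} [IsProbabilityMeasure μ]

theorem isSymm_expect {A : Ω → Matrix ι ι ℝ} (h : ∀ ω, (A ω).IsSymm) : (expect μ A).IsSymm := by
  ext i j
  simp only [transpose_apply, expect, of_apply]
  congr 1
  funext ω
  exact (h ω).apply i j

/-- The exponential of a bounded random symmetric matrix, centred a little above its mean, has
expectation at most the identity. -/
theorem posSemidef_one_sub_expect_exp {A : Ω → Matrix ι ι ℝ} (hA : IsCompactRV A)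
    (hs : ∀ ω, (A ω).IsSymm) {t η : ℝ} (hη : 0 ≤ η) (hηt : η * t ≤ 1 / 2) (ht : 0 ≤ t)
    (h1 : ∀ ω, (t • (1 : Matrix ι ι ℝ) - A ω).PosSemidef)
    (h2 : ∀ ω, (t • (1 : Matrix ι ι ℝ) + A ω).PosSemidef)
    (h3 : ∀ ω, (t ^ 2 • (1 : Matrix ι ι ℝ) - A ω ^ 2).PosSemidef) :
    (1 - expect μ fun ω => NormedSpace.exp
      (η • (A ω - (expect μ A + (2 * η) • expect μ fun ω => A ω ^ 2)))).PosSemidef := by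
  have hA2 : IsCompactRV fun ω => A ω ^ 2 := hA.comp (continuous_pow 2)
  set M := expect μ A with hM
  set V := expect μ fun ω => A ω ^ 2 with hV
  set F := M + (2 * η) • V with hF
  set X : Ω → Matrix ι ι ℝ := fun ω => η • (A ω - F) with hX
  have hMs : M.IsSymm := isSymm_expect hs
  have hVp : V.PosSemidef := posSemidef_expect hA2 fun ω => (hs ω).posSemidef_sq
  have hFs : F.IsSymm := hMs.add (hVp.isSymm.smul _)
  have hXs : ∀ ω, (X ω).IsSymm := fun ω => ((hs ω).sub hFs).smul _
  have hcX : Continuous fun B : Matrix ι ι ℝ => η • (B - F) := by fun_prop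
  have hXc : IsCompactRV X := hA.comp hcX
  have hX2 : IsCompactRV fun ω => X ω ^ 2 := hXc.comp (continuous_pow 2)
  have hXe : IsCompactRV fun ω => NormedSpace.exp (X ω) := hXc.comp continuous_exp
  have hc1 : IsCompactRV fun _ : Ω => (1 : Matrix ι ι ℝ) := IsCompactRV.const 1
  have hMt : (t • (1 : Matrix ι ι ℝ) + M).PosSemidef := by
    have hc : IsCompactRV fun _ : Ω => (t • 1 : Matrix ι ι ℝ) := IsCompactRV.const _
    have := posSemidef_expect (μ := μ) (X := fun ω => t • (1 : Matrix ι ι ℝ) + A ω)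
      (hA.comp (by fun_prop)) h2
    rwa [expect_add hc hA, expect_const] at this
  have hVt : (t ^ 2 • (1 : Matrix ι ι ℝ) - V).PosSemidef := by
    have hc : IsCompactRV fun _ : Ω => (t ^ 2 • 1 : Matrix ι ι ℝ) := IsCompactRV.const _
    have := posSemidef_expect (μ := μ) (X := fun ω => t ^ 2 • (1 : Matrix ι ι ℝ) - A ω ^ 2)
      (hA2.comp (g := fun B => t ^ 2 • (1 : Matrix ι ι ℝ) - B) (by fun_prop)) h3
    rwa [expect_sub hc hA2, expect_const] at this
  -- The bound exp X ⪯ 1 + X + X² needs X ⪯ 1. Both A ⪯ t and -E A ⪯ t are used, which is why ηt ≤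
  -- 1/2 is required.
  have hX1 : ∀ ω, (1 - X ω).PosSemidef := by
    intro ω
    have e : 1 - X ω = (1 - 2 * (η * t)) • (1 : Matrix ι ι ℝ) + η • (t • (1 : Matrix ι ι ℝ) - A ω)
        + η • (t • (1 : Matrix ι ι ℝ) + M) + (2 * η ^ 2) • V := by
      simp only [hX, hF]
      module
    rw [e]
    exact (((PosSemidef.one.smul (by linarith)).add ((h1 ω).smul hη)).add (hMt.smul hη)).add
      (hVp.smul (by positivity))
  have hpt := fun ω => posSemidef_one_add_add_sq_sub_exp (hXs ω) (hX1 ω)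
  have hc2 : Continuous fun B : Matrix ι ι ℝ => 1 + B := by fun_prop
  have hc3 : Continuous fun B : Matrix ι ι ℝ => 1 + B + B ^ 2 := by fun_prop
  have hE := posSemidef_expect (μ := μ) (X := fun ω => 1 + X ω + X ω ^ 2 - NormedSpace.exp (X ω))
    (hXc.comp (hc3.sub continuous_exp)) hpt
  rw [expect_sub (hXc.comp hc3) hXe, expect_add (hXc.comp hc2) hX2, expect_add hc1 hXc,
    expect_const] at hE
  have hEX : expect μ X = -((2 * η ^ 2) • V) := by
    have hcF : IsCompactRV fun _ : Ω => F := IsCompactRV.const F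
    simp only [hX]
    rw [expect_smul, expect_sub hA hcF, expect_const, ← hM, hF]
    module
  have hEX2 : expect μ (fun ω => X ω ^ 2) = η ^ 2 • (V + (4 * η ^ 2) • V ^ 2 - M ^ 2) := by
    have e : ∀ ω, X ω ^ 2 = η ^ 2 • (A ω ^ 2 + F ^ 2 - F * A ω - A ω * F) := by
      intro ω
      simp only [hX]
      rw [smul_pow]
      congr 1
      noncomm_ring
    have hcF : IsCompactRV fun _ : Ω => F ^ 2 := IsCompactRV.const _
    have k1 : IsCompactRV fun ω => F * A ω := hA.comp (continuous_const_mul F)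
    have k2 : IsCompactRV fun ω => A ω * F := hA.comp (continuous_mul_const F)
    have k3 : IsCompactRV fun ω => A ω ^ 2 + F ^ 2 := hA2.comp (g := fun B => B + F ^ 2) (by fun_prop)
    have k4 : IsCompactRV fun ω => A ω ^ 2 + F ^ 2 - F * A ω :=
      hA.comp (g := fun B => B ^ 2 + F ^ 2 - F * B) (by fun_prop)
    simp only [e]
    rw [expect_smul, expect_sub k4 k2, expect_sub k3 k1, expect_add hA2 hcF, expect_const,
      expect_mul_left F hA, expect_mul_right F hA, ← hM, ← hV]
    congr 1
    have h4 : (4 * η ^ 2) • V ^ 2 = ((2 * η) • V) ^ 2 := by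
      rw [smul_pow]; congr 1; ring
    rw [h4, hF]
    generalize (2 * η) • V = W
    noncomm_ring
  -- This is the slack -(E X + E X²). The factor 2 in the shift 2ηV leaves one η²V over, which
  -- absorbs 4η⁴V² because V² ⪯ t²V and 2ηt ≤ 1.
  have hfin : (η ^ 2 • M ^ 2 + η ^ 2 • (V - (4 * η ^ 2) • V ^ 2)).PosSemidef := by
    refine (hMs.posSemidef_sq.smul (by positivity)).add (PosSemidef.smul ?_ (by positivity))
    have := (hVp.smul_sub_sq hVt).smul (show (0 : ℝ) ≤ 4 * η ^ 2 by positivity)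
    have e : V - (4 * η ^ 2) • V ^ 2
        = (4 * η ^ 2) • (t ^ 2 • V - V ^ 2) + (1 - 4 * (η * t) ^ 2) • V := by module
    rw [e]
    refine this.add (hVp.smul ?_)
    have : 0 ≤ η * t := mul_nonneg hη ht
    nlinarith
  have e : 1 - expect μ (fun ω => NormedSpace.exp (X ω))
      = (1 + expect μ X + expect μ (fun ω => X ω ^ 2) - expect μ fun ω => NormedSpace.exp (X ω))
        + (η ^ 2 • M ^ 2 + η ^ 2 • (V - (4 * η ^ 2) • V ^ 2)) := by
    rw [hEX, hEX2]
    module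
  rw [e]
  exact hE.add hfin

end Matrix

end

/-! ### Quadratic forms as polynomials, sums of squares of bounded degree, and pseudoexpectations.
-/

section

open Filter Topology

set_option linter.unusedSectionVars false

open MvPolynomial in
/-- The linear form `⟨x, u⟩` as a polynomial in `u`. -/
noncomputable def linPoly {d : ℕ} (x : Fin d → ℝ) : MvPolynomial (Fin d) ℝ := ∑ a, C (x a) * X a

/-- `∑ Q i j w i w j` for a family of polynomials `w`. -/
noncomputable def formPoly {d : ℕ} {ι : Type*} [Fintype ι] (Q : Matrix ι ι ℝ)
    (w : ι → MvPolynomial (Fin d) ℝ) : MvPolynomial (Fin d) ℝ :=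
  ∑ i, ∑ j, MvPolynomial.C (Q i j) * w i * w j

/-- Sums of squares of polynomials of degree at most `k`. -/
noncomputable def sosDeg (d k : ℕ) : AddSubmonoid (MvPolynomial (Fin d) ℝ) :=
  AddSubmonoid.closure {p | ∃ q : MvPolynomial (Fin d) ℝ, q.totalDegree ≤ k ∧ p = q ^ 2}

namespace MvPolynomial

variable {d : ℕ} {ι : Type*} [Fintype ι]

theorem totalDegree_linPoly_le (x : Fin d → ℝ) : (linPoly x).totalDegree ≤ 1 := by
  refine totalDegree_finsetSum_le fun a _ => (totalDegree_mul _ _).trans ?_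
  simp

theorem totalDegree_formPoly_le (Q : Matrix ι ι ℝ) {w : ι → MvPolynomial (Fin d) ℝ} {k : ℕ}
    (hw : ∀ i, (w i).totalDegree ≤ k) : (formPoly Q w).totalDegree ≤ 2 * k := by
  refine totalDegree_finsetSum_le fun i _ => totalDegree_finsetSum_le fun j _ => ?_
  refine (totalDegree_mul _ _).trans ?_
  have h1 := totalDegree_mul (C (Q i j)) (w i)
  have h2 := hw i
  have h3 := hw j
  rw [totalDegree_C] at h1
  omega

theorem quadPoly_eq_formPoly (M : Matrix (Fin d) (Fin d) ℝ) : quadPoly M = formPoly M X := rfl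

theorem totalDegree_quadPoly_le (M : Matrix (Fin d) (Fin d) ℝ) : (quadPoly M).totalDegree ≤ 2 :=
  totalDegree_formPoly_le M fun _ => (totalDegree_X _).le

theorem formPoly_add (P Q : Matrix ι ι ℝ) (w : ι → MvPolynomial (Fin d) ℝ) :
    formPoly (P + Q) w = formPoly P w + formPoly Q w := by
  simp only [formPoly, Matrix.add_apply, C_add, add_mul, Finset.sum_add_distrib]

theorem formPoly_smul (c : ℝ) (Q : Matrix ι ι ℝ) (w : ι → MvPolynomial (Fin d) ℝ) :
    formPoly (c • Q) w = c • formPoly Q w := by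
  simp only [formPoly, Matrix.smul_apply, smul_eq_mul, C_mul, mul_assoc, Finset.smul_sum,
    smul_eq_C_mul]

/-- `formPoly` as a linear map in the matrix. -/
noncomputable def formPolyₗ (w : ι → MvPolynomial (Fin d) ℝ) :
    Matrix ι ι ℝ →ₗ[ℝ] MvPolynomial (Fin d) ℝ where
  toFun Q := formPoly Q w
  map_add' P Q := formPoly_add P Q w
  map_smul' c Q := formPoly_smul c Q w

theorem formPolyₗ_apply (w : ι → MvPolynomial (Fin d) ℝ) (Q : Matrix ι ι ℝ) :
    formPolyₗ w Q = formPoly Q w := rfl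

theorem formPoly_one [DecidableEq ι] (w : ι → MvPolynomial (Fin d) ℝ) :
    formPoly (1 : Matrix ι ι ℝ) w = ∑ i, w i ^ 2 := by
  simp only [formPoly]
  refine Finset.sum_congr rfl fun i _ => ?_
  rw [Finset.sum_eq_single i]
  · simp [pow_two]
  · intro j _ hj
    simp [Matrix.one_apply_ne hj.symm]
  · simp

theorem formPoly_transpose_mul (A B : Matrix ι ι ℝ) (w : ι → MvPolynomial (Fin d) ℝ) :
    formPoly (A.transpose * B) w = ∑ r, (∑ i, C (A r i) * w i) * (∑ j, C (B r j) * w j) := by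
  have h : ∀ r, (∑ i, C (A r i) * w i) * (∑ j, C (B r j) * w j)
      = ∑ i, ∑ j, C (A r i) * w i * (C (B r j) * w j) := fun r => Finset.sum_mul_sum ..
  simp only [h]
  rw [Finset.sum_comm]
  refine Finset.sum_congr rfl fun i _ => ?_
  rw [Finset.sum_comm]
  refine Finset.sum_congr rfl fun j _ => ?_
  simp only [Matrix.mul_apply, Matrix.transpose_apply, map_sum, Finset.sum_mul, C_mul]
  refine Finset.sum_congr rfl fun r _ => ?_
  ring

theorem quadPoly_transpose_mul (A B : Matrix (Fin d) (Fin d) ℝ) :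
    quadPoly (A.transpose * B) = ∑ r, linPoly (fun a => A r a) * linPoly (fun a => B r a) :=
  formPoly_transpose_mul A B X

theorem quadPoly_transpose (A : Matrix (Fin d) (Fin d) ℝ) :
    quadPoly A.transpose = quadPoly A := by
  simp only [quadPoly, Matrix.transpose_apply]
  rw [Finset.sum_comm]
  refine Finset.sum_congr rfl fun i _ => Finset.sum_congr rfl fun j _ => by ring

theorem sq_mem_sosDeg {k : ℕ} {q : MvPolynomial (Fin d) ℝ} (h : q.totalDegree ≤ k) :
    q ^ 2 ∈ sosDeg d k :=
  AddSubmonoid.subset_closure ⟨q, h, rfl⟩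

theorem mul_mem_sosDeg {k l : ℕ} {p q : MvPolynomial (Fin d) ℝ} (hp : p ∈ sosDeg d k)
    (hq : q ∈ sosDeg d l) : p * q ∈ sosDeg d (k + l) := by
  induction hp using AddSubmonoid.closure_induction with
  | zero => simp
  | add x y _ _ hx hy => rw [add_mul]; exact add_mem hx hy
  | mem x hx =>
    obtain ⟨a, ha, rfl⟩ := hx
    induction hq using AddSubmonoid.closure_induction with
    | zero => simp
    | add x y _ _ hx hy => rw [mul_add]; exact add_mem hx hy
    | mem y hy =>
      obtain ⟨b, hb, rfl⟩ := hy
      rw [← mul_pow]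
      exact sq_mem_sosDeg ((totalDegree_mul _ _).trans (by omega))

theorem pow_mem_sosDeg {k : ℕ} {p : MvPolynomial (Fin d) ℝ} (hp : p ∈ sosDeg d k) (n : ℕ) :
    p ^ n ∈ sosDeg d (n * k) := by
  induction n with
  | zero =>
    have := sq_mem_sosDeg (d := d) (k := 0) (q := 1) (by simp)
    simpa using this
  | succ n ih =>
    rw [pow_succ, add_mul, one_mul]
    exact mul_mem_sosDeg ih hp

theorem smul_mem_sosDeg {k : ℕ} {p : MvPolynomial (Fin d) ℝ} (hp : p ∈ sosDeg d k) {c : ℝ}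
    (hc : 0 ≤ c) : c • p ∈ sosDeg d k := by
  have h : (C √c : MvPolynomial (Fin d) ℝ) ^ 2 ∈ sosDeg d 0 := sq_mem_sosDeg (by simp)
  have := mul_mem_sosDeg h hp
  rwa [zero_add, ← C_pow, Real.sq_sqrt hc, ← smul_eq_C_mul] at this

theorem formPoly_mem_sosDeg [DecidableEq ι] {Q : Matrix ι ι ℝ} (hQ : Q.PosSemidef) {k : ℕ}
    {w : ι → MvPolynomial (Fin d) ℝ} (hw : ∀ i, (w i).totalDegree ≤ k) :
    formPoly Q w ∈ sosDeg d k := by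
  obtain ⟨A, rfl⟩ := hQ.exists_eq_transpose_mul_self
  rw [formPoly_transpose_mul]
  refine sum_mem fun r _ => ?_
  rw [← pow_two]
  refine sq_mem_sosDeg (totalDegree_finsetSum_le fun i _ => (totalDegree_mul _ _).trans ?_)
  rw [totalDegree_C, zero_add]
  exact hw i

theorem quadPoly_mem_sosDeg {M : Matrix (Fin d) (Fin d) ℝ} (hM : M.PosSemidef) :
    quadPoly M ∈ sosDeg d 1 :=
  formPoly_mem_sosDeg hM fun _ => (totalDegree_X _).le

/-- The Cauchy–Schwarz inequality is a sum of squares. -/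
theorem quadPoly_mul_sub_sq_mem_sosDeg (A B : Matrix (Fin d) (Fin d) ℝ) :
    quadPoly (A.transpose * A) * quadPoly (B.transpose * B) - quadPoly (A.transpose * B) ^ 2
      ∈ sosDeg d 2 := by
  obtain ⟨y, hy⟩ : ∃ y : Fin d → MvPolynomial (Fin d) ℝ, ∀ r, y r = linPoly fun a => A r a :=
    ⟨_, fun _ => rfl⟩
  obtain ⟨z, hz⟩ : ∃ z : Fin d → MvPolynomial (Fin d) ℝ, ∀ r, z r = linPoly fun a => B r a :=
    ⟨_, fun _ => rfl⟩
  have hy' : ∀ r, (y r).totalDegree ≤ 1 := fun r => hy r ▸ totalDegree_linPoly_le _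
  have hz' : ∀ r, (z r).totalDegree ≤ 1 := fun r => hz r ▸ totalDegree_linPoly_le _
  simp only [quadPoly_transpose_mul, ← hy, ← hz]
  -- Lagrange's identity; the double sum counts each pair twice, whence the factor 1/2.
  have e : (∑ r, y r * y r) * (∑ r, z r * z r) - (∑ r, y r * z r) ^ 2
      = (1 / 2 : ℝ) • ∑ r, ∑ s, (y r * z s - y s * z r) ^ 2 := by
    have h1 : ∑ r, ∑ s, (y r * z s - y s * z r) ^ 2
        = (2 : ℝ) • ((∑ r, y r * y r) * (∑ r, z r * z r) - (∑ r, y r * z r) ^ 2) := by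
      have h2 : ∀ r s, (y r * z s - y s * z r) ^ 2 = y r * y r * (z s * z s)
          + z r * z r * (y s * y s) - 2 * ((y r * z r) * (y s * z s)) := fun r s => by ring
      simp only [h2, Finset.sum_sub_distrib, Finset.sum_add_distrib, ← Finset.mul_sum,
        ← Finset.sum_mul]
      rw [two_smul]
      ring
    rw [h1, smul_smul]
    norm_num
  rw [e]
  refine smul_mem_sosDeg (sum_mem fun r _ => sum_mem fun s _ => sq_mem_sosDeg ?_) (by norm_num)
  have h1 := totalDegree_mul (y r) (z s)
  have h2 := totalDegree_mul (y s) (z r)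
  have := hy' r; have := hy' s; have := hz' r; have := hz' s
  exact (totalDegree_sub _ _).trans (max_le (by omega) (by omega))

end MvPolynomial

namespace IsSpherePseudoexpectation

open MvPolynomial

variable {d ℓ : ℕ} {E : MvPolynomial (Fin d) ℝ →ₗ[ℝ] ℝ} (hE : IsSpherePseudoexpectation ℓ E)

include hE

theorem nonneg_of_mem_sosDeg {k : ℕ} (hk : 2 * k ≤ ℓ) {p : MvPolynomial (Fin d) ℝ}
    (hp : p ∈ sosDeg d k) : 0 ≤ E p := by
  induction hp using AddSubmonoid.closure_induction with
  | zero => simp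
  | add x y _ _ hx hy => rw [map_add]; exact add_nonneg hx hy
  | mem x hx =>
    obtain ⟨q, hq, rfl⟩ := hx
    exact hE.sq_nonneg q (by omega)

theorem le_of_sub_mem_sosDeg {k : ℕ} (hk : 2 * k ≤ ℓ) {p q : MvPolynomial (Fin d) ℝ}
    (h : q - p ∈ sosDeg d k) : E p ≤ E q := by
  have := hE.nonneg_of_mem_sosDeg hk h
  rw [map_sub] at this
  linarith

theorem sq_map_mul_le {p q : MvPolynomial (Fin d) ℝ} (hp : 2 * p.totalDegree ≤ ℓ)
    (hq : 2 * q.totalDegree ≤ ℓ) : E (p * q) ^ 2 ≤ E (p ^ 2) * E (q ^ 2) := by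
  have h : ∀ t : ℝ, 0 ≤ E (q ^ 2) * (t * t) + 2 * E (p * q) * t + E (p ^ 2) := by
    intro t
    have h1 := hE.sq_nonneg (p + t • q) (by
      have := totalDegree_add p (t • q)
      have h2 := totalDegree_smul_le t q
      omega)
    have e : (p + t • q) ^ 2 = p ^ 2 + (2 * t) • (p * q) + (t * t) • q ^ 2 := by
      simp only [smul_eq_C_mul, C_mul, map_ofNat]
      ring
    rw [e, map_add, map_add, map_smul, map_smul, smul_eq_mul, smul_eq_mul] at h1
    linarith
  have := discrim_le_zero h
  rw [discrim] at this
  linarith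

theorem map_sumSq_mul {q : MvPolynomial (Fin d) ℝ} (hq : q.totalDegree + 2 ≤ ℓ) :
    E ((∑ a, X a ^ 2) * q) = E q := by
  have := hE.sphere q hq
  rw [sub_mul, one_mul, map_sub] at this
  linarith

theorem map_formPoly_nonneg {ι : Type*} [Fintype ι] [DecidableEq ι] {Q : Matrix ι ι ℝ}
    (hQ : Q.PosSemidef) {k : ℕ} (hk : 2 * k ≤ ℓ) {w : ι → MvPolynomial (Fin d) ℝ}
    (hw : ∀ i, (w i).totalDegree ≤ k) : 0 ≤ E (formPoly Q w) :=
  hE.nonneg_of_mem_sosDeg hk (formPoly_mem_sosDeg hQ hw)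

end IsSpherePseudoexpectation

end

/-! ### Degrees of the squares in a sum-of-squares certificate. -/

section

open Filter Topology

set_option linter.unusedSectionVars false

namespace MvPolynomial

variable {d : ℕ}

theorem IsHomogeneous.eval_mul_left {p : MvPolynomial (Fin d) ℝ} {n : ℕ} (hp : p.IsHomogeneous n)
    (c : ℝ) (x : Fin d → ℝ) : eval (fun i => c * x i) p = c ^ n * eval x p := by
  rw [eval_eq, eval_eq, Finset.mul_sum]
  refine Finset.sum_congr rfl fun m hm => ?_
  have h1 : m.degree = n := by
    have := hp (mem_support_iff.1 hm)
    rw [Finsupp.degree_eq_weight_one]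
    exact this
  have h2 : ∑ i ∈ m.support, m i = n := h1
  simp only [mul_pow, Finset.prod_mul_distrib, Finset.prod_pow_eq_pow_sum, h2]
  ring

theorem sum_homogeneousComponent_of_le {p : MvPolynomial (Fin d) ℝ} {N : ℕ}
    (h : p.totalDegree ≤ N) : ∑ j ∈ Finset.range (N + 1), homogeneousComponent j p = p := by
  conv_rhs => rw [← sum_homogeneousComponent p]
  symm
  refine Finset.sum_subset (fun j hj => ?_) fun j _ hj => ?_
  · simp only [Finset.mem_range] at hj ⊢; omega
  · simp only [Finset.mem_range, not_lt] at hj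
    exact homogeneousComponent_eq_zero _ _ (by omega)

/-- The leading form of a nonnegative polynomial is nonnegative. -/
theorem eval_homogeneousComponent_nonneg {p : MvPolynomial (Fin d) ℝ} (hp : ∀ x, 0 ≤ eval x p)
    {N : ℕ} (hN : p.totalDegree ≤ N) (x : Fin d → ℝ) :
    0 ≤ eval x (homogeneousComponent N p) := by
  -- For t > 0 this is t^N p(x/t), and at t = 0 it extends continuously to the degree-N component at
  -- x.
  set g : ℝ → ℝ := fun t =>
    ∑ j ∈ Finset.range (N + 1), t ^ (N - j) * eval x (homogeneousComponent j p) with hg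
  have hc : Continuous g := by fun_prop
  have h0 : g 0 = eval x (homogeneousComponent N p) := by
    rw [hg]
    dsimp only
    rw [Finset.sum_eq_single N]
    · simp
    · intro j hj hne
      simp only [Finset.mem_range] at hj
      rw [zero_pow (by omega), zero_mul]
    · simp
  have hpos : ∀ t : ℝ, 0 < t → 0 ≤ g t := by
    intro t ht
    have e : g t = t ^ N * eval (fun i => t⁻¹ * x i) p := by
      conv_rhs => rw [← sum_homogeneousComponent_of_le hN]
      rw [map_sum, Finset.mul_sum]
      refine Finset.sum_congr rfl fun j hj => ?_
      rw [(homogeneousComponent_isHomogeneous j p).eval_mul_left, ← mul_assoc]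
      congr 1
      simp only [Finset.mem_range] at hj
      rw [inv_pow, ← div_eq_mul_inv, eq_div_iff (by positivity), ← pow_add]
      congr 1
      omega
    rw [e]
    exact mul_nonneg (by positivity) (hp _)
  rw [← h0]
  refine ge_of_tendsto (hc.continuousWithinAt (s := Set.Ioi 0) (x := 0)) ?_
  filter_upwards [self_mem_nhdsWithin] with t ht using hpos t ht

theorem homogeneousComponent_totalDegree_ne_zero {p : MvPolynomial (Fin d) ℝ}
    (h : 0 < p.totalDegree) : homogeneousComponent p.totalDegree p ≠ 0 := by
  intro h0
  have := sum_homogeneousComponent p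
  rw [Finset.sum_range_succ, h0, add_zero] at this
  have h1 : p.totalDegree ≤ p.totalDegree - 1 := by
    conv_lhs => rw [← this]
    refine totalDegree_finsetSum_le fun j hj => ?_
    simp only [Finset.mem_range] at hj
    exact ((homogeneousComponent_isHomogeneous j p).totalDegree_le).trans (by omega)
  omega

/-- Leading forms of nonnegative polynomials cannot cancel: if the degree dropped, the top
components would be nonnegative with sum zero, so both would vanish. -/
theorem totalDegree_le_totalDegree_add_of_nonneg {p q : MvPolynomial (Fin d) ℝ}
    (hp : ∀ x, 0 ≤ eval x p) (hq : ∀ x, 0 ≤ eval x q) :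
    p.totalDegree ≤ (p + q).totalDegree ∧ q.totalDegree ≤ (p + q).totalDegree := by
  by_contra hcon
  set N := max p.totalDegree q.totalDegree with hN
  have hlt : (p + q).totalDegree < N := by omega
  have h0 : homogeneousComponent N p + homogeneousComponent N q = 0 := by
    rw [← map_add]
    exact homogeneousComponent_eq_zero _ _ hlt
  have hpN := eval_homogeneousComponent_nonneg hp (le_max_left p.totalDegree q.totalDegree)
  have hqN := eval_homogeneousComponent_nonneg hq (le_max_right p.totalDegree q.totalDegree)
  have hev : ∀ x, eval x (homogeneousComponent N p) + eval x (homogeneousComponent N q) = 0 := by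
    intro x
    rw [← map_add, h0, map_zero]
  have hp0 : homogeneousComponent N p = 0 := funext fun x => by
    have h1 := hpN x; have h2 := hqN x; have h3 := hev x
    rw [map_zero]; linarith
  have hq0 : homogeneousComponent N q = 0 := funext fun x => by
    have h1 := hpN x; have h2 := hqN x; have h3 := hev x
    rw [map_zero]; linarith
  rcases max_choice p.totalDegree q.totalDegree with h | h
  · rw [hN, h] at hp0
    exact homogeneousComponent_totalDegree_ne_zero (by omega) hp0
  · rw [hN, h] at hq0
    exact homogeneousComponent_totalDegree_ne_zero (by omega) hq0

theorem eval_nonneg_of_isSumSq {p : MvPolynomial (Fin d) ℝ} (hp : IsSumSq p) (x : Fin d → ℝ) :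
    0 ≤ eval x p := by
  induction hp with
  | zero => simp
  | sq_add a _ ih =>
    rw [map_add, map_mul]
    exact add_nonneg (mul_self_nonneg _) ih

/-- The relation ⪯ puts no bound on the degrees of the squares, while a pseudoexpectation is
nonnegative only on squares of low degree. The absence of cancellation bridges this gap. -/
theorem mem_sosDeg_of_isSumSq {p : MvPolynomial (Fin d) ℝ} (hp : IsSumSq p) {k : ℕ}
    (hk : p.totalDegree ≤ 2 * k) : p ∈ sosDeg d k := by
  induction hp with
  | zero => exact zero_mem _
  | sq_add a hs ih =>
    obtain ⟨h1, h2⟩ := totalDegree_le_totalDegree_add_of_nonneg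
      (eval_nonneg_of_isSumSq (IsSumSq.mul_self a)) (eval_nonneg_of_isSumSq hs)
    refine add_mem ?_ (ih (h2.trans hk))
    rw [← pow_two]
    refine sq_mem_sosDeg ?_
    rcases eq_or_ne a 0 with rfl | ha
    · simp
    · rw [totalDegree_mul_of_isDomain ha ha] at h1
      omega

end MvPolynomial

end

/-! ### Compactness of pseudomoments, attainment and continuity of the maximum. -/

section

open Filter Topology

set_option linter.unusedSectionVars false

theorem Finsupp.exists_add_of_degree_le {σ : Type*} (s t : ℕ) (m : σ →₀ ℕ) (h : m.degree ≤ s + t) :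
    ∃ a b : σ →₀ ℕ, m = a + b ∧ a.degree ≤ s ∧ b.degree ≤ t := by
  induction s generalizing m with
  | zero => exact ⟨0, m, by simp, by simp, by simpa using h⟩
  | succ s ih =>
    rcases eq_or_ne m 0 with rfl | hm
    · exact ⟨0, 0, by simp, by simp, by simp⟩
    · obtain ⟨i, hi⟩ := Finsupp.ne_iff.1 hm
      have h1 : m = single i 1 + (m - single i 1) := by
        rw [add_tsub_cancel_of_le]
        rw [Finsupp.single_le_iff]
        exact Nat.one_le_iff_ne_zero.2 hi
      have h2 : m.degree = 1 + (m - single i 1).degree := by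
        conv_lhs => rw [h1]
        rw [map_add, Finsupp.degree_single]
      obtain ⟨a, b, hab, ha, hb⟩ := ih (m - single i 1) (by omega)
      refine ⟨single i 1 + a, b, ?_, ?_, hb⟩
      · rw [add_assoc, ← hab]; exact h1
      · rw [map_add, Finsupp.degree_single]; omega

namespace IsSpherePseudoexpectation

open MvPolynomial

variable {d k : ℕ} {E : MvPolynomial (Fin d) ℝ →ₗ[ℝ] ℝ} (hE : IsSpherePseudoexpectation (2 * k) E)

include hE

/-- If m = x_i m', then Ẽ m'² = Ẽ(∑ x_a² m'²) by the sphere constraint; Ẽ m² is one of the summands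
and the others are nonnegative. Variables are peeled off in this way. -/
theorem map_monomial_sq_le_one (n : ℕ) (m : Fin d →₀ ℕ) (hm : m.degree = n) (hn : n ≤ k) :
    E ((monomial m 1) ^ 2) ≤ 1 := by
  induction n generalizing m with
  | zero =>
    have h0 : m = 0 := (Finsupp.degree_eq_zero_iff m).1 hm
    subst h0
    simp [hE.map_one]
  | succ n ih =>
    have hm0 : m ≠ 0 := by rintro rfl; simp at hm
    obtain ⟨i, hi⟩ := Finsupp.ne_iff.1 hm0
    have h1 : m = Finsupp.single i 1 + (m - Finsupp.single i 1) := by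
      rw [add_tsub_cancel_of_le]
      rw [Finsupp.single_le_iff]
      exact Nat.one_le_iff_ne_zero.2 hi
    generalize m - Finsupp.single i 1 = m' at h1
    subst h1
    rw [map_add, Finsupp.degree_single] at hm
    have hq : (monomial m' (1 : ℝ)).totalDegree ≤ n := by
      refine (totalDegree_monomial_le _ _).trans ?_
      change m'.degree ≤ n
      omega
    refine le_trans ?_ (ih m' (by omega) (by omega))
    rw [← hE.map_sumSq_mul (q := (monomial m' (1 : ℝ)) ^ 2) (by
      have := totalDegree_pow (monomial m' (1 : ℝ)) 2
      omega)]
    refine hE.le_of_sub_mem_sosDeg (k := k) le_rfl ?_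
    have e : (∑ a, (X a : MvPolynomial (Fin d) ℝ) ^ 2) * (monomial m' 1) ^ 2
        - (monomial (Finsupp.single i 1 + m') 1) ^ 2
        = ∑ a ∈ Finset.univ.erase i, (X a * monomial m' 1) ^ 2 := by
      rw [← Finset.add_sum_erase _ _ (Finset.mem_univ i), add_mul, Finset.sum_mul,
        monomial_single_add, pow_one, mul_pow, add_sub_cancel_left]
      simp only [mul_pow]
    rw [e]
    refine sum_mem fun a _ => sq_mem_sosDeg ((totalDegree_mul _ _).trans ?_)
    rw [totalDegree_X]
    omega

/-- The monomial splits into two factors of degree at most k, to which Cauchy–Schwarz for Ẽ applies.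
-/
theorem abs_map_monomial_le_one {m : Fin d →₀ ℕ} (hm : m.degree ≤ 2 * k) :
    |E (monomial m 1)| ≤ 1 := by
  obtain ⟨a, b, rfl, ha, hb⟩ := Finsupp.exists_add_of_degree_le k k m (by omega)
  have hd : ∀ c : Fin d →₀ ℕ, c.degree ≤ k → 2 * (monomial c (1 : ℝ)).totalDegree ≤ 2 * k := by
    intro c hc
    have : (monomial c (1 : ℝ)).totalDegree ≤ c.degree := totalDegree_monomial_le _ _
    omega
  have h1 := hE.sq_map_mul_le (hd a ha) (hd b hb)
  rw [monomial_mul, one_mul] at h1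
  have h2 := hE.map_monomial_sq_le_one _ a rfl ha
  have h3 := hE.map_monomial_sq_le_one _ b rfl hb
  have h4 := hE.sq_nonneg _ (hd b hb)
  rw [← sq_le_one_iff_abs_le_one]
  nlinarith

end IsSpherePseudoexpectation

namespace MvPolynomial

variable {d : ℕ}

theorem degree_le_of_mem_support {p : MvPolynomial (Fin d) ℝ} {m : Fin d →₀ ℕ}
    (hm : m ∈ p.support) : m.degree ≤ p.totalDegree :=
  le_totalDegree hm

/-- The linear functional on polynomials with prescribed values on monomials. -/
noncomputable def momentFunctional (x : (Fin d →₀ ℕ) → ℝ) : MvPolynomial (Fin d) ℝ →ₗ[ℝ] ℝ :=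
  (basisMonomials (Fin d) ℝ).constr ℝ x

theorem map_eq_sum_coeff (E : MvPolynomial (Fin d) ℝ →ₗ[ℝ] ℝ) (p : MvPolynomial (Fin d) ℝ) :
    E p = ∑ m ∈ p.support, p.coeff m * E (monomial m 1) := by
  conv_lhs => rw [p.as_sum]
  rw [map_sum]
  refine Finset.sum_congr rfl fun m _ => ?_
  rw [← smul_eq_mul, ← map_smul, smul_monomial, smul_eq_mul, mul_one]

theorem momentFunctional_monomial (x : (Fin d →₀ ℕ) → ℝ) (m : Fin d →₀ ℕ) :
    momentFunctional x (monomial m 1) = x m := by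
  have := (basisMonomials (Fin d) ℝ).constr_basis ℝ x m
  rwa [coe_basisMonomials] at this

theorem continuous_momentFunctional (p : MvPolynomial (Fin d) ℝ) :
    Continuous fun x => momentFunctional x p := by
  have : (fun x => momentFunctional x p) = fun x => ∑ m ∈ p.support, p.coeff m * x m := by
    funext x
    rw [map_eq_sum_coeff]
    simp only [momentFunctional_monomial]
  rw [this]
  fun_prop

/-- The moment sequences of pseudoexpectations. -/
def pseudoMoments (d k : ℕ) : Set ((Fin d →₀ ℕ) → ℝ) :=
  Set.univ.pi (fun _ => Set.Icc (-1) 1) ∩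
    {x | IsSpherePseudoexpectation (2 * k) (momentFunctional x)}

/-- Each condition involves finitely many coordinates, so it is closed in the product topology, and
the cube is compact by Tychonoff. -/
theorem isCompact_pseudoMoments (d k : ℕ) : IsCompact (pseudoMoments d k) := by
  refine (isCompact_univ_pi fun _ => isCompact_Icc).inter_right ?_
  have : {x : (Fin d →₀ ℕ) → ℝ | IsSpherePseudoexpectation (2 * k) (momentFunctional x)}
      = {x | momentFunctional x 1 = 1}
        ∩ ((⋂ (q : MvPolynomial (Fin d) ℝ) (_ : 2 * q.totalDegree ≤ 2 * k),
            {x | 0 ≤ momentFunctional x (q ^ 2)})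
        ∩ ⋂ (q : MvPolynomial (Fin d) ℝ) (_ : q.totalDegree + 2 ≤ 2 * k),
            {x | momentFunctional x ((∑ a, X a ^ 2 - 1) * q) = 0}) := by
    ext x
    simp only [Set.mem_ofPred_eq, Set.mem_inter_iff, Set.mem_iInter]
    exact ⟨fun h => ⟨h.1, h.2, h.3⟩, fun h => ⟨h.1, h.2.1, h.2.2⟩⟩
  rw [this]
  refine (isClosed_eq (continuous_momentFunctional _) continuous_const).inter
    (IsClosed.inter ?_ ?_)
  · exact isClosed_iInter fun q => isClosed_iInter fun _ =>
      isClosed_le continuous_const (continuous_momentFunctional _)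
  · exact isClosed_iInter fun q => isClosed_iInter fun _ =>
      isClosed_eq (continuous_momentFunctional _) continuous_const

theorem pseudoValues_eq_image {k : ℕ} {p : MvPolynomial (Fin d) ℝ} (hp : p.totalDegree ≤ 2 * k) :
    pseudoValues (2 * k) p = (fun x => momentFunctional x p) '' pseudoMoments d k := by
  ext t
  constructor
  · rintro ⟨E, hE, rfl⟩
    -- The values of `E` above degree 2k are arbitrary and possibly large; setting them to 0 puts
    -- the sequence in the cube and changes no condition.
    set x : (Fin d →₀ ℕ) → ℝ := fun m => if m.degree ≤ 2 * k then E (monomial m 1) else 0 with hx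
    have hxE : ∀ q : MvPolynomial (Fin d) ℝ, q.totalDegree ≤ 2 * k →
        momentFunctional x q = E q := by
      intro q hq
      rw [map_eq_sum_coeff, map_eq_sum_coeff E]
      refine Finset.sum_congr rfl fun m hm => ?_
      rw [momentFunctional_monomial, hx]
      dsimp only
      rw [if_pos ((degree_le_of_mem_support hm).trans hq)]
    refine ⟨x, ⟨fun m _ => ?_, ?_⟩, hxE p hp⟩
    · rw [hx]
      dsimp only
      split_ifs with h
      · exact abs_le.1 (hE.abs_map_monomial_le_one h)
      · simp
    · refine ⟨?_, fun q hq => ?_, fun q hq => ?_⟩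
      · rw [hxE 1 (by simp)]; exact hE.map_one
      · rw [hxE _ ((totalDegree_pow _ _).trans hq)]
        exact hE.sq_nonneg q hq
      · rw [hxE]
        · exact hE.sphere q hq
        · have h1 : (∑ a, X a ^ 2 - 1 : MvPolynomial (Fin d) ℝ).totalDegree ≤ 2 := by
            refine (totalDegree_sub _ _).trans (max_le ?_ (by simp))
            exact totalDegree_finsetSum_le fun a _ => by simp
          exact (totalDegree_mul _ _).trans (by omega)
  · rintro ⟨x, hx, rfl⟩
    exact ⟨_, hx.2, rfl⟩

theorem isSpherePseudoexpectation_eval {x : Fin d → ℝ} (hx : ∑ a, x a ^ 2 = 1) (ℓ : ℕ) :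
    IsSpherePseudoexpectation ℓ (aeval (R := ℝ) x).toLinearMap where
  map_one := by simp
  sq_nonneg q _ := by simp only [AlgHom.toLinearMap_apply, map_pow]; positivity
  sphere q _ := by simp [hx]

theorem isGreatest_pseudoMax (hd : 0 < d) {k : ℕ} {p : MvPolynomial (Fin d) ℝ}
    (hp : p.totalDegree ≤ 2 * k) :
    IsGreatest (pseudoValues (2 * k) p) (pseudoMax (2 * k) p) := by
  have hne : (pseudoValues (2 * k) p).Nonempty := by
    refine ⟨_, _, isSpherePseudoexpectation_eval (x := Pi.single ⟨0, hd⟩ 1) ?_ _, rfl⟩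
    rw [Finset.sum_eq_single ⟨0, hd⟩]
    · simp
    · intro b _ hb
      simp [hb]
    · simp
  have hc : IsCompact (pseudoValues (2 * k) p) := by
    rw [pseudoValues_eq_image hp]
    exact (isCompact_pseudoMoments d k).image (continuous_momentFunctional p)
  exact hc.isGreatest_sSup hne

/-- The products `u a * u b`. -/
noncomputable def tensorVars (d : ℕ) (i : Fin d × Fin d) : MvPolynomial (Fin d) ℝ := X i.1 * X i.2

theorem totalDegree_tensorVars_le (i : Fin d × Fin d) : (tensorVars d i).totalDegree ≤ 2 := by
  refine (totalDegree_mul _ _).trans ?_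
  simp

open Kronecker in
theorem formPoly_kronecker (A B : Matrix (Fin d) (Fin d) ℝ) :
    formPoly (A.kronecker B) (tensorVars d) = quadPoly A * quadPoly B := by
  simp only [formPoly, quadPoly, tensorVars, Fintype.sum_prod_type, Matrix.kronecker,
    Matrix.kroneckerMap_apply, C_mul, Finset.sum_mul_sum]
  refine Finset.sum_congr rfl fun a _ => Finset.sum_congr rfl fun b _ =>
    Finset.sum_congr rfl fun c _ => Finset.sum_congr rfl fun e _ => ?_
  ring

theorem abs_map_formPoly_tensorVars_le {E : MvPolynomial (Fin d) ℝ →ₗ[ℝ] ℝ}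
    (hE : IsSpherePseudoexpectation (2 * 4) E) (Q : Matrix (Fin d × Fin d) (Fin d × Fin d) ℝ) :
    |E (formPoly Q (tensorVars d))| ≤ ∑ i, ∑ j, |Q i j| := by
  simp only [formPoly, map_sum]
  refine (Finset.abs_sum_le_sum_abs _ _).trans (Finset.sum_le_sum fun i _ => ?_)
  refine (Finset.abs_sum_le_sum_abs _ _).trans (Finset.sum_le_sum fun j _ => ?_)
  have e : C (Q i j) * tensorVars d i * tensorVars d j
      = Q i j • monomial (Finsupp.single i.1 1 + Finsupp.single i.2 1 +
        (Finsupp.single j.1 1 + Finsupp.single j.2 1)) (1 : ℝ) := by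
    rw [smul_eq_C_mul, mul_assoc]
    simp only [tensorVars, X, monomial_mul, mul_one]
  rw [e, map_smul, smul_eq_mul, abs_mul]
  refine mul_le_of_le_one_right (abs_nonneg _) (hE.abs_map_monomial_le_one ?_)
  simp only [map_add, Finsupp.degree_single]
  norm_num

theorem totalDegree_formPoly_tensorVars_le (Q : Matrix (Fin d × Fin d) (Fin d × Fin d) ℝ) :
    (formPoly Q (tensorVars d)).totalDegree ≤ 2 * 4 :=
  (totalDegree_formPoly_le Q totalDegree_tensorVars_le).trans (by norm_num)

/-- The maximiser for P is a competitor for Q, and degree-four pseudomoments are at most 1 in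
absolute value. Used in both directions, this makes the maximum Lipschitz in the entries, hence
measurable in the samples. -/
theorem pseudoMax_formPoly_le_add (hd : 0 < d) (P Q : Matrix (Fin d × Fin d) (Fin d × Fin d) ℝ) :
    pseudoMax (2 * 4) (formPoly P (tensorVars d)) ≤
      pseudoMax (2 * 4) (formPoly Q (tensorVars d)) + ∑ i, ∑ j, |P i j - Q i j| := by
  obtain ⟨⟨E, hE, h⟩, -⟩ := isGreatest_pseudoMax hd (totalDegree_formPoly_tensorVars_le P)
  have h1 : E (formPoly Q (tensorVars d)) ≤ _ :=
    (isGreatest_pseudoMax hd (totalDegree_formPoly_tensorVars_le Q)).2 ⟨E, hE, rfl⟩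
  have h2 := (abs_le.1 (abs_map_formPoly_tensorVars_le hE (P - Q))).2
  simp only [← formPolyₗ_apply, map_sub] at h2 h1 h ⊢
  simp only [Matrix.sub_apply] at h2
  linarith

theorem continuous_pseudoMax_formPoly (hd : 0 < d) :
    Continuous fun Q => pseudoMax (2 * 4) (formPoly Q (tensorVars d)) := by
  rw [continuous_iff_continuousAt]
  intro Q
  have hc : Continuous fun P : Matrix (Fin d × Fin d) (Fin d × Fin d) ℝ =>
      ∑ i, ∑ j, |P i j - Q i j| := by
    refine continuous_finsetSum _ fun i _ => continuous_finsetSum _ fun j _ => ?_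
    exact ((Matrix.continuous_entry i j).sub continuous_const).abs
  have h0 := hc.tendsto Q
  simp only [sub_self, abs_zero, Finset.sum_const_zero] at h0
  refine tendsto_iff_dist_tendsto_zero.2 (squeeze_zero (fun _ => dist_nonneg) (fun P => ?_) h0)
  rw [Real.dist_eq, abs_le]
  have h1 := pseudoMax_formPoly_le_add hd P Q
  have h2 := pseudoMax_formPoly_le_add hd Q P
  simp only [abs_sub_comm (Q _ _)] at h2
  constructor <;> linarith

end MvPolynomial

end

/-! ### Cauchy–Schwarz for integrals, and the spectral norm through positive semidefiniteness. -/

section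

open Filter Topology

set_option linter.unusedSectionVars false

/-- Cauchy–Schwarz obtained from the pointwise inequality 2√(FG) ≤ (B/A)F + (A/B)G. Adding ε to A
and B keeps the weights meaningful when one of them vanishes. -/
theorem integral_le_mul_of_sq_le {Ω : Type*} [MeasurableSpace Ω] {μ : Measure Ω} {h F G : Ω → ℝ}
    (hh : Integrable h μ) (hF : Integrable F μ) (hG : Integrable G μ) (hF0 : ∀ ω, 0 ≤ F ω)
    (hG0 : ∀ ω, 0 ≤ G ω) (hFG : ∀ ω, h ω ^ 2 ≤ F ω * G ω) {A B : ℝ} (hA : 0 ≤ A) (hB : 0 ≤ B)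
    (hFA : ∫ ω, F ω ∂μ ≤ A ^ 2) (hGB : ∫ ω, G ω ∂μ ≤ B ^ 2) : ∫ ω, h ω ∂μ ≤ A * B := by
  have key : ∀ ε : ℝ, 0 < ε → ∫ ω, h ω ∂μ ≤ (A + ε) * (B + ε) := by
    intro ε hε
    have hA' : 0 < A + ε := by linarith
    have hB' : 0 < B + ε := by linarith
    have hpt : ∀ ω, h ω ≤ (B + ε) / (2 * (A + ε)) * F ω + (A + ε) / (2 * (B + ε)) * G ω := by
      intro ω
      refine abs_le_of_sq_le_sq' ?_ ?_ |>.2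
      · refine (hFG ω).trans ?_
        have e : (B + ε) / (2 * (A + ε)) * F ω * ((A + ε) / (2 * (B + ε)) * G ω)
            = F ω * G ω / 4 := by field_simp; ring
        nlinarith [sq_nonneg ((B + ε) / (2 * (A + ε)) * F ω - (A + ε) / (2 * (B + ε)) * G ω)]
      · have := hF0 ω; have := hG0 ω; positivity
    calc ∫ ω, h ω ∂μ
        ≤ ∫ ω, ((B + ε) / (2 * (A + ε)) * F ω + (A + ε) / (2 * (B + ε)) * G ω) ∂μ :=
          integral_mono hh ((hF.const_mul _).add (hG.const_mul _)) hpt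
      _ = (B + ε) / (2 * (A + ε)) * ∫ ω, F ω ∂μ + (A + ε) / (2 * (B + ε)) * ∫ ω, G ω ∂μ := by
          rw [integral_add (hF.const_mul _) (hG.const_mul _), integral_const_mul,
            integral_const_mul]
      _ ≤ (B + ε) / (2 * (A + ε)) * (A + ε) ^ 2 + (A + ε) / (2 * (B + ε)) * (B + ε) ^ 2 := by
          gcongr
          · exact hFA.trans (by gcongr; linarith)
          · exact hGB.trans (by gcongr; linarith)
      _ = (A + ε) * (B + ε) := by field_simp; ring
  have hc : Tendsto (fun ε : ℝ => (A + ε) * (B + ε)) (𝓝[>] 0) (𝓝 (A * B)) := by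
    have : Continuous fun ε : ℝ => (A + ε) * (B + ε) := by fun_prop
    have h2 := this.tendsto 0
    simp only [add_zero] at h2
    exact h2.mono_left nhdsWithin_le_nhds
  refine ge_of_tendsto hc ?_
  filter_upwards [self_mem_nhdsWithin] with ε hε using key ε hε

theorem sq_integral_le_integral_sq {Ω : Type*} [MeasurableSpace Ω] {μ : Measure Ω}
    [IsProbabilityMeasure μ] {f : Ω → ℝ} (hf : Integrable f μ)
    (hf2 : Integrable (fun ω => f ω ^ 2) μ) :
    (∫ ω, f ω ∂μ) ^ 2 ≤ ∫ ω, f ω ^ 2 ∂μ := by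
  set s := ∫ ω, f ω ∂μ with hs
  have h1 : 0 ≤ ∫ ω, (f ω - s) ^ 2 ∂μ := integral_nonneg fun ω => sq_nonneg _
  have e : ∀ ω, (f ω - s) ^ 2 = f ω ^ 2 - 2 * s * f ω + s ^ 2 := fun ω => by ring
  simp only [e] at h1
  have hi : Integrable (fun ω => f ω ^ 2 - 2 * s * f ω) μ := hf2.sub (hf.const_mul _)
  rw [integral_add hi (integrable_const _), integral_sub hf2 (hf.const_mul _),
    integral_const_mul, integral_const] at h1
  simp only [probReal_univ, smul_eq_mul, one_mul, ← hs] at h1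
  nlinarith

namespace Matrix

variable {d : ℕ} {M : Matrix (Fin d) (Fin d) ℝ}

theorem dotProduct_self_eq_norm_sq (y : EuclideanSpace ℝ (Fin d)) : y.ofLp ⬝ᵥ y.ofLp = ‖y‖ ^ 2 := by
  rw [EuclideanSpace.norm_sq_eq]
  simp only [dotProduct, Real.norm_eq_abs, sq_abs]
  simp only [pow_two]

theorem IsSymm.dotProduct_sq_mulVec (hM : M.IsSymm) (y : Fin d → ℝ) :
    y ⬝ᵥ (M ^ 2 *ᵥ y) = (M *ᵥ y) ⬝ᵥ (M *ᵥ y) := by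
  rw [pow_two, ← mulVec_mulVec, dotProduct_mulVec, ← mulVec_transpose, hM.eq]

theorem posSemidef_sq_smul_one_sub_sq_iff (hM : M.IsSymm) {t : ℝ} (ht : 0 ≤ t) :
    (t ^ 2 • (1 : Matrix (Fin d) (Fin d) ℝ) - M ^ 2).PosSemidef ↔ spectralNorm₂ M ≤ t := by
  have hq : ∀ y : EuclideanSpace ℝ (Fin d),
      y.ofLp ⬝ᵥ ((t ^ 2 • (1 : Matrix (Fin d) (Fin d) ℝ) - M ^ 2) *ᵥ y.ofLp)
        = (t * ‖y‖) ^ 2 - ‖toEuclideanCLM (n := Fin d) (𝕜 := ℝ) M y‖ ^ 2 := by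
    intro y
    rw [sub_mulVec, dotProduct_sub, hM.dotProduct_sq_mulVec, smul_mulVec, one_mulVec,
      dotProduct_smul, dotProduct_self_eq_norm_sq, ← dotProduct_self_eq_norm_sq
        (toEuclideanCLM (n := Fin d) (𝕜 := ℝ) M y), smul_eq_mul, mul_pow]
    rfl
  constructor
  · intro h
    refine ContinuousLinearMap.opNorm_le_bound _ ht fun y => ?_
    have h1 := h.dotProduct_mulVec_nonneg y.ofLp
    rw [star_trivial, hq] at h1
    exact (abs_le_of_sq_le_sq' (sub_nonneg.1 h1) (by positivity)).2
  · intro h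
    refine PosSemidef.of_dotProduct_mulVec_nonneg ?_ fun y => ?_
    · have h1 : (t ^ 2 • (1 : Matrix (Fin d) (Fin d) ℝ) - M ^ 2).IsSymm :=
        (isSymm_one.smul _).sub (hM.pow 2)
      rw [IsHermitian, conjTranspose_eq_transpose_of_trivial, h1.eq]
    · have h1 := hq (WithLp.toLp 2 y)
      rw [star_trivial]
      change y ⬝ᵥ _ = _ at h1
      rw [h1]
      have h2 := (toEuclideanCLM (n := Fin d) (𝕜 := ℝ) M).le_of_opNorm_le h (WithLp.toLp 2 y)
      have h3 := norm_nonneg (toEuclideanCLM (n := Fin d) (𝕜 := ℝ) M (WithLp.toLp 2 y))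
      nlinarith

theorem spectralNorm₂_nonneg (M : Matrix (Fin d) (Fin d) ℝ) : 0 ≤ spectralNorm₂ M := norm_nonneg _

variable {ι : Type*} [Fintype ι] [DecidableEq ι]

theorem PosSemidef.sq_smul_one_sub_sq {A : Matrix ι ι ℝ} (hA : A.PosSemidef) {t : ℝ} (ht : 0 ≤ t)
    (h : (t • (1 : Matrix ι ι ℝ) - A).PosSemidef) :
    (t ^ 2 • (1 : Matrix ι ι ℝ) - A ^ 2).PosSemidef := by
  have e : t ^ 2 • (1 : Matrix ι ι ℝ) - A ^ 2
      = t • (t • (1 : Matrix ι ι ℝ) - A) + (t • A - A ^ 2) := by module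
  rw [e]
  exact (h.smul ht).add (hA.smul_sub_sq h)

theorem IsSymm.smul_one_sub_of_sq {A : Matrix ι ι ℝ} (hA : A.IsSymm) {t : ℝ} (ht : 0 ≤ t)
    (h : (t ^ 2 • (1 : Matrix ι ι ℝ) - A ^ 2).PosSemidef) :
    (t • (1 : Matrix ι ι ℝ) - A).PosSemidef := by
  obtain ⟨U, l, hU, hU', rfl⟩ := hA.exists_eq_mul_diagonal_mul
  have hone : ∀ c : ℝ, c • (1 : Matrix ι ι ℝ) = U * diagonal (fun _ => c) * Uᵀ := by
    intro c
    rw [← smul_one_eq_diagonal, mul_smul_comm, mul_one, smul_mul_assoc, hU']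
  have hsq : (U * diagonal l * Uᵀ) ^ 2 = U * diagonal (fun i => l i ^ 2) * Uᵀ := by
    calc _ = U * diagonal l * (Uᵀ * U) * diagonal l * Uᵀ := by rw [pow_two]; simp only [mul_assoc]
      _ = _ := by
        rw [hU, mul_one, mul_assoc U, diagonal_mul_diagonal]
        simp only [pow_two]
  rw [hsq, hone, ← sub_mul, ← mul_sub, diagonal_sub] at h
  rw [hone, ← sub_mul, ← mul_sub, diagonal_sub]
  refine posSemidef_mul_diagonal_mul fun i => ?_
  have := nonneg_of_posSemidef_mul_diagonal_mul hU h i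
  exact sub_nonneg.2 (abs_le_of_sq_le_sq' (sub_nonneg.1 this) ht).2

theorem PosSemidef.trace_smul_one_sub {A : Matrix ι ι ℝ} (hA : A.PosSemidef) :
    (A.trace • (1 : Matrix ι ι ℝ) - A).PosSemidef := by
  obtain ⟨U, l, hU, hU', rfl⟩ := hA.isSymm.exists_eq_mul_diagonal_mul
  have hl := nonneg_of_posSemidef_mul_diagonal_mul hU hA
  have hone : ∀ c : ℝ, c • (1 : Matrix ι ι ℝ) = U * diagonal (fun _ => c) * Uᵀ := by
    intro c
    rw [← smul_one_eq_diagonal, mul_smul_comm, mul_one, smul_mul_assoc, hU']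
  have ht : (U * diagonal l * Uᵀ).trace = ∑ i, l i := by
    rw [trace_mul_comm, ← mul_assoc, hU, one_mul, trace_diagonal]
  rw [ht, hone, ← sub_mul, ← mul_sub, diagonal_sub]
  exact posSemidef_mul_diagonal_mul fun i =>
    sub_nonneg.2 (Finset.single_le_sum (f := l) (fun i _ => hl i) (Finset.mem_univ i))

end Matrix

end

/-! ### Moment bounds for nice distributions. -/

section

open Filter Topology

set_option linter.unusedSectionVars false

theorem Matrix.posSemidef_of_integral_mul {ι Ω : Type*} [Fintype ι] [MeasurableSpace Ω]
    {μ : Measure Ω} {f : Ω → ι → ℝ} (h : ∀ a b, Integrable (fun x => f x a * f x b) μ) :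
    (Matrix.of fun a b => ∫ x, f x a * f x b ∂μ).PosSemidef := by
  refine Matrix.PosSemidef.of_dotProduct_mulVec_nonneg ?_ fun y => ?_
  · ext a b
    simp only [Matrix.conjTranspose_apply, star_trivial, Matrix.of_apply, mul_comm]
  · have e : star y ⬝ᵥ (Matrix.of fun a b => ∫ x, f x a * f x b ∂μ).mulVec y
        = ∫ x, (∑ a, y a * f x a) ^ 2 ∂μ := by
      simp only [pow_two, Finset.sum_mul_sum]
      have hi : ∀ a b, Integrable (fun x => y a * f x a * (y b * f x b)) μ := by
        intro a b
        refine ((h a b).const_mul (y a * y b)).congr (Eventually.of_forall fun x => ?_)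
        simp only
        ring
      rw [integral_finsetSum _ fun a _ => integrable_finsetSum _ fun b _ => hi a b]
      simp only [dotProduct, Matrix.mulVec, star_trivial, Finset.mul_sum, Matrix.of_apply]
      refine Finset.sum_congr rfl fun a _ => ?_
      rw [integral_finsetSum _ fun b _ => hi a b]
      refine Finset.sum_congr rfl fun b _ => ?_
      rw [mul_comm (∫ x, _ ∂μ), ← mul_assoc, ← integral_const_mul]
      congr 1
      funext x
      ring
    rw [e]
    exact integral_nonneg fun x => sq_nonneg _

open MvPolynomial in
-- The polynomial c‖u‖² - ⟨u, Mu⟩ times a power of ⟨u, Mu⟩ is a sum of squares, and ‖u‖² counts as 1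
-- under Ẽ. Each application trades one factor ⟨u, Mu⟩ for c.
theorem IsSpherePseudoexpectation.map_quadPoly_pow_le {d : ℕ} {E : MvPolynomial (Fin d) ℝ →ₗ[ℝ] ℝ}
    (hE : IsSpherePseudoexpectation (2 * 4) E) {M : Matrix (Fin d) (Fin d) ℝ} (hM : M.PosSemidef)
    {c : ℝ} (hc : 0 ≤ c) (hMc : (c • (1 : Matrix (Fin d) (Fin d) ℝ) - M).PosSemidef) {n : ℕ}
    (hn : n ≤ 4) : E (quadPoly M ^ n) ≤ c ^ n := by
  have hSm : quadPoly M ∈ sosDeg d 1 := quadPoly_mem_sosDeg hM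
  have hT : c • (∑ a, (X a : MvPolynomial (Fin d) ℝ) ^ 2) - quadPoly M ∈ sosDeg d 1 := by
    have := quadPoly_mem_sosDeg hMc
    rw [quadPoly_eq_formPoly, ← formPolyₗ_apply, map_sub, map_smul, formPolyₗ_apply,
      formPolyₗ_apply, formPoly_one] at this
    exact this
  induction n with
  | zero => simp [hE.map_one]
  | succ j ih =>
    have h1 := mul_mem_sosDeg hT (pow_mem_sosDeg hSm j)
    have h2 := hE.nonneg_of_mem_sosDeg (k := 1 + j * 1) (by omega) h1
    have h3 : (quadPoly M ^ j).totalDegree + 2 ≤ 2 * 4 := by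
      have h4 := totalDegree_pow (quadPoly M) j
      have h5 : j * (quadPoly M).totalDegree ≤ j * 2 := by
        gcongr
        exact totalDegree_quadPoly_le M
      omega
    rw [sub_mul, smul_mul_assoc, map_sub, map_smul, hE.map_sumSq_mul h3, ← pow_succ',
      smul_eq_mul] at h2
    have h6 := mul_le_mul_of_nonneg_left (ih (by omega)) hc
    rw [pow_succ' c]
    linarith

namespace IsNice

variable {d : ℕ} {D : Measure (EuclideanSpace ℝ (Fin d))} [IsProbabilityMeasure D] {L : ℝ}
  (hD : IsNice D L)

include hD

theorem integrable_norm_pow_eight : Integrable (fun x => ‖x‖ ^ 8) D :=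
  hD.cert_eight.memLp.integrable_norm_pow (by norm_num)

theorem integrable_prod {r : ℕ} (hr : r ≤ 8) (s : Fin r → Fin d) :
    Integrable (fun x => ∏ j, x (s j)) D := by
  have hb : Integrable (fun x : EuclideanSpace ℝ (Fin d) => 1 + ‖x‖ ^ 8) D :=
    (integrable_const 1).add hD.integrable_norm_pow_eight
  refine hb.mono' ?_ (Eventually.of_forall fun x => ?_)
  · refine Measurable.aestronglyMeasurable ?_
    fun_prop
  · rw [norm_prod]
    calc ∏ j, ‖x (s j)‖ ≤ ∏ _j : Fin r, ‖x‖ :=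
          Finset.prod_le_prod (fun _ _ => norm_nonneg _) fun j _ => PiLp.norm_apply_le x (s j)
      _ = ‖x‖ ^ r := by simp
      _ ≤ 1 + ‖x‖ ^ 8 := by
          rcases le_total ‖x‖ 1 with h | h
          · have := pow_le_one₀ (n := r) (norm_nonneg x) h
            have := pow_nonneg (norm_nonneg x) 8
            linarith
          · have := pow_le_pow_right₀ h hr
            linarith

theorem integrable_mul (a b : Fin d) : Integrable (fun x => x a * x b) D := by
  simpa [Fin.prod_univ_two] using hD.integrable_prod (r := 2) (by norm_num) ![a, b]

theorem integral_apply_eq_zero (a : Fin d) : ∫ x, x a ∂D = 0 := by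
  have hi : Integrable (fun x => x) D :=
    hD.cert_eight.memLp.integrable (by norm_num)
  have := (EuclideanSpace.proj (𝕜 := ℝ) a).integral_comp_comm hi
  rw [hD.mean_zero, map_zero] at this
  exact this

theorem covMatrix_apply (a b : Fin d) : covMatrix D a b = ∫ x, x a * x b ∂D := by
  simp only [covMatrix, Matrix.of_apply, covariance, hD.integral_apply_eq_zero, sub_zero]

theorem posSemidef_covMatrix : (covMatrix D).PosSemidef := by
  have e : covMatrix D = Matrix.of fun a b => ∫ x, x a * x b ∂D := by
    ext a b
    exact hD.covMatrix_apply a b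
  rw [e]
  exact Matrix.posSemidef_of_integral_mul fun a b => hD.integrable_mul a b

open MvPolynomial in
theorem momentPoly_two : momentPoly D 2 = quadPoly (covMatrix D) := by
  simp only [momentPoly, quadPoly]
  rw [← Fintype.sum_prod_type' fun a b =>
    (C (covMatrix D a b) * X a * X b : MvPolynomial (Fin d) ℝ)]
  refine Fintype.sum_equiv (finTwoArrowEquiv (Fin d)) _ _ fun s => ?_
  simp only [finTwoArrowEquiv_apply, Fin.prod_univ_two, hD.covMatrix_apply, mul_assoc]
  rfl

open MvPolynomial

theorem map_linPoly_pow (E : MvPolynomial (Fin d) ℝ →ₗ[ℝ] ℝ) (x : Fin d → ℝ) (r : ℕ) :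
    E (linPoly x ^ r) = ∑ s : Fin r → Fin d, (∏ j, x (s j)) * E (∏ j, X (s j)) := by
  have e : linPoly x ^ r
      = ∑ s : Fin r → Fin d, (∏ j, x (s j)) • (∏ j, X (s j) : MvPolynomial (Fin d) ℝ) := by
    rw [linPoly, Fintype.sum_pow]
    refine Finset.sum_congr rfl fun s _ => ?_
    rw [Finset.prod_mul_distrib, smul_eq_C_mul, map_prod]
  rw [e, map_sum]
  simp only [map_smul, smul_eq_mul]

theorem integrable_map_linPoly_pow (E : MvPolynomial (Fin d) ℝ →ₗ[ℝ] ℝ) {r : ℕ} (hr : r ≤ 8) :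
    Integrable (fun x => E (linPoly (fun a => x a) ^ r)) D := by
  simp only [hD.map_linPoly_pow]
  exact integrable_finsetSum _ fun s _ => (hD.integrable_prod hr s).mul_const _

theorem integral_map_linPoly_pow (E : MvPolynomial (Fin d) ℝ →ₗ[ℝ] ℝ) {r : ℕ} (hr : r ≤ 8) :
    ∫ x, E (linPoly (fun a => x a) ^ r) ∂D = E (momentPoly D r) := by
  simp only [hD.map_linPoly_pow]
  rw [integral_finsetSum _ fun s _ => (hD.integrable_prod hr s).mul_const _, momentPoly, map_sum]
  refine Finset.sum_congr rfl fun s _ => ?_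
  rw [integral_mul_const, ← smul_eq_C_mul, map_smul, smul_eq_mul]

theorem integral_map_linPoly_pow_eight_le {E : MvPolynomial (Fin d) ℝ →ₗ[ℝ] ℝ}
    (hE : IsSpherePseudoexpectation (2 * 4) E) :
    ∫ x, E (linPoly (fun a => x a) ^ 8) ∂D ≤ L ^ 2 * E (quadPoly (covMatrix D) ^ 4) := by
  rw [hD.integral_map_linPoly_pow E le_rfl]
  have h1 := hD.cert_eight.sosLE
  rw [SosLE, hD.momentPoly_two, ← smul_eq_C_mul] at h1
  have h2 := hE.le_of_sub_mem_sosDeg (k := 4) le_rfl (mem_sosDeg_of_isSumSq h1 ?_)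
  · rwa [map_smul, smul_eq_mul] at h2
  · refine (totalDegree_sub _ _).trans (max_le ?_ ?_)
    · refine (totalDegree_smul_le _ _).trans ((totalDegree_pow _ _).trans ?_)
      have := totalDegree_quadPoly_le (covMatrix D)
      omega
    · refine totalDegree_finsetSum_le fun s _ => (totalDegree_mul _ _).trans ?_
      rw [totalDegree_C, zero_add]
      refine (totalDegree_finsetProd _ _).trans ?_
      simp

theorem posSemidef_spectralNorm_smul_one_sub :
    (spectralNorm₂ (covMatrix D) • (1 : Matrix (Fin d) (Fin d) ℝ) - covMatrix D).PosSemidef := by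
  have hs := hD.posSemidef_covMatrix.isSymm
  exact hs.smul_one_sub_of_sq (Matrix.spectralNorm₂_nonneg _)
    ((Matrix.posSemidef_sq_smul_one_sub_sq_iff hs (Matrix.spectralNorm₂_nonneg _)).2 le_rfl)

theorem spectralNorm_le_trace : spectralNorm₂ (covMatrix D) ≤ (covMatrix D).trace := by
  have hp := hD.posSemidef_covMatrix
  exact (Matrix.posSemidef_sq_smul_one_sub_sq_iff hp.isSymm hp.trace_nonneg).1
    (hp.sq_smul_one_sub_sq hp.trace_nonneg hp.trace_smul_one_sub)

theorem integral_map_linPoly_pow_eight_le_spectralNorm {E : MvPolynomial (Fin d) ℝ →ₗ[ℝ] ℝ}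
    (hE : IsSpherePseudoexpectation (2 * 4) E) :
    ∫ x, E (linPoly (fun a => x a) ^ 8) ∂D ≤ (L * spectralNorm₂ (covMatrix D) ^ 2) ^ 2 := by
  refine (hD.integral_map_linPoly_pow_eight_le hE).trans ?_
  calc _ ≤ L ^ 2 * spectralNorm₂ (covMatrix D) ^ 4 := by
        gcongr
        exact hE.map_quadPoly_pow_le hD.posSemidef_covMatrix (Matrix.spectralNorm₂_nonneg _)
          hD.posSemidef_spectralNorm_smul_one_sub le_rfl
    _ = _ := by ring

theorem integrable_apply_pow {r : ℕ} (hr : r ≤ 8) (a : Fin d) : Integrable (fun x => x a ^ r) D := by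
  simpa using hD.integrable_prod hr fun _ => a

/-- Evaluation at the basis vector e_a is itself a pseudoexpectation. -/
theorem integral_apply_pow_eight_le (a : Fin d) :
    ∫ x, x a ^ 8 ∂D ≤ L ^ 2 * covMatrix D a a ^ 4 := by
  have hs : ∑ b, (Pi.single a (1 : ℝ) : Fin d → ℝ) b ^ 2 = 1 := by
    rw [Finset.sum_eq_single a]
    · simp
    · intro b _ hb
      simp [hb]
    · simp
  have := hD.integral_map_linPoly_pow_eight_le (isSpherePseudoexpectation_eval hs (2 * 4))
  simpa [linPoly, quadPoly, Pi.single_apply] using this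

theorem covMatrix_diag_nonneg (a : Fin d) : 0 ≤ covMatrix D a a := hD.posSemidef_covMatrix.diag_nonneg

/-- Unless Σ = 0, necessarily L ≥ 1: at a positive diagonal entry Jensen gives Σ_aa⁴ ≤ E x_a⁸ ≤ L²
Σ_aa⁴. -/
theorem spectralNorm_le_mul (hL : 0 < L) :
    spectralNorm₂ (covMatrix D) ≤ L * spectralNorm₂ (covMatrix D) := by
  by_cases h0 : covMatrix D = 0
  · simp [h0, spectralNorm₂]
  · have hp := hD.posSemidef_covMatrix
    have htr : (covMatrix D).trace ≠ 0 := fun h => h0 (hp.trace_eq_zero_iff.1 h)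
    obtain ⟨a, -, ha⟩ := Finset.exists_ne_zero_of_sum_ne_zero htr
    have ha' : 0 < covMatrix D a a := lt_of_le_of_ne (hD.covMatrix_diag_nonneg a) (Ne.symm ha)
    have h1 := hD.integral_apply_pow_eight_le a
    have h2 := sq_integral_le_integral_sq (hD.integrable_apply_pow (r := 2) (by norm_num) a)
      (by simpa only [← pow_mul] using hD.integrable_apply_pow (r := 4) (by norm_num) a)
    have h3 := sq_integral_le_integral_sq (hD.integrable_apply_pow (r := 4) (by norm_num) a)
      (by simpa only [← pow_mul] using hD.integrable_apply_pow (r := 8) (by norm_num) a)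
    simp only [← pow_mul, Nat.reduceMul] at h2 h3
    have h4 : ∫ x, x a ^ 2 ∂D = covMatrix D a a := by
      rw [hD.covMatrix_apply]
      simp only [pow_two]
    rw [h4] at h2
    have h5 : (covMatrix D a a) ^ 4 ≤ L ^ 2 * covMatrix D a a ^ 4 := by
      refine le_trans ?_ h1
      refine le_trans ?_ h3
      calc covMatrix D a a ^ 4 = (covMatrix D a a ^ 2) ^ 2 := by ring
        _ ≤ _ := by gcongr
    have h6 : 1 ≤ L ^ 2 := by
      have : 0 < covMatrix D a a ^ 4 := by positivity
      nlinarith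
    have h7 : 1 ≤ L := by nlinarith
    have := Matrix.spectralNorm₂_nonneg (covMatrix D)
    nlinarith

/-- Convexity of the fourth power, with weights proportional to Σ_aa, reduces ‖x‖⁸ = (∑ x_a²)⁴ to
the coordinate moments E x_a⁸ ≤ L² Σ_aa⁴. The shift by ε keeps the weights positive. -/
theorem integral_norm_pow_eight_le : ∫ x, ‖x‖ ^ 8 ∂D ≤ (L * (covMatrix D).trace ^ 2) ^ 2 := by
  have key : ∀ ε : ℝ, 0 < ε →
      ∫ x, ‖x‖ ^ 8 ∂D ≤ L ^ 2 * (∑ a, (covMatrix D a a + ε)) ^ 4 := by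
    intro ε hε
    set w : Fin d → ℝ := fun a => covMatrix D a a + ε with hw
    have hw0 : ∀ a, 0 < w a := fun a => by
      have := hD.covMatrix_diag_nonneg a
      simp only [hw]; linarith
    cases isEmpty_or_nonempty (Fin d)
    · have : ∀ x : EuclideanSpace ℝ (Fin d), ‖x‖ ^ 8 = 0 := by
        intro x
        rw [Subsingleton.elim x 0]
        simp
      simp [this]
    set T := ∑ a, w a with hT
    have hT0 : 0 < T := Finset.sum_pos (fun a _ => hw0 a) Finset.univ_nonempty
    have hpt : ∀ x : EuclideanSpace ℝ (Fin d), ‖x‖ ^ 8 ≤ ∑ a, T ^ 3 / w a ^ 3 * x a ^ 8 := by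
      intro x
      have h1 : ‖x‖ ^ 8 = (∑ a, w a / T * (T / w a * x a ^ 2)) ^ 4 := by
        have : ∀ a, w a / T * (T / w a * x a ^ 2) = x a ^ 2 := fun a => by
          have := (hw0 a).ne'
          field_simp
        simp only [this]
        calc ‖x‖ ^ 8 = (‖x‖ ^ 2) ^ 4 := by ring
          _ = _ := by
            rw [EuclideanSpace.norm_sq_eq]
            simp only [Real.norm_eq_abs, sq_abs]
      rw [h1]
      refine (Real.pow_arith_mean_le_arith_mean_pow Finset.univ _ _
        (fun a _ => (div_pos (hw0 a) hT0).le) ?_ (fun a _ => ?_) 4).trans (le_of_eq ?_)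
      · rw [← Finset.sum_div, ← hT, div_self hT0.ne']
      · have := hw0 a
        positivity
      · refine Finset.sum_congr rfl fun a _ => ?_
        have := (hw0 a).ne'
        field_simp
    have hi : ∀ a, Integrable (fun x : EuclideanSpace ℝ (Fin d) => T ^ 3 / w a ^ 3 * x a ^ 8) D :=
      fun a => (hD.integrable_apply_pow le_rfl a).const_mul _
    calc ∫ x, ‖x‖ ^ 8 ∂D ≤ ∫ x, ∑ a, T ^ 3 / w a ^ 3 * x a ^ 8 ∂D :=
          integral_mono hD.integrable_norm_pow_eight (integrable_finsetSum _ fun a _ => hi a) hpt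
      _ = ∑ a, T ^ 3 / w a ^ 3 * ∫ x, x a ^ 8 ∂D := by
          rw [integral_finsetSum _ fun a _ => hi a]
          simp only [integral_const_mul]
      _ ≤ ∑ a, T ^ 3 * L ^ 2 * w a := by
          refine Finset.sum_le_sum fun a _ => ?_
          have h0 := hw0 a
          have h1 : ∫ x, x a ^ 8 ∂D ≤ L ^ 2 * w a ^ 4 := by
            refine (hD.integral_apply_pow_eight_le a).trans ?_
            have := hD.covMatrix_diag_nonneg a
            gcongr
            simp only [hw]; linarith
          calc T ^ 3 / w a ^ 3 * ∫ x, x a ^ 8 ∂D ≤ T ^ 3 / w a ^ 3 * (L ^ 2 * w a ^ 4) := by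
                gcongr
            _ = T ^ 3 * L ^ 2 * w a := by field_simp
      _ = L ^ 2 * T ^ 4 := by rw [← Finset.mul_sum, ← hT]; ring
  have hc : Tendsto (fun ε : ℝ => L ^ 2 * (∑ a, (covMatrix D a a + ε)) ^ 4) (𝓝[>] 0)
      (𝓝 ((L * (covMatrix D).trace ^ 2) ^ 2)) := by
    have h1 : Continuous fun ε : ℝ => L ^ 2 * (∑ a, (covMatrix D a a + ε)) ^ 4 := by fun_prop
    have h2 := h1.tendsto 0
    simp only [add_zero] at h2
    have e : (L * (covMatrix D).trace ^ 2) ^ 2 = L ^ 2 * (∑ a, covMatrix D a a) ^ 4 := by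
      simp only [Matrix.trace, Matrix.diag_apply]
      ring
    rw [e]
    exact h2.mono_left nhdsWithin_le_nhds
  refine ge_of_tendsto hc ?_
  filter_upwards [self_mem_nhdsWithin] with ε hε using key ε hε

end IsNice

end

/-! ### Pseudo-moments of sums of independent centred matrices. -/

section

open Filter Topology

set_option linter.unusedSectionVars false

namespace MvPolynomial

variable {d : ℕ}

theorem quadPoly_add (A B : Matrix (Fin d) (Fin d) ℝ) :
    quadPoly (A + B) = quadPoly A + quadPoly B := formPoly_add A B X

theorem quadPoly_sub (A B : Matrix (Fin d) (Fin d) ℝ) :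
    quadPoly (A - B) = quadPoly A - quadPoly B := (formPolyₗ X).map_sub A B

theorem quadPoly_smul (c : ℝ) (A : Matrix (Fin d) (Fin d) ℝ) :
    quadPoly (c • A) = c • quadPoly A := formPoly_smul c A X

/-- The linear form `M ↦ E (⟨u, M u⟩ q)`. -/
noncomputable def quadMulₗ (E : MvPolynomial (Fin d) ℝ →ₗ[ℝ] ℝ) (q : MvPolynomial (Fin d) ℝ) :
    Matrix (Fin d) (Fin d) ℝ →ₗ[ℝ] ℝ where
  toFun M := E (q * quadPoly M)
  map_add' A B := by rw [quadPoly_add, mul_add, map_add]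
  map_smul' c A := by rw [quadPoly_smul, mul_smul_comm, map_smul]; rfl

theorem quadMulₗ_apply (E : MvPolynomial (Fin d) ℝ →ₗ[ℝ] ℝ) (q : MvPolynomial (Fin d) ℝ)
    (M : Matrix (Fin d) (Fin d) ℝ) : quadMulₗ E q M = E (q * quadPoly M) := rfl

theorem continuous_map_quadPoly_mul (E : MvPolynomial (Fin d) ℝ →ₗ[ℝ] ℝ) {T : Type*}
    [TopologicalSpace T] {f g : T → Matrix (Fin d) (Fin d) ℝ} (hf : Continuous f)
    (hg : Continuous g) : Continuous fun x => E (quadPoly (f x) * quadPoly (g x)) := by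
  simp only [← formPoly_kronecker, ← formPolyₗ_apply]
  have h1 : Continuous (E ∘ₗ formPolyₗ (tensorVars d)) := LinearMap.continuous_of_finiteDimensional _
  refine h1.comp (continuous_matrix fun i j => ?_)
  exact (hf.matrix_elem i.1 j.1).mul (hg.matrix_elem i.2 j.2)

theorem continuous_map_quadPoly_sq (E : MvPolynomial (Fin d) ℝ →ₗ[ℝ] ℝ) {T : Type*}
    [TopologicalSpace T] {f : T → Matrix (Fin d) (Fin d) ℝ} (hf : Continuous f) :
    Continuous fun x => E (quadPoly (f x) ^ 2) := by
  simp only [pow_two]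
  exact continuous_map_quadPoly_mul E hf hf

end MvPolynomial

open MvPolynomial

section Bucket

variable {Ω : Type*} [MeasurableSpace Ω] {μ : Measure Ω} [IsProbabilityMeasure μ]

/-- In an expression linear in X with coefficients depending on an independent S, X may be replaced
by its mean. This kills the terms of odd degree in a centred summand. -/
theorem Matrix.integral_linear_of_indepFun {m n : Type*} [Fintype m] [Fintype n] [DecidableEq m]
    [DecidableEq n] {β : Type*} [MeasurableSpace β] [TopologicalSpace β] [OpensMeasurableSpace β]
    {g : β → (Matrix m n ℝ →ₗ[ℝ] ℝ)} (hg : ∀ M, Continuous fun s => g s M)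
    {S : Ω → β} {X : Ω → Matrix m n ℝ} (hS : IsCompactRV S) (hX : IsCompactRV X)
    (hind : IndepFun S X μ) :
    ∫ ω, g (S ω) (X ω) ∂μ = ∫ ω, g (S ω) (expect μ X) ∂μ := by
  have h : ∀ s, ∀ M : Matrix m n ℝ, g s M = ∑ i, ∑ j, g s (single i j 1) * M i j := by
    intro s M
    conv_lhs => rw [matrix_eq_sum_single M]
    simp only [map_sum]
    refine Finset.sum_congr rfl fun i _ => Finset.sum_congr rfl fun j _ => ?_
    rw [mul_comm, ← smul_eq_mul, ← map_smul, smul_single, smul_eq_mul, mul_one]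
  have hSi : ∀ i j, IsCompactRV fun ω => g (S ω) (single i j 1) := fun i j => hS.comp (hg _)
  have hXi : ∀ i j, IsCompactRV fun ω => X ω i j := fun i j => hX.comp (continuous_entry i j)
  have hi : ∀ i j, Integrable (fun ω => g (S ω) (single i j 1) * X ω i j) μ := fun i j =>
    (((hSi i j).prodMk (hXi i j)).comp (g := fun p : ℝ × ℝ => p.1 * p.2) (by fun_prop)).integrable μ
  have hi' : ∀ i j, Integrable (fun ω => g (S ω) (single i j 1) * expect μ X i j) μ := fun i j =>
    ((hSi i j).integrable μ).mul_const _
  simp only [h _ (X _), h _ (expect μ X)]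
  rw [integral_finsetSum _ fun i _ => integrable_finsetSum _ fun j _ => hi i j,
    integral_finsetSum _ fun i _ => integrable_finsetSum _ fun j _ => hi' i j]
  refine Finset.sum_congr rfl fun i _ => ?_
  rw [integral_finsetSum _ fun j _ => hi i j, integral_finsetSum _ fun j _ => hi' i j]
  refine Finset.sum_congr rfl fun j _ => ?_
  rw [integral_mul_const]
  exact (hind.comp (hg (single i j 1)).measurable
    (continuous_entry i j).measurable).integral_fun_mul_eq_mul_integral
    (hSi i j).measurable.aestronglyMeasurable (hXi i j).measurable.aestronglyMeasurable

variable {d : ℕ} {E : MvPolynomial (Fin d) ℝ →ₗ[ℝ] ℝ} (hE : IsSpherePseudoexpectation (2 * 4) E)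
  {S X : Ω → Matrix (Fin d) (Fin d) ℝ}

include hE

theorem IsSpherePseudoexpectation.integral_map_quadPoly_sq_add (hS : IsCompactRV S)
    (hX : IsCompactRV X) (hind : IndepFun S X μ) (hX0 : Matrix.expect μ X = 0) :
    ∫ ω, E (quadPoly (S ω + X ω) ^ 2) ∂μ
      = ∫ ω, E (quadPoly (S ω) ^ 2) ∂μ + ∫ ω, E (quadPoly (X ω) ^ 2) ∂μ := by
  have h0 : ∫ ω, E (quadPoly (S ω) * quadPoly (X ω)) ∂μ = 0 := by
    have := Matrix.integral_linear_of_indepFun (g := fun s => quadMulₗ E (quadPoly s))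
      (fun M => continuous_map_quadPoly_mul E continuous_id continuous_const) hS hX hind
    simp only [hX0, map_zero, integral_zero, quadMulₗ_apply] at this
    exact this
  have e : ∀ ω, E (quadPoly (S ω + X ω) ^ 2) = E (quadPoly (S ω) ^ 2) + E (quadPoly (X ω) ^ 2)
      + 2 * E (quadPoly (S ω) * quadPoly (X ω)) := by
    intro ω
    rw [quadPoly_add, ← smul_eq_mul, ← map_smul, ← map_add, ← map_add]
    congr 1
    rw [smul_eq_C_mul, map_ofNat]
    ring
  have i1 : Integrable (fun ω => E (quadPoly (S ω) ^ 2)) μ :=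
    (hS.comp (continuous_map_quadPoly_sq E continuous_id)).integrable μ
  have i2 : Integrable (fun ω => E (quadPoly (X ω) ^ 2)) μ :=
    (hX.comp (continuous_map_quadPoly_sq E continuous_id)).integrable μ
  have i3 : Integrable (fun ω => E (quadPoly (S ω) * quadPoly (X ω))) μ :=
    ((hS.prodMk hX).comp (continuous_map_quadPoly_mul E continuous_fst continuous_snd)).integrable μ
  simp only [e]
  have i4 : Integrable (fun ω => E (quadPoly (S ω) ^ 2) + E (quadPoly (X ω) ^ 2)) μ := i1.add i2
  rw [integral_add i4 (i3.const_mul 2), integral_add i1 i2, integral_const_mul, h0]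
  ring

/-- Pathwise bound for `E ‖(S + X) u‖⁴`. -/
theorem IsSpherePseudoexpectation.map_quadPoly_sq_add_sq_le {A B : Matrix (Fin d) (Fin d) ℝ}
    (hA : A.IsSymm) (hB : B.IsSymm) :
    E (quadPoly ((A + B) ^ 2) ^ 2) ≤ E (quadPoly (A ^ 2) ^ 2)
      + 8 * E (quadPoly (A ^ 2) * quadPoly (B ^ 2)) + 3 * E (quadPoly (B ^ 2) ^ 2)
      + 4 * E (quadPoly (A ^ 2) * quadPoly (A * B)) := by
  have hcs : quadPoly (A ^ 2) * quadPoly (B ^ 2) - quadPoly (A * B) ^ 2 ∈ sosDeg d 2 := by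
    have := quadPoly_mul_sub_sq_mem_sosDeg A B
    rwa [hA.eq, hB.eq, ← pow_two, ← pow_two] at this
  have hq : quadPoly ((A + B) ^ 2) = quadPoly (A ^ 2) + 2 * quadPoly (A * B) + quadPoly (B ^ 2) := by
    have h1 : (A + B) ^ 2 = A ^ 2 + A * B + B * A + B ^ 2 := by noncomm_ring
    have h2 : quadPoly (B * A) = quadPoly (A * B) := by
      rw [← quadPoly_transpose (A * B), Matrix.transpose_mul, hA.eq, hB.eq]
    rw [h1, quadPoly_add, quadPoly_add, quadPoly_add, h2]
    ring
  rw [hq]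
  have ha := totalDegree_quadPoly_le (A ^ 2)
  have hb := totalDegree_quadPoly_le (B ^ 2)
  have hc := totalDegree_quadPoly_le (A * B)
  generalize quadPoly (A ^ 2) = a at *
  generalize quadPoly (B ^ 2) = b at *
  generalize quadPoly (A * B) = c at *
  have h1 := hE.nonneg_of_mem_sosDeg (k := 2) (by norm_num) hcs
  -- This gives 4bc ≤ 2b² + 2c². The accumulated 6c² is at most 6ab by Cauchy–Schwarz; the term 4ac
  -- is kept because it is linear in B and averages to zero.
  have h2 := hE.sq_nonneg (b - c) (by
    have := totalDegree_sub b c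
    omega)
  have e1 : (a + 2 * c + b) ^ 2 = a ^ 2 + (4 : ℝ) • c ^ 2 + b ^ 2 + (4 : ℝ) • (a * c)
      + (2 : ℝ) • (a * b) + (4 : ℝ) • (b * c) := by
    simp only [smul_eq_C_mul, map_ofNat]; ring
  have e2 : (b - c) ^ 2 = b ^ 2 + c ^ 2 - (2 : ℝ) • (b * c) := by
    simp only [smul_eq_C_mul, map_ofNat]; ring
  rw [e1]
  rw [e2] at h2
  simp only [map_add, map_sub, map_smul, smul_eq_mul] at h1 h2 ⊢
  linarith

/-- Jensen's inequality, from Ẽ(⟨u, Vu⟩ - ⟨u, Bu⟩)² ≥ 0 with B the mean of V. -/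
theorem IsSpherePseudoexpectation.map_quadPoly_expect_sq_le {V : Ω → Matrix (Fin d) (Fin d) ℝ}
    (hV : IsCompactRV V) :
    E (quadPoly (Matrix.expect μ V) ^ 2) ≤ ∫ ω, E (quadPoly (V ω) ^ 2) ∂μ := by
  set B := Matrix.expect μ V with hB
  have hpt : ∀ ω, 2 * quadMulₗ E (quadPoly B) (V ω) - E (quadPoly B ^ 2)
      ≤ E (quadPoly (V ω) ^ 2) := by
    intro ω
    have h1 := hE.sq_nonneg (quadPoly (V ω) - quadPoly B) (by
      have := totalDegree_sub (quadPoly (V ω)) (quadPoly B)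
      have := totalDegree_quadPoly_le (V ω)
      have := totalDegree_quadPoly_le B
      omega)
    have e : (quadPoly (V ω) - quadPoly B) ^ 2
        = quadPoly (V ω) ^ 2 + quadPoly B ^ 2 - (2 : ℝ) • (quadPoly B * quadPoly (V ω)) := by
      simp only [smul_eq_C_mul, map_ofNat]; ring
    rw [e] at h1
    simp only [map_add, map_sub, map_smul, smul_eq_mul] at h1
    rw [quadMulₗ_apply]
    linarith
  have i1 : Integrable (fun ω => quadMulₗ E (quadPoly B) (V ω)) μ :=
    (hV.comp (quadMulₗ E (quadPoly B)).continuous_of_finiteDimensional).integrable μ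
  have i2 : Integrable (fun ω => E (quadPoly (V ω) ^ 2)) μ :=
    (hV.comp (continuous_map_quadPoly_sq E continuous_id)).integrable μ
  have := integral_mono ((i1.const_mul 2).sub (integrable_const _)) i2 hpt
  simp only [Pi.sub_apply] at this
  rw [integral_sub (i1.const_mul 2) (integrable_const _), integral_const_mul,
    Matrix.map_expect (quadMulₗ E (quadPoly B)) hV, ← hB, quadMulₗ_apply, integral_const,
    probReal_univ, one_smul, ← pow_two] at this
  linarith

variable {κ : Type*} [DecidableEq κ] {Y : κ → Ω → Matrix (Fin d) (Fin d) ℝ}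
  (hY : ∀ j, IsCompactRV (Y j)) (hY0 : ∀ j, Matrix.expect μ (Y j) = 0)
  (hind : ∀ (s : Finset κ) (j : κ), j ∉ s → IndepFun (fun ω => ∑ i ∈ s, Y i ω) (Y j) μ)

include hY hY0 hind

theorem IsSpherePseudoexpectation.integral_map_quadPoly_sum_sq_le {w : ℝ}
    (hw : ∀ j, ∫ ω, E (quadPoly (Y j ω) ^ 2) ∂μ ≤ w) (s : Finset κ) :
    ∫ ω, E (quadPoly (∑ j ∈ s, Y j ω) ^ 2) ∂μ ≤ s.card * w := by
  induction s using Finset.induction_on with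
  | empty => simp [quadPoly]
  | insert j s hj ih =>
    simp only [Finset.sum_insert hj, add_comm (Y j _), Finset.card_insert_of_notMem hj]
    rw [hE.integral_map_quadPoly_sq_add (IsCompactRV.finsetSum hY s) (hY j) (hind s j hj) (hY0 j)]
    have := hw j
    push_cast
    linarith

omit hE in
theorem integral_quadMul_sum_sq_le (q : MvPolynomial (Fin d) ℝ) {c : ℝ}
    (hc : ∀ j, ∫ ω, quadMulₗ E q (Y j ω ^ 2) ∂μ ≤ c) (s : Finset κ) :
    ∫ ω, quadMulₗ E q ((∑ j ∈ s, Y j ω) ^ 2) ∂μ ≤ s.card * c := by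
  induction s using Finset.induction_on with
  | empty => simp
  | insert j s hj ih =>
    simp only [Finset.sum_insert hj, add_comm (Y j _), Finset.card_insert_of_notMem hj]
    obtain ⟨S, hSdef⟩ : ∃ S : Ω → Matrix (Fin d) (Fin d) ℝ, S = fun ω => ∑ i ∈ s, Y i ω := ⟨_, rfl⟩
    have hS : IsCompactRV S := hSdef ▸ IsCompactRV.finsetSum hY s
    have hSω : ∀ ω, ∑ i ∈ s, Y i ω = S ω := fun ω => by rw [hSdef]
    have hindj : IndepFun S (Y j) μ := hSdef ▸ hind s j hj
    simp only [hSω] at ih ⊢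
    have hl : Continuous (quadMulₗ E q) := LinearMap.continuous_of_finiteDimensional _
    have hSY := hS.prodMk (hY j)
    have h1 : ∫ ω, quadMulₗ E q (S ω * Y j ω) ∂μ = 0 := by
      have := Matrix.integral_linear_of_indepFun (μ := μ)
        (g := fun s => quadMulₗ E q ∘ₗ LinearMap.mulLeft ℝ s)
        (fun M => hl.comp (continuous_mul_const M)) hS (hY j) hindj
      simp only [hY0 j, map_zero, integral_zero, LinearMap.comp_apply,
        LinearMap.mulLeft_apply] at this
      exact this
    have h2 : ∫ ω, quadMulₗ E q (Y j ω * S ω) ∂μ = 0 := by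
      have := Matrix.integral_linear_of_indepFun (μ := μ)
        (g := fun s => quadMulₗ E q ∘ₗ LinearMap.mulRight ℝ s)
        (fun M => hl.comp (continuous_const_mul M)) hS (hY j) hindj
      simp only [hY0 j, map_zero, integral_zero, LinearMap.comp_apply,
        LinearMap.mulRight_apply] at this
      exact this
    have e : ∀ ω, quadMulₗ E q ((S ω + Y j ω) ^ 2) = quadMulₗ E q (S ω ^ 2)
        + quadMulₗ E q (S ω * Y j ω) + quadMulₗ E q (Y j ω * S ω) + quadMulₗ E q (Y j ω ^ 2) := by
      intro ω
      rw [← map_add, ← map_add, ← map_add]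
      congr 1
      noncomm_ring
    have i1 : Integrable (fun ω => quadMulₗ E q (S ω ^ 2)) μ :=
      (hS.comp (hl.comp (continuous_pow 2))).integrable μ
    have i2 : Integrable (fun ω => quadMulₗ E q (S ω * Y j ω)) μ :=
      (hSY.comp (g := fun p => quadMulₗ E q (p.1 * p.2))
        (hl.comp (continuous_fst.mul continuous_snd))).integrable μ
    have i3 : Integrable (fun ω => quadMulₗ E q (Y j ω * S ω)) μ :=
      (hSY.comp (g := fun p => quadMulₗ E q (p.2 * p.1))
        (hl.comp (continuous_snd.mul continuous_fst))).integrable μ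
    have i4 : Integrable (fun ω => quadMulₗ E q (Y j ω ^ 2)) μ :=
      ((hY j).comp (hl.comp (continuous_pow 2))).integrable μ
    have i12 : Integrable (fun ω => quadMulₗ E q (S ω ^ 2) + quadMulₗ E q (S ω * Y j ω)) μ :=
      i1.add i2
    have i123 : Integrable (fun ω => quadMulₗ E q (S ω ^ 2) + quadMulₗ E q (S ω * Y j ω)
      + quadMulₗ E q (Y j ω * S ω)) μ := i12.add i3
    simp only [e]
    rw [integral_add i123 i4, integral_add i12 i3, integral_add i1 i2, h1, h2]
    have := hc j
    push_cast
    linarith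

/-- Adding a summand to a sum S of s terms costs 8·(mixed term) + 3w by the pathwise bound. In the
mixed term Y_j² is replaced by its mean B, and M ↦ Ẽ(⟨u, Bu⟩⟨u, Mu⟩) of S² is additive in the
summands, so the mixed term is at most sw. The induction closes because 4s² + 8s + 3 ≤ 4(s + 1)². -/
theorem IsSpherePseudoexpectation.integral_map_quadPoly_sum_sq_sq_le
    (hYs : ∀ j ω, (Y j ω).IsSymm) {w : ℝ} (hw0 : 0 ≤ w)
    (hw : ∀ j, ∫ ω, E (quadPoly (Y j ω ^ 2) ^ 2) ∂μ ≤ w) (s : Finset κ) :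
    ∫ ω, E (quadPoly ((∑ j ∈ s, Y j ω) ^ 2) ^ 2) ∂μ ≤ 4 * s.card ^ 2 * w := by
  induction s using Finset.induction_on with
  | empty => simp [quadPoly, pow_two]
  | insert j s hj ih =>
    simp only [Finset.sum_insert hj, add_comm (Y j _), Finset.card_insert_of_notMem hj]
    have hSs : ∀ ω, (∑ i ∈ s, Y i ω).IsSymm := by
      intro ω
      simp only [Matrix.IsSymm, Matrix.transpose_sum]
      exact Finset.sum_congr rfl fun i _ => hYs i ω
    have hlin : ∀ q, (∀ i, ∫ ω, quadMulₗ E q (Y i ω ^ 2) ∂μ ≤ w) →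
        ∫ ω, quadMulₗ E q ((∑ i ∈ s, Y i ω) ^ 2) ∂μ ≤ s.card * w := fun q hq =>
      integral_quadMul_sum_sq_le hY hY0 hind q hq s
    obtain ⟨S, hSdef⟩ : ∃ S : Ω → Matrix (Fin d) (Fin d) ℝ, S = fun ω => ∑ i ∈ s, Y i ω := ⟨_, rfl⟩
    have hS : IsCompactRV S := hSdef ▸ IsCompactRV.finsetSum hY s
    have hSω : ∀ ω, ∑ i ∈ s, Y i ω = S ω := fun ω => by rw [hSdef]
    have hindj : IndepFun S (Y j) μ := hSdef ▸ hind s j hj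
    simp only [hSω] at ih hSs hlin ⊢
    have hY2 : ∀ i, IsCompactRV fun ω => Y i ω ^ 2 := fun i => (hY i).comp (continuous_pow 2)
    have hSY := hS.prodMk (hY j)
    set B := Matrix.expect μ (fun ω => Y j ω ^ 2) with hB
    have hBw : E (quadPoly B ^ 2) ≤ w := (hE.map_quadPoly_expect_sq_le (hY2 j)).trans (hw j)
    have iY : ∀ i, Integrable (fun ω => E (quadPoly (Y i ω ^ 2) ^ 2)) μ := fun i =>
      ((hY i).comp (continuous_map_quadPoly_sq E (continuous_pow 2))).integrable μ
    have hlB : ∀ i, ∫ ω, quadMulₗ E (quadPoly B) (Y i ω ^ 2) ∂μ ≤ w := by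
      intro i
      have hpt : ∀ ω, quadMulₗ E (quadPoly B) (Y i ω ^ 2)
          ≤ 1 / 2 * E (quadPoly B ^ 2) + 1 / 2 * E (quadPoly (Y i ω ^ 2) ^ 2) := by
        intro ω
        rw [quadMulₗ_apply]
        have h1 := hE.sq_nonneg (quadPoly B - quadPoly (Y i ω ^ 2)) (by
          have := totalDegree_sub (quadPoly B) (quadPoly (Y i ω ^ 2))
          have := totalDegree_quadPoly_le (Y i ω ^ 2)
          have := totalDegree_quadPoly_le B
          omega)
        have e : (quadPoly B - quadPoly (Y i ω ^ 2)) ^ 2 = quadPoly B ^ 2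
            + quadPoly (Y i ω ^ 2) ^ 2 - (2 : ℝ) • (quadPoly B * quadPoly (Y i ω ^ 2)) := by
          simp only [smul_eq_C_mul, map_ofNat]; ring
        rw [e] at h1
        simp only [map_add, map_sub, map_smul, smul_eq_mul] at h1
        linarith
      have i1 : Integrable (fun ω => quadMulₗ E (quadPoly B) (Y i ω ^ 2)) μ :=
        ((hY2 i).comp (quadMulₗ E (quadPoly B)).continuous_of_finiteDimensional).integrable μ
      have h2 := integral_mono i1 ((integrable_const _).add ((iY i).const_mul (1 / 2))) hpt
      rw [integral_add' (integrable_const _) ((iY i).const_mul (1 / 2)), integral_const,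
        integral_const_mul, probReal_univ, one_smul] at h2
      have := hw i
      linarith
    have hc1 : ∫ ω, E (quadPoly (S ω ^ 2) * quadPoly (Y j ω ^ 2)) ∂μ ≤ s.card * w := by
      have h1 := Matrix.integral_linear_of_indepFun (μ := μ)
        (g := fun s => quadMulₗ E (quadPoly (s ^ 2)))
        (fun M => continuous_map_quadPoly_mul E (continuous_pow 2) continuous_const) hS (hY2 j)
        (hindj.comp measurable_id (continuous_pow 2).measurable)
      simp only [quadMulₗ_apply] at h1
      rw [h1, ← hB]
      refine le_trans (le_of_eq ?_) (hlin (quadPoly B) hlB)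
      simp only [quadMulₗ_apply, mul_comm]
    have hc2 : ∫ ω, E (quadPoly (S ω ^ 2) * quadPoly (S ω * Y j ω)) ∂μ = 0 := by
      have h1 := Matrix.integral_linear_of_indepFun (μ := μ)
        (g := fun s => quadMulₗ E (quadPoly (s ^ 2)) ∘ₗ LinearMap.mulLeft ℝ s)
        (fun M => continuous_map_quadPoly_mul E (continuous_pow 2) (continuous_mul_const M))
        hS (hY j) hindj
      simp only [hY0 j, map_zero, integral_zero, LinearMap.comp_apply,
        LinearMap.mulLeft_apply, quadMulₗ_apply] at h1
      exact h1
    have iS : Integrable (fun ω => E (quadPoly (S ω ^ 2) ^ 2)) μ :=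
      (hS.comp (continuous_map_quadPoly_sq E (continuous_pow 2))).integrable μ
    have i1 : Integrable (fun ω => E (quadPoly (S ω ^ 2) * quadPoly (Y j ω ^ 2))) μ :=
      (hSY.comp (continuous_map_quadPoly_mul E (continuous_fst.pow 2)
        (continuous_snd.pow 2))).integrable μ
    have i2 : Integrable (fun ω => E (quadPoly (S ω ^ 2) * quadPoly (S ω * Y j ω))) μ :=
      (hSY.comp (continuous_map_quadPoly_mul E (continuous_fst.pow 2)
        (continuous_fst.mul continuous_snd))).integrable μ
    have iSY : Integrable (fun ω => E (quadPoly ((S ω + Y j ω) ^ 2) ^ 2)) μ :=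
      (hSY.comp (continuous_map_quadPoly_sq E
        ((continuous_fst.add continuous_snd).pow 2))).integrable μ
    have i3 := iS.add (i1.const_mul 8)
    have i4 := i3.add ((iY j).const_mul 3)
    have h1 := integral_mono iSY (i4.add (i2.const_mul 4)) fun ω =>
      hE.map_quadPoly_sq_add_sq_le (hSs ω) (hYs j ω)
    rw [integral_add' i4 (i2.const_mul 4), integral_add' i3 ((iY j).const_mul 3),
      integral_add' iS (i1.const_mul 8), integral_const_mul, integral_const_mul,
      integral_const_mul, hc2] at h1
    have := hw j
    push_cast
    nlinarith

end Bucket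

end

/-! ### Moments of a single truncated sample. -/

section

open Filter Topology

set_option linter.unusedSectionVars false

open MvPolynomial

section Sample

variable {d : ℕ}

theorem truncVec_eq_or (α : ℝ) (x : EuclideanSpace ℝ (Fin d)) :
    truncVec α x = x ∨ truncVec α x = 0 := by
  rw [truncVec]
  split_ifs <;> simp

theorem isCompactRV_truncVec (α : ℝ) :
    IsCompactRV (truncVec α : EuclideanSpace ℝ (Fin d) → EuclideanSpace ℝ (Fin d)) := by
  refine ⟨?_, Metric.closedBall 0 (max α 0), isCompact_closedBall _ _, fun x => ?_⟩
  · exact Measurable.ite (measurableSet_le measurable_norm measurable_const) measurable_id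
      measurable_const
  · rw [mem_closedBall_zero_iff, truncVec]
    split_ifs with h
    · exact h.trans (le_max_left _ _)
    · simp

/-- The matrix `ṽ ṽᵀ`. -/
noncomputable def truncOuter (α : ℝ) (x : EuclideanSpace ℝ (Fin d)) : Matrix (Fin d) (Fin d) ℝ :=
  Matrix.of fun a b => truncVec α x a * truncVec α x b

/-- The centred matrix `ṽ ṽᵀ - E [ṽ ṽᵀ]`. -/
noncomputable def sampleDev (D : Measure (EuclideanSpace ℝ (Fin d))) (α : ℝ)
    (x : EuclideanSpace ℝ (Fin d)) : Matrix (Fin d) (Fin d) ℝ :=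
  truncOuter α x - truncSecondMoment D α

theorem isCompactRV_truncOuter (α : ℝ) : IsCompactRV (truncOuter (d := d) α) := by
  refine (isCompactRV_truncVec α).comp
    (g := fun t : EuclideanSpace ℝ (Fin d) => Matrix.of fun a b => t a * t b) ?_
  exact continuous_matrix fun a b => by
    simp only [Matrix.of_apply]
    fun_prop

theorem isSymm_truncOuter (α : ℝ) (x : EuclideanSpace ℝ (Fin d)) : (truncOuter α x).IsSymm := by
  ext a b
  simp only [Matrix.transpose_apply, truncOuter, Matrix.of_apply, mul_comm]

theorem posSemidef_truncOuter (α : ℝ) (x : EuclideanSpace ℝ (Fin d)) :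
    (truncOuter α x).PosSemidef := by
  have := Matrix.posSemidef_vecMulVec_self_star (R := ℝ) (truncVec α x).ofLp
  rwa [star_trivial] at this

theorem quadPoly_truncOuter (α : ℝ) (x : EuclideanSpace ℝ (Fin d)) :
    quadPoly (truncOuter α x) = linPoly (fun a => truncVec α x a) ^ 2 := by
  rw [linPoly, pow_two, Finset.sum_mul_sum, quadPoly]
  refine Finset.sum_congr rfl fun a _ => Finset.sum_congr rfl fun b _ => ?_
  rw [truncOuter, Matrix.of_apply, C_mul]
  ring

theorem truncOuter_sq (α : ℝ) (x : EuclideanSpace ℝ (Fin d)) :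
    truncOuter α x ^ 2 = ‖truncVec α x‖ ^ 2 • truncOuter α x := by
  ext a b
  rw [pow_two, Matrix.mul_apply, Matrix.smul_apply, EuclideanSpace.norm_sq_eq, smul_eq_mul,
    Finset.sum_mul]
  refine Finset.sum_congr rfl fun c _ => ?_
  simp only [truncOuter, Matrix.of_apply, Real.norm_eq_abs, sq_abs]
  ring

theorem map_linPoly_truncVec_pow_le {E : MvPolynomial (Fin d) ℝ →ₗ[ℝ] ℝ}
    (hE : IsSpherePseudoexpectation (2 * 4) E) (α : ℝ) (x : EuclideanSpace ℝ (Fin d)) :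
    E (linPoly (fun a => truncVec α x a) ^ 8) ≤ E (linPoly (fun a => x a) ^ 8) := by
  rcases truncVec_eq_or α x with h | h
  · rw [h]
  · rw [h]
    have h1 : linPoly (fun a => (0 : EuclideanSpace ℝ (Fin d)) a) = 0 := by simp [linPoly]
    rw [h1, zero_pow (by norm_num), map_zero]
    have h2 : linPoly (fun a => x a) ^ 8 = (linPoly (fun a => x a) ^ 4) ^ 2 := by ring
    rw [h2]
    refine hE.sq_nonneg _ ?_
    have := totalDegree_pow (linPoly fun a => x a) 4
    have := totalDegree_linPoly_le fun a => x a
    omega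

theorem norm_truncVec_le (α : ℝ) (x : EuclideanSpace ℝ (Fin d)) : ‖truncVec α x‖ ≤ ‖x‖ := by
  rcases truncVec_eq_or α x with h | h <;> simp [h]

theorem sq_map_linPoly_pow_four_le {E : MvPolynomial (Fin d) ℝ →ₗ[ℝ] ℝ}
    (hE : IsSpherePseudoexpectation (2 * 4) E) (x : Fin d → ℝ) :
    E (linPoly x ^ 4) ^ 2 ≤ E (linPoly x ^ 8) := by
  have h4 : (linPoly x ^ 4).totalDegree ≤ 4 := by
    have := totalDegree_pow (linPoly x) 4
    have := totalDegree_linPoly_le x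
    omega
  have := hE.sq_map_mul_le (p := 1) (q := linPoly x ^ 4) (by simp) (by omega)
  rwa [one_mul, one_pow, hE.map_one, one_mul, ← pow_mul] at this

theorem map_linPoly_pow_eight_nonneg {E : MvPolynomial (Fin d) ℝ →ₗ[ℝ] ℝ}
    (hE : IsSpherePseudoexpectation (2 * 4) E) (x : Fin d → ℝ) : 0 ≤ E (linPoly x ^ 8) :=
  (sq_nonneg _).trans (sq_map_linPoly_pow_four_le hE x)

end Sample

namespace IsNice

variable {d : ℕ} {D : Measure (EuclideanSpace ℝ (Fin d))} [IsProbabilityMeasure D] {L : ℝ}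
  (hD : IsNice D L) (α : ℝ)

omit [IsProbabilityMeasure D] in
theorem truncSecondMoment_eq_expect :
    truncSecondMoment D α = Matrix.expect D (truncOuter α) := rfl

theorem isSymm_sampleDev (x : EuclideanSpace ℝ (Fin d)) : (sampleDev D α x).IsSymm :=
  (isSymm_truncOuter α x).sub (Matrix.isSymm_expect (μ := D) fun x => isSymm_truncOuter α x)

omit [IsProbabilityMeasure D] in
theorem isCompactRV_sampleDev : IsCompactRV (sampleDev D α) :=
  (isCompactRV_truncOuter α).comp (g := fun M => M - truncSecondMoment D α) (by fun_prop)

theorem expect_sampleDev : Matrix.expect D (sampleDev D α) = 0 := by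
  have := Matrix.expect_sub (μ := D) (isCompactRV_truncOuter (d := d) α)
    (IsCompactRV.const (truncSecondMoment D α))
  rw [Matrix.expect_const, ← truncSecondMoment_eq_expect, sub_self] at this
  exact this

theorem posSemidef_truncSecondMoment : (truncSecondMoment D α).PosSemidef :=
  Matrix.posSemidef_expect (isCompactRV_truncOuter α) (posSemidef_truncOuter α)

include hD

/-- As ṽ is either v or 0, the cross terms between ṽ and v - ṽ vanish, so the difference is the
second moment matrix of v - ṽ. -/
theorem posSemidef_covMatrix_sub_truncSecondMoment :
    (covMatrix D - truncSecondMoment D α).PosSemidef := by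
  have hpt : ∀ (x : EuclideanSpace ℝ (Fin d)) (a b : Fin d),
      (x a - truncVec α x a) * (x b - truncVec α x b)
        = x a * x b - truncVec α x a * truncVec α x b := by
    intro x a b
    rcases truncVec_eq_or α x with h | h <;> simp [h]
  have hi : ∀ a b, Integrable (fun x => truncVec α x a * truncVec α x b) D := fun a b =>
    (isCompactRV_truncOuter α).integrable_entry a b
  have e : covMatrix D - truncSecondMoment D α = Matrix.of fun a b =>
      ∫ x, (x a - truncVec α x a) * (x b - truncVec α x b) ∂D := by
    ext a b
    simp only [hpt, Matrix.of_apply]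
    rw [integral_sub (hD.integrable_mul a b) (hi a b), Matrix.sub_apply, hD.covMatrix_apply]
    rfl
  rw [e]
  refine Matrix.posSemidef_of_integral_mul (f := fun x a => x a - truncVec α x a) fun a b => ?_
  simp only [hpt]
  exact (hD.integrable_mul a b).sub (hi a b)

theorem posSemidef_spectralNorm_smul_one_sub_truncSecondMoment :
    (spectralNorm₂ (covMatrix D) • (1 : Matrix (Fin d) (Fin d) ℝ)
      - truncSecondMoment D α).PosSemidef := by
  have := hD.posSemidef_spectralNorm_smul_one_sub.add
    (hD.posSemidef_covMatrix_sub_truncSecondMoment α)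
  rwa [sub_add_sub_cancel] at this

variable {E : MvPolynomial (Fin d) ℝ →ₗ[ℝ] ℝ} (hE : IsSpherePseudoexpectation (2 * 4) E)

include hE

/-- The fourth moment is bounded by the square root of the eighth, first under Ẽ and then under the
expectation; between the two the truncation is dropped. -/
theorem integral_map_linPoly_truncVec_pow_four_le (hL : 0 < L) :
    ∫ x, E (linPoly (fun a => truncVec α x a) ^ 4) ∂D ≤ L * spectralNorm₂ (covMatrix D) ^ 2 := by
  have hc : IsCompactRV fun x => E (quadPoly (truncOuter (d := d) α x) ^ 2) :=
    (isCompactRV_truncOuter α).comp (continuous_map_quadPoly_sq E continuous_id)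
  simp only [quadPoly_truncOuter, ← pow_mul] at hc
  have hl := Matrix.spectralNorm₂_nonneg (covMatrix D)
  have hB : (0 : ℝ) ≤ L * spectralNorm₂ (covMatrix D) ^ 2 := by positivity
  have hF : ∫ _ : EuclideanSpace ℝ (Fin d), (1 : ℝ) ∂D ≤ 1 ^ 2 := by simp
  have hG := hD.integral_map_linPoly_pow_eight_le_spectralNorm hE
  have hGi := hD.integrable_map_linPoly_pow E (r := 8) le_rfl
  have hpt : ∀ x : EuclideanSpace ℝ (Fin d), E (linPoly (fun a => truncVec α x a) ^ 4) ^ 2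
      ≤ 1 * E (linPoly (fun a => x a) ^ 8) := by
    intro x
    rw [one_mul]
    exact (sq_map_linPoly_pow_four_le hE _).trans (map_linPoly_truncVec_pow_le hE α x)
  have hci := hc.integrable D
  have hG0 : ∀ x : EuclideanSpace ℝ (Fin d), 0 ≤ E (linPoly (fun a => x a) ^ 8) := fun x =>
    map_linPoly_pow_eight_nonneg hE _
  have := integral_le_mul_of_sq_le hci (integrable_const 1) hGi (fun _ => zero_le_one) hG0 hpt
    zero_le_one hB hF hG
  rwa [one_mul] at this

/-- Centring only lowers a second moment: it subtracts Ẽ⟨u, Bu⟩² with B the mean of ṽṽᵀ. -/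
theorem integral_map_quadPoly_sampleDev_sq_le (hL : 0 < L) :
    ∫ x, E (quadPoly (sampleDev D α x) ^ 2) ∂D ≤ L * spectralNorm₂ (covMatrix D) ^ 2 := by
  refine le_trans ?_ (hD.integral_map_linPoly_truncVec_pow_four_le α hE hL)
  set B := truncSecondMoment D α with hB
  have hR := isCompactRV_truncOuter (d := d) α
  have h1 : ∫ x, quadMulₗ E (quadPoly B) (truncOuter α x) ∂D = E (quadPoly B ^ 2) := by
    rw [Matrix.map_expect _ hR, ← truncSecondMoment_eq_expect, ← hB, quadMulₗ_apply, pow_two]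
  have e : ∀ x, E (quadPoly (sampleDev D α x) ^ 2)
      = E (linPoly (fun a => truncVec α x a) ^ 4) + E (quadPoly B ^ 2)
        - 2 * quadMulₗ E (quadPoly B) (truncOuter α x) := by
    intro x
    rw [quadMulₗ_apply, ← smul_eq_mul, ← map_smul, ← map_add, ← map_sub, sampleDev, quadPoly_sub,
      quadPoly_truncOuter, smul_eq_C_mul, map_ofNat]
    congr 1
    ring
  have i1 : Integrable (fun x => E (linPoly (fun a => truncVec α x a) ^ 4)) D := by
    have hc : IsCompactRV fun x => E (quadPoly (truncOuter (d := d) α x) ^ 2) :=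
      hR.comp (continuous_map_quadPoly_sq E continuous_id)
    simp only [quadPoly_truncOuter, ← pow_mul] at hc
    exact hc.integrable D
  have i2 : Integrable (fun x => quadMulₗ E (quadPoly B) (truncOuter α x)) D :=
    (hR.comp (quadMulₗ E (quadPoly B)).continuous_of_finiteDimensional).integrable D
  have i3 : Integrable (fun x => E (linPoly (fun a => truncVec α x a) ^ 4)
      + E (quadPoly B ^ 2)) D := i1.add (integrable_const _)
  simp only [e]
  rw [integral_sub i3 (i2.const_mul 2), integral_add i1 (integrable_const _), integral_const_mul,
    h1, integral_const, probReal_univ, one_smul]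
  have := hE.sq_nonneg (quadPoly B) (by
    have := totalDegree_quadPoly_le B
    omega)
  linarith

/-- Since (ṽṽᵀ)² = ‖ṽ‖² ṽṽᵀ, the integrand is ‖ṽ‖⁴ Ẽ⟨ṽ, u⟩⁴. Cauchy–Schwarz splits it into E‖v‖⁸ and
∫ Ẽ⟨v, u⟩⁸, which is where one factor Tr Σ and one factor ‖Σ‖ come from. -/
theorem integral_norm_truncVec_mul_le (hL : 0 < L) :
    ∫ x, E (quadPoly (truncOuter α x ^ 2) ^ 2) ∂D
      ≤ (L * (covMatrix D).trace * spectralNorm₂ (covMatrix D)) ^ 2 := by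
  have hc : IsCompactRV fun x => E (quadPoly (truncOuter (d := d) α x ^ 2) ^ 2) :=
    (isCompactRV_truncOuter α).comp (continuous_map_quadPoly_sq E (continuous_pow 2))
  have e : ∀ x, E (quadPoly (truncOuter (d := d) α x ^ 2) ^ 2)
      = ‖truncVec α x‖ ^ 4 * E (linPoly (fun a => truncVec α x a) ^ 4) := by
    intro x
    rw [truncOuter_sq, quadPoly_smul, smul_pow, map_smul, smul_eq_mul, quadPoly_truncOuter,
      ← pow_mul, ← pow_mul]
  have hl := Matrix.spectralNorm₂_nonneg (covMatrix D)
  have e2 : (L * (covMatrix D).trace * spectralNorm₂ (covMatrix D)) ^ 2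
      = (L * (covMatrix D).trace ^ 2) * (L * spectralNorm₂ (covMatrix D) ^ 2) := by ring
  have hA : (0 : ℝ) ≤ L * (covMatrix D).trace ^ 2 := by positivity
  have hB : (0 : ℝ) ≤ L * spectralNorm₂ (covMatrix D) ^ 2 := by positivity
  have hG := hD.integral_map_linPoly_pow_eight_le_spectralNorm hE
  have hGi := hD.integrable_map_linPoly_pow E (r := 8) le_rfl
  have hpt : ∀ x : EuclideanSpace ℝ (Fin d), E (quadPoly (truncOuter α x ^ 2) ^ 2) ^ 2
      ≤ ‖x‖ ^ 8 * E (linPoly (fun a => x a) ^ 8) := by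
    intro x
    rw [e, mul_pow, ← pow_mul]
    refine mul_le_mul ?_ ((sq_map_linPoly_pow_four_le hE _).trans
      (map_linPoly_truncVec_pow_le hE α x)) (sq_nonneg _) (by positivity)
    exact pow_le_pow_left₀ (norm_nonneg _) (norm_truncVec_le α x) _
  have hG0 : ∀ x : EuclideanSpace ℝ (Fin d), 0 ≤ E (linPoly (fun a => x a) ^ 8) := fun x =>
    map_linPoly_pow_eight_nonneg hE _
  rw [e2]
  exact integral_le_mul_of_sq_le (hc.integrable D) hD.integrable_norm_pow_eight hGi
    (fun x => pow_nonneg (norm_nonneg x) 8) hG0 hpt hA hB hD.integral_norm_pow_eight_le hG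

omit hD in
-- The parallelogram identity gives ‖(A - B)u‖² ≤ 2‖Au‖² + 2‖Bu‖²; squaring is legitimate because
-- the discarded terms are products of sums of squares.
theorem map_quadPoly_sub_sq_sq_le {A B : Matrix (Fin d) (Fin d) ℝ} (hA : A.IsSymm) (hB : B.IsSymm) :
    E (quadPoly ((A - B) ^ 2) ^ 2) ≤ 8 * E (quadPoly (A ^ 2) ^ 2) + 8 * E (quadPoly (B ^ 2) ^ 2) := by
  have hp : quadPoly ((A + B) ^ 2) ∈ sosDeg d 1 := quadPoly_mem_sosDeg (hA.add hB).posSemidef_sq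
  have hm : quadPoly ((A - B) ^ 2) ∈ sosDeg d 1 := quadPoly_mem_sosDeg (hA.sub hB).posSemidef_sq
  have hrel : quadPoly ((A + B) ^ 2) + quadPoly ((A - B) ^ 2)
      = (2 : ℝ) • quadPoly (A ^ 2) + (2 : ℝ) • quadPoly (B ^ 2) := by
    rw [← quadPoly_add, ← quadPoly_smul, ← quadPoly_smul, ← quadPoly_add]
    congr 1
    have : (A + B) ^ 2 + (A - B) ^ 2 = 2 • A ^ 2 + 2 • B ^ 2 := by noncomm_ring
    rw [this]
    module
  have ha := totalDegree_quadPoly_le (A ^ 2)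
  have hb := totalDegree_quadPoly_le (B ^ 2)
  generalize quadPoly (A ^ 2) = a at *
  generalize quadPoly (B ^ 2) = b at *
  generalize quadPoly ((A + B) ^ 2) = p at *
  generalize quadPoly ((A - B) ^ 2) = m at *
  have h1 := hE.nonneg_of_mem_sosDeg (k := 1 + 1) (by norm_num) (mul_mem_sosDeg hp hp)
  have h2 := hE.nonneg_of_mem_sosDeg (k := 1 + 1) (by norm_num) (mul_mem_sosDeg hp hm)
  have h3 := hE.sq_nonneg (a - b) (by
    have := totalDegree_sub a b
    omega)
  have e1 : m ^ 2 = (8 : ℝ) • a ^ 2 + (8 : ℝ) • b ^ 2 - (4 : ℝ) • (a - b) ^ 2 - p * p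
      - (2 : ℝ) • (p * m) := by
    have e2 : (p + m) ^ 2 = ((2 : ℝ) • a + (2 : ℝ) • b) ^ 2 := by rw [hrel]
    simp only [smul_eq_C_mul, map_ofNat] at e2 ⊢
    linear_combination e2
  rw [e1]
  simp only [map_add, map_sub, map_smul, smul_eq_mul]
  linarith

theorem integral_map_quadPoly_sampleDev_sq_sq_le (hL : 0 < L) :
    ∫ x, E (quadPoly (sampleDev D α x ^ 2) ^ 2) ∂D
      ≤ 16 * (L * (covMatrix D).trace * spectralNorm₂ (covMatrix D)) ^ 2 := by
  set B := truncSecondMoment D α with hB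
  set l := spectralNorm₂ (covMatrix D) with hl
  have hl0 : 0 ≤ l := Matrix.spectralNorm₂_nonneg _
  have hBp : B.PosSemidef := posSemidef_truncSecondMoment α
  have hBl := hD.posSemidef_spectralNorm_smul_one_sub_truncSecondMoment α
  -- From B ⪯ ‖Σ‖ I the left side is at most ‖Σ‖⁴; it is put in the same form as the uncentred bound
  -- by ‖Σ‖ ≤ Tr Σ and ‖Σ‖ ≤ L‖Σ‖.
  have hB4 : E (quadPoly (B ^ 2) ^ 2) ≤ (L * (covMatrix D).trace * l) ^ 2 := by
    refine (hE.map_quadPoly_pow_le hBp.isSymm.posSemidef_sq (sq_nonneg l)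
      (hBp.sq_smul_one_sub_sq hl0 hBl) (by norm_num)).trans ?_
    have h1 := hD.spectralNorm_le_trace
    have h2 := hD.spectralNorm_le_mul hL
    have : l ^ 2 ≤ L * (covMatrix D).trace * l := by
      calc l ^ 2 = l * l := pow_two l
        _ ≤ (L * l) * (covMatrix D).trace := mul_le_mul h2 h1 hl0 (by positivity)
        _ = _ := by ring
    gcongr
  have hR := isCompactRV_truncOuter (d := d) α
  have i1 : Integrable (fun x => E (quadPoly (sampleDev D α x ^ 2) ^ 2)) D :=
    ((isCompactRV_sampleDev α).comp (continuous_map_quadPoly_sq E (continuous_pow 2))).integrable D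
  have i2 : Integrable (fun x => E (quadPoly (truncOuter (d := d) α x ^ 2) ^ 2)) D :=
    (hR.comp (continuous_map_quadPoly_sq E (continuous_pow 2))).integrable D
  have h1 := integral_mono i1 ((i2.const_mul 8).add (integrable_const _)) fun x =>
    map_quadPoly_sub_sq_sq_le hE (isSymm_truncOuter α x) hBp.isSymm
  rw [integral_add' (i2.const_mul 8) (integrable_const _), integral_const, integral_const_mul,
    probReal_univ, one_smul] at h1
  have := hD.integral_norm_truncVec_mul_le α hE hL
  linarith

end IsNice

end

/-! ### Truncated matrices, bucket moments, and the choice of η. -/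

section

open Filter Topology

set_option linter.unusedSectionVars false

open MvPolynomial

namespace Matrix

variable {d : ℕ}

theorem continuous_spectralNorm₂ : Continuous (spectralNorm₂ (d := d)) := by
  have h : Continuous (toEuclideanCLM (n := Fin d) (𝕜 := ℝ)).toAlgEquiv.toLinearMap :=
    LinearMap.continuous_of_finiteDimensional _
  exact h.norm

theorem measurable_truncMatrix (τ : ℝ) : Measurable (truncMatrix (d := d) τ) :=
  Measurable.ite (measurableSet_le continuous_spectralNorm₂.measurable measurable_const)
    measurable_id measurable_const

theorem isCompactRV_truncMatrix {Ω : Type*} [MeasurableSpace Ω] {Z : Ω → Matrix (Fin d) (Fin d) ℝ}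
    (hZ : IsCompactRV Z) (τ : ℝ) : IsCompactRV fun ω => truncMatrix τ (Z ω) := by
  obtain ⟨hm, K, hK, h⟩ := hZ
  refine ⟨(measurable_truncMatrix τ).comp hm, K ∪ {0}, hK.union isCompact_singleton, fun ω => ?_⟩
  rw [truncMatrix]
  split_ifs
  · exact Or.inl (h ω)
  · exact Or.inr rfl

theorem truncMatrix_eq_or (τ : ℝ) (M : Matrix (Fin d) (Fin d) ℝ) :
    truncMatrix τ M = M ∨ truncMatrix τ M = 0 := by
  rw [truncMatrix]
  split_ifs <;> simp

theorem IsSymm.truncMatrix {M : Matrix (Fin d) (Fin d) ℝ} (hM : M.IsSymm) (τ : ℝ) :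
    (truncMatrix τ M).IsSymm := by
  rcases truncMatrix_eq_or τ M with h | h
  · rwa [h]
  · rw [h]; exact isSymm_zero

theorem spectralNorm₂_truncMatrix_le (τ : ℝ) (M : Matrix (Fin d) (Fin d) ℝ) :
    spectralNorm₂ (truncMatrix τ M) ≤ |τ| := by
  rw [truncMatrix]
  split_ifs with h
  · exact h.trans (le_abs_self τ)
  · simp [spectralNorm₂]

theorem kronecker_pow_two (A B : Matrix (Fin d) (Fin d) ℝ) :
    (A.kronecker B) ^ 2 = (A ^ 2).kronecker (B ^ 2) := by
  rw [pow_two, pow_two, pow_two]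
  exact (mul_kronecker_mul A A B B).symm

theorem IsSymm.kronecker {A B : Matrix (Fin d) (Fin d) ℝ} (hA : A.IsSymm) (hB : B.IsSymm) :
    (A.kronecker B).IsSymm := by
  ext i j
  exact congrArg₂ (· * ·) (hA.apply i.1 j.1) (hB.apply i.2 j.2)

/-- Applied with W = Z̃² and c = τ², this is the norm bound on Z̃ ⊗ Z̃. -/
theorem posSemidef_smul_one_sub_kronecker_self {W : Matrix (Fin d) (Fin d) ℝ} (hW : W.PosSemidef)
    {c : ℝ} (hc : 0 ≤ c) (h : (c • (1 : Matrix (Fin d) (Fin d) ℝ) - W).PosSemidef) :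
    (c ^ 2 • (1 : Matrix (Fin d × Fin d) (Fin d × Fin d) ℝ) - W.kronecker W).PosSemidef := by
  have h1 : ((c • (1 : Matrix (Fin d) (Fin d) ℝ) - W).kronecker W).PosSemidef := h.kronecker hW
  have h2 : ((c • (1 : Matrix (Fin d) (Fin d) ℝ)).kronecker
      (c • (1 : Matrix (Fin d) (Fin d) ℝ) - W)).PosSemidef :=
    (PosSemidef.one.smul hc).kronecker h
  have e : c ^ 2 • (1 : Matrix (Fin d × Fin d) (Fin d × Fin d) ℝ) - W.kronecker W
      = (c • (1 : Matrix (Fin d) (Fin d) ℝ) - W).kronecker W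
        + (c • (1 : Matrix (Fin d) (Fin d) ℝ)).kronecker
            (c • (1 : Matrix (Fin d) (Fin d) ℝ) - W) := by
    ext ⟨i, i'⟩ ⟨j, j'⟩
    simp only [kronecker, sub_apply, add_apply, smul_apply, kroneckerMap_apply, smul_eq_mul,
      one_apply, Prod.mk.injEq, ite_and]
    split_ifs <;> ring
  rw [e]
  exact h1.add h2

theorem continuous_kronecker_self : Continuous fun Z : Matrix (Fin d) (Fin d) ℝ => Z.kronecker Z :=
  continuous_matrix fun i j =>
    (continuous_id.matrix_elem i.1 j.1).mul (continuous_id.matrix_elem i.2 j.2)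

end Matrix

section Bucket

variable {d n k : ℕ} {D : Measure (EuclideanSpace ℝ (Fin d))} [IsProbabilityMeasure D] {L : ℝ}

theorem IsEquipartition.card_mul {B : Fin k → Finset (Fin n)} (hB : IsEquipartition B) (i : Fin k) :
    (B i).card * k = n := by
  have h1 : (Finset.univ : Finset (Fin k)).biUnion B = Finset.univ := by
    ext j
    simp only [Finset.mem_biUnion, Finset.mem_univ, true_and, iff_true]
    exact (hB.existsUnique_mem j).exists
  have h2 := Finset.card_biUnion (s := Finset.univ) (t := B) fun a _ b _ hab =>
    Finset.disjoint_left.2 fun j ha hb => hab ((hB.existsUnique_mem j).unique ha hb)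
  rw [h1, Finset.card_univ, Fintype.card_fin] at h2
  rw [Finset.sum_congr rfl fun j _ => hB.card_eq j i, Finset.sum_const, Finset.card_univ,
    Fintype.card_fin, smul_eq_mul] at h2
  rw [mul_comm, ← h2]

theorem bucketDev_eq_smul_sum (α : ℝ) {B : Finset (Fin n)} (hn : 0 < n) (hB : B.card * k = n)
    (v : Fin n → EuclideanSpace ℝ (Fin d)) :
    bucketDev D α k B v = ((k : ℝ) / n) • ∑ j ∈ B, sampleDev D α (v j) := by
  have hn' : (n : ℝ) ≠ 0 := by positivity
  have hc : (B.card : ℝ) * k = n := by exact_mod_cast hB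
  ext a b
  rw [Matrix.smul_apply, Matrix.sum_apply]
  simp only [bucketDev, sampleDev, truncOuter, Matrix.of_apply, Matrix.sub_apply,
    Finset.sum_sub_distrib, Finset.sum_const, nsmul_eq_mul, smul_eq_mul, one_div_div, mul_sub]
  congr 1
  rw [← mul_assoc, div_mul_eq_mul_div, mul_comm (k : ℝ), hc, div_self hn', one_mul]

theorem isCompactRV_sampleDev_eval (α : ℝ) (j : Fin n) :
    IsCompactRV fun v : Fin n → EuclideanSpace ℝ (Fin d) => sampleDev D α (v j) :=
  (IsNice.isCompactRV_sampleDev α).precomp (measurable_pi_apply j)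

theorem integral_eval_pi {f : EuclideanSpace ℝ (Fin d) → ℝ} (hf : Measurable f) (j : Fin n) :
    ∫ v, f (v j) ∂(Measure.pi fun _ : Fin n => D) = ∫ x, f x ∂D := by
  have h := measurePreserving_eval (fun _ : Fin n => D) j
  exact (integral_map h.measurable.aemeasurable hf.aestronglyMeasurable).symm.trans
    (by rw [h.map_eq])

theorem expect_sampleDev_eval (α : ℝ) (j : Fin n) :
    Matrix.expect (Measure.pi fun _ : Fin n => D) (fun v => sampleDev D α (v j)) = 0 := by
  rw [← IsNice.expect_sampleDev (D := D) α]
  ext a b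
  exact integral_eval_pi (f := fun x => sampleDev D α x a b)
    ((Matrix.continuous_entry a b).measurable.comp (IsNice.isCompactRV_sampleDev α).measurable) j

theorem indepFun_sum_sampleDev (α : ℝ) (s : Finset (Fin n)) (j : Fin n) (hj : j ∉ s) :
    IndepFun (fun v : Fin n → EuclideanSpace ℝ (Fin d) => ∑ i ∈ s, sampleDev D α (v i))
      (fun v => sampleDev D α (v j)) (Measure.pi fun _ : Fin n => D) := by
  have hm := (IsNice.isCompactRV_sampleDev (D := D) α).measurable
  have h : iIndepFun (fun (i : Fin n) (v : Fin n → EuclideanSpace ℝ (Fin d)) =>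
      sampleDev D α (v i)) (Measure.pi fun _ : Fin n => D) :=
    iIndepFun_pi (X := fun _ => sampleDev D α) fun _ => hm.aemeasurable
  have := h.indepFun_finsetSum_of_notMem (fun i => hm.comp (measurable_pi_apply i)) hj
  rwa [Finset.sum_fn] at this

theorem isCompactRV_bucketDev (α : ℝ) {B : Finset (Fin n)} (hn : 0 < n) (hB : B.card * k = n) :
    IsCompactRV (bucketDev D α k B) := by
  have h := (IsCompactRV.finsetSum (isCompactRV_sampleDev_eval (D := D) α) B).comp
    (g := fun M => ((k : ℝ) / n) • M) (by fun_prop)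
  have e : bucketDev D α k B = fun v => ((k : ℝ) / n) • ∑ j ∈ B, sampleDev D α (v j) :=
    funext fun v => bucketDev_eq_smul_sum α hn hB v
  rwa [e]

theorem isSymm_bucketDev (α : ℝ) {B : Finset (Fin n)} (hn : 0 < n) (hB : B.card * k = n)
    (v : Fin n → EuclideanSpace ℝ (Fin d)) : (bucketDev D α k B v).IsSymm := by
  rw [bucketDev_eq_smul_sum α hn hB]
  refine Matrix.IsSymm.smul ?_ _
  simp only [Matrix.IsSymm, Matrix.transpose_sum]
  exact Finset.sum_congr rfl fun i _ => IsNice.isSymm_sampleDev α (v i)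

variable (hD : IsNice D L) (α : ℝ) {E : MvPolynomial (Fin d) ℝ →ₗ[ℝ] ℝ}
  (hE : IsSpherePseudoexpectation (2 * 4) E)

include hD hE

theorem integral_map_quadPoly_bucketDev_sq_le (hL : 0 < L) {B : Finset (Fin n)} (hn : 0 < n)
    (hB : B.card * k = n) :
    ∫ v, E (quadPoly (bucketDev D α k B v) ^ 2) ∂(Measure.pi fun _ : Fin n => D)
      ≤ (k : ℝ) / n * (L * spectralNorm₂ (covMatrix D) ^ 2) := by
  have h := hE.integral_map_quadPoly_sum_sq_le (isCompactRV_sampleDev_eval (D := D) α)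
    (expect_sampleDev_eval α) (indepFun_sum_sampleDev α)
    (w := L * spectralNorm₂ (covMatrix D) ^ 2) (fun j => ?_) B
  · have hc : (B.card : ℝ) * k = n := by exact_mod_cast hB
    have hn' : (n : ℝ) ≠ 0 := by positivity
    simp only [bucketDev_eq_smul_sum α hn hB, quadPoly_smul, smul_pow, map_smul, smul_eq_mul]
    rw [integral_const_mul]
    calc _ ≤ ((k : ℝ) / n) ^ 2 * (B.card * (L * spectralNorm₂ (covMatrix D) ^ 2)) := by gcongr
      _ = (B.card * k / n) * ((k : ℝ) / n * (L * spectralNorm₂ (covMatrix D) ^ 2)) := by ring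
      _ = _ := by rw [hc, div_self hn', one_mul]
  · rw [integral_eval_pi (f := fun x => E (quadPoly (sampleDev D α x) ^ 2))
      ((continuous_map_quadPoly_sq E continuous_id).measurable.comp
        (IsNice.isCompactRV_sampleDev α).measurable)]
    exact hD.integral_map_quadPoly_sampleDev_sq_le α hE hL

theorem integral_map_quadPoly_bucketDev_sq_sq_le (hL : 0 < L) {B : Finset (Fin n)} (hn : 0 < n)
    (hB : B.card * k = n) :
    ∫ v, E (quadPoly (bucketDev D α k B v ^ 2) ^ 2) ∂(Measure.pi fun _ : Fin n => D)
      ≤ 64 * ((k : ℝ) / n * (L * (covMatrix D).trace * spectralNorm₂ (covMatrix D))) ^ 2 := by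
  set w := (L * (covMatrix D).trace * spectralNorm₂ (covMatrix D)) ^ 2 with hw
  have h := hE.integral_map_quadPoly_sum_sq_sq_le (isCompactRV_sampleDev_eval (D := D) α)
    (expect_sampleDev_eval α) (indepFun_sum_sampleDev α)
    (fun j v => IsNice.isSymm_sampleDev α (v j)) (w := 16 * w) (by positivity) (fun j => ?_) B
  · have hc : (B.card : ℝ) * k = n := by exact_mod_cast hB
    have hn' : (n : ℝ) ≠ 0 := by positivity
    simp only [bucketDev_eq_smul_sum α hn hB, smul_pow, quadPoly_smul, map_smul, smul_eq_mul]
    rw [integral_const_mul]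
    calc _ ≤ (((k : ℝ) / n) ^ 2) ^ 2 * (4 * B.card ^ 2 * (16 * w)) := by gcongr
      _ = 64 * (B.card * k / n) ^ 2 * (((k : ℝ) / n) ^ 2 * w) := by ring
      _ = _ := by rw [hc, div_self hn', hw]; ring
  · rw [integral_eval_pi (f := fun x => E (quadPoly (sampleDev D α x ^ 2) ^ 2))
      ((continuous_map_quadPoly_sq E (continuous_pow 2)).measurable.comp
        (IsNice.isCompactRV_sampleDev α).measurable)]
    exact hD.integral_map_quadPoly_sampleDev_sq_sq_le α hE hL

end Bucket

/-- The free optimum is η = √(b/a), giving 2√(ab). When the constraint cuts it off, η = 1/(2s) makes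
b/η = 2bs. Adding ε to a, b and s avoids division by zero. -/
theorem le_add_mul_sqrt_of_forall_le {R P a b s : ℝ} (ha : 0 ≤ a) (hb : 0 ≤ b) (hs : 0 ≤ s)
    (h : ∀ η : ℝ, 0 < η → η * s ≤ 1 / 2 → R ≤ P + η * a + b / η) :
    R ≤ P + 2 * √(a * b) + 2 * (b * s) := by
  have key : ∀ ε : ℝ, 0 < ε → R ≤ P + 2 * √((a + ε) * (b + ε)) + 2 * ((b + ε) * (s + ε)) := by
    intro ε hε
    have ha' : 0 < a + ε := by linarith
    have hb' : 0 < b + ε := by linarith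
    have hs' : 0 < s + ε := by linarith
    set r := √((b + ε) / (a + ε)) with hr
    have hr0 : 0 < r := Real.sqrt_pos.2 (by positivity)
    have hrr : r * r = (b + ε) / (a + ε) := Real.mul_self_sqrt (by positivity)
    have hra : √((a + ε) * (b + ε)) = r * (a + ε) := by
      rw [Real.sqrt_eq_iff_mul_self_eq (by positivity) (by positivity)]
      refine Eq.symm ?_
      calc r * (a + ε) * (r * (a + ε)) = (r * r) * (a + ε) ^ 2 := by ring
        _ = (b + ε) / (a + ε) * (a + ε) * (a + ε) := by rw [hrr]; ring
        _ = _ := by rw [div_mul_cancel₀ _ ha'.ne']; ring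
    have hrb : (b + ε) / r = r * (a + ε) := by
      rw [div_eq_iff hr0.ne']
      calc b + ε = (b + ε) / (a + ε) * (a + ε) := (div_mul_cancel₀ _ ha'.ne').symm
        _ = _ := by rw [← hrr]; ring
    set η := min r (1 / (2 * (s + ε))) with hη
    have hη0 : 0 < η := lt_min hr0 (by positivity)
    have hηs : η * s ≤ 1 / 2 := by
      calc η * s ≤ 1 / (2 * (s + ε)) * (s + ε) := by
            refine mul_le_mul (min_le_right _ _) (by linarith) hs (by positivity)
        _ = 1 / 2 := by field_simp
    have h1 := h η hη0 hηs
    have h2 : η * a ≤ r * (a + ε) :=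
      mul_le_mul (min_le_left _ _) (by linarith) ha hr0.le
    have h3 : b / η ≤ r * (a + ε) + 2 * ((b + ε) * (s + ε)) := by
      have h4 : b / η ≤ (b + ε) / η := by gcongr; linarith
      refine h4.trans ?_
      rcases min_choice r (1 / (2 * (s + ε))) with hm | hm
      · rw [hη, hm, hrb]
        have : 0 < (b + ε) * (s + ε) := by positivity
        linarith
      · rw [hη, hm]
        have e : (b + ε) / (1 / (2 * (s + ε))) = 2 * ((b + ε) * (s + ε)) := by field_simp
        rw [e]
        have : 0 < r * (a + ε) := by positivity
        linarith
    rw [hra]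
    linarith
  have hc : Tendsto (fun ε : ℝ => P + 2 * √((a + ε) * (b + ε)) + 2 * ((b + ε) * (s + ε))) (𝓝[>] 0)
      (𝓝 (P + 2 * √(a * b) + 2 * (b * s))) := by
    have h1 : Continuous fun ε : ℝ =>
        P + 2 * √((a + ε) * (b + ε)) + 2 * ((b + ε) * (s + ε)) := by fun_prop
    have h2 := h1.tendsto 0
    simp only [add_zero] at h2
    exact h2.mono_left nhdsWithin_le_nhds
  refine ge_of_tendsto hc ?_
  filter_upwards [self_mem_nhdsWithin] with ε hε using key ε hε

end

/-! ### The Bernstein bound for the maximum over pseudodistributions. -/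

section

open Filter Topology

set_option linter.unusedSectionVars false

open MvPolynomial

namespace IsSpherePseudoexpectation

variable {d : ℕ} {E : MvPolynomial (Fin d) ℝ →ₗ[ℝ] ℝ}

theorem map_formPoly_one_tensorVars (hE : IsSpherePseudoexpectation (2 * 4) E) :
    E (formPoly 1 (tensorVars d)) = 1 := by
  have hq : (∑ a : Fin d, (X a : MvPolynomial (Fin d) ℝ) ^ 2).totalDegree ≤ 2 :=
    totalDegree_finsetSum_le fun a _ => (totalDegree_pow _ _).trans (by simp)
  rw [show (1 : Matrix (Fin d × Fin d) (Fin d × Fin d) ℝ) = Matrix.kronecker 1 1 from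
      Matrix.one_kronecker_one.symm, formPoly_kronecker, quadPoly_eq_formPoly, formPoly_one,
    hE.map_sumSq_mul (by omega), ← mul_one (∑ a : Fin d, _), hE.map_sumSq_mul (by simp), hE.map_one]

theorem map_formPoly_tensorVars_le (hd : 0 < d) (hE : IsSpherePseudoexpectation (2 * 4) E)
    {Y : Matrix (Fin d × Fin d) (Fin d × Fin d) ℝ} (hY : Y.IsSymm) :
    E (formPoly Y (tensorVars d))
      ≤ 2 * Real.log d + ((NormedSpace.exp Y).trace / (d * d) - 1) := by
  have hd' : (0 : ℝ) < d := by exact_mod_cast hd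
  have h := hE.map_formPoly_nonneg
    (Matrix.posSemidef_smul_one_sub_of_trace_exp hY (c := (d : ℝ) * d) (by positivity)) le_rfl
    fun i => (totalDegree_tensorVars_le i).trans (by norm_num)
  rw [← formPolyₗ_apply, map_sub, map_smul, formPolyₗ_apply, formPolyₗ_apply, map_sub, map_smul,
    hE.map_formPoly_one_tensorVars, smul_eq_mul, mul_one, Real.log_mul hd'.ne' hd'.ne'] at h
  linarith

end IsSpherePseudoexpectation

/-- The supremum over pseudodistributions falls only on the fluctuation ∑ (A_i - F_i), where the
trace exponential bounds it uniformly. The hypotheses `hc₁` and `hc₂` concern one fixed Ẽ at a time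
and contain no supremum inside the expectation. -/
theorem integral_pseudoMax_formPoly_sum_le {d : ℕ} (hd : 0 < d) {Ω κ : Type*} [MeasurableSpace Ω]
    [Fintype κ] {μ : Measure Ω} [IsProbabilityMeasure μ]
    {A : κ → Ω → Matrix (Fin d × Fin d) (Fin d × Fin d) ℝ} (hA : ∀ i, IsCompactRV (A i))
    (hs : ∀ i ω, (A i ω).IsSymm) 
    (hind : ∀ (s : Finset κ) (i : κ), i ∉ s → IndepFun (fun ω (j : s) => A j ω) (A i) μ) {t η : ℝ} (hη : 0 < η)
    (hηt : η * t ≤ 1 / 2) (ht : 0 ≤ t)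
    (h2 : ∀ i ω, (t ^ 2 • (1 : Matrix (Fin d × Fin d) (Fin d × Fin d) ℝ) - A i ω ^ 2).PosSemidef)
    {c₁ c₂ : ℝ} (hc₁ : ∀ E, IsSpherePseudoexpectation (2 * 4) E → ∀ i,
      ∫ ω, E (formPoly (A i ω) (tensorVars d)) ∂μ ≤ c₁)
    (hc₂ : ∀ E, IsSpherePseudoexpectation (2 * 4) E → ∀ i,
      ∫ ω, E (formPoly (A i ω ^ 2) (tensorVars d)) ∂μ ≤ c₂) :
    ∫ ω, pseudoMax (2 * 4) (formPoly (∑ i, A i ω) (tensorVars d)) ∂μ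
      ≤ Fintype.card κ * (c₁ + 2 * η * c₂) + 2 * Real.log d / η := by
  have hd' : (0 : ℝ) < d := by exact_mod_cast hd
  have hA2 : ∀ i, IsCompactRV fun ω => A i ω ^ 2 := fun i => (hA i).comp (continuous_pow 2)
  set F : κ → Matrix (Fin d × Fin d) (Fin d × Fin d) ℝ := fun i =>
    Matrix.expect μ (A i) + (2 * η) • Matrix.expect μ fun ω => A i ω ^ 2 with hF
  have hFs : ∀ i, (F i).IsSymm := fun i =>
    (Matrix.isSymm_expect (hs i)).add
      ((Matrix.isSymm_expect fun ω => (hs i ω).pow 2).smul _)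
  set Y : κ → Ω → Matrix (Fin d × Fin d) (Fin d × Fin d) ℝ := fun i ω => η • (A i ω - F i) with hY
  have hφ : ∀ i, Continuous fun M : Matrix (Fin d × Fin d) (Fin d × Fin d) ℝ => η • (M - F i) :=
    fun i => by fun_prop
  have hYc : ∀ i, IsCompactRV (Y i) := fun i =>
    (hA i).comp (g := fun M => η • (M - F i)) (hφ i)
  have hYs : ∀ i ω, (Y i ω).IsSymm := fun i ω => ((hs i ω).sub (hFs i)).smul η
  have hYind : ∀ (s : Finset κ) (i : κ), i ∉ s →
      IndepFun (fun ω => ∑ j ∈ s, Y j ω) (Y i) μ := by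
    intro s i hi
    have := (hind s i hi).comp (φ := fun z => ∑ j : s, η • (z j - F j))
      (ψ := fun M => η • (M - F i))
      (Finset.measurable_fun_sum _ fun j _ => (hφ j).measurable.comp (measurable_pi_apply j))
      (hφ i).measurable
    refine this.congr (Eventually.of_forall fun ω => ?_) (Eventually.of_forall fun ω => rfl)
    exact Finset.sum_coe_sort s fun j => Y j ω
  have hYexp : ∀ i, (1 - Matrix.expect μ fun ω => NormedSpace.exp (Y i ω)).PosSemidef := fun i =>
    Matrix.posSemidef_one_sub_expect_exp (hA i) (hs i) hη.le hηt ht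
      (fun ω => (hs i ω).smul_one_sub_of_sq ht (h2 i ω))
      (fun ω => by
        have := (hs i ω).neg.smul_one_sub_of_sq ht (by rw [neg_sq]; exact h2 i ω)
        rwa [sub_neg_eq_add] at this) (h2 i)
  have hT : ∫ ω, (NormedSpace.exp (∑ i, Y i ω)).trace ∂μ ≤ d * d := by
    have := Matrix.integral_trace_exp_sum_le (μ := μ) hYc hYs hYind hYexp Finset.univ
    simpa using this
  have hTi : Integrable (fun ω => (NormedSpace.exp (∑ i, Y i ω)).trace) μ :=
    ((IsCompactRV.finsetSum hYc Finset.univ).comp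
      (g := fun M => (NormedSpace.exp M).trace) Matrix.continuous_exp.matrix_trace).integrable μ
  have hG : Integrable
      (fun ω => pseudoMax (2 * 4) (formPoly (∑ i, A i ω) (tensorVars d))) μ :=
    ((IsCompactRV.finsetSum hA Finset.univ).comp (continuous_pseudoMax_formPoly hd)).integrable μ
  have key : ∀ ω, pseudoMax (2 * 4) (formPoly (∑ i, A i ω) (tensorVars d))
      ≤ Fintype.card κ * (c₁ + 2 * η * c₂)
        + (2 * Real.log d + ((NormedSpace.exp (∑ i, Y i ω)).trace / (d * d) - 1)) / η := by
    intro ω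
    obtain ⟨E, hE, hEv⟩ :=
      (isGreatest_pseudoMax hd (totalDegree_formPoly_tensorVars_le (∑ i, A i ω))).1
    rw [← hEv]
    -- The maximiser `E` depends on the sample ω, but `F i` does not. With `E` held fixed, the
    -- integrals below run over a fresh sample, so the uniform bounds apply.
    have hF' : ∀ i, E (formPoly (F i) (tensorVars d)) ≤ c₁ + 2 * η * c₂ := by
      intro i
      have e1 := Matrix.map_expect (μ := μ) (E.comp (formPolyₗ (tensorVars d))) (hA i)
      have e2 := Matrix.map_expect (μ := μ) (E.comp (formPolyₗ (tensorVars d))) (hA2 i)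
      simp only [LinearMap.comp_apply, formPolyₗ_apply] at e1 e2
      rw [hF, ← formPolyₗ_apply, map_add, map_smul, map_add, map_smul, formPolyₗ_apply,
        formPolyₗ_apply, ← e1, ← e2, smul_eq_mul]
      have h1 := hc₁ E hE i
      have h2 := hc₂ E hE i
      gcongr
    have hsum : ∑ i, A i ω = ∑ i, F i + η⁻¹ • ∑ i, Y i ω := by
      rw [hY, ← Finset.smul_sum, smul_smul, inv_mul_cancel₀ hη.ne', one_smul,
        Finset.sum_sub_distrib, add_sub_cancel]
    have hYs' : (∑ i, Y i ω).IsSymm := by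
      simp only [Matrix.IsSymm, Matrix.transpose_sum]
      exact Finset.sum_congr rfl fun i _ => hYs i ω
    rw [hsum, ← formPolyₗ_apply, map_add, map_smul, map_add, map_smul, map_sum, map_sum,
      formPolyₗ_apply, smul_eq_mul, div_eq_inv_mul _ η]
    refine add_le_add ?_ ?_
    · calc _ ≤ ∑ i : κ, (c₁ + 2 * η * c₂) := Finset.sum_le_sum fun i _ => hF' i
        _ = _ := by simp [mul_add]
    · exact mul_le_mul_of_nonneg_left (hE.map_formPoly_tensorVars_le hd hYs') (by positivity)
  have hI : Integrable (fun ω => Fintype.card κ * (c₁ + 2 * η * c₂)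
        + (2 * Real.log d + ((NormedSpace.exp (∑ i, Y i ω)).trace / (d * d) - 1)) / η) μ := by
    fun_prop
  refine (integral_mono hG hI key).trans ?_
  have h1 : Integrable (fun ω => (NormedSpace.exp (∑ i, Y i ω)).trace / ((d : ℝ) * d)) μ :=
    hTi.div_const _
  rw [integral_add (integrable_const _) (by fun_prop), integral_div,
    integral_add (integrable_const _) (by fun_prop), integral_sub h1 (integrable_const _),
    integral_div]
  simp only [integral_const, probReal_univ, one_smul]
  gcongr
  have : (∫ ω, (NormedSpace.exp (∑ i, Y i ω)).trace ∂μ) / ((d : ℝ) * d) ≤ 1 :=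
    (div_le_one (by positivity)).2 hT
  linarith

section DevPoly

variable {d n k : ℕ} {D : Measure (EuclideanSpace ℝ (Fin d))} [IsProbabilityMeasure D] {L : ℝ}

theorem devPoly_eq_formPoly (α τ : ℝ) (B : Fin k → Finset (Fin n))
    (v : Fin n → EuclideanSpace ℝ (Fin d)) :
    devPoly D α τ B v = formPoly (∑ i, (truncMatrix τ (bucketDev D α k (B i) v)).kronecker
      (truncMatrix τ (bucketDev D α k (B i) v))) (tensorVars d) := by
  rw [← formPolyₗ_apply, map_sum]
  simp only [formPolyₗ_apply, formPoly_kronecker, devPoly, pow_two]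

theorem indepFun_bucketDev (α : ℝ) (hn : 0 < n) {B : Fin k → Finset (Fin n)}
    (hB : IsEquipartition B) (s : Finset (Fin k)) (i : Fin k) (hi : i ∉ s) :
    IndepFun (fun v (j : s) => bucketDev D α k (B j) v) (bucketDev D α k (B i))
      (Measure.pi fun _ : Fin n => D) := by
  have hm := (IsNice.isCompactRV_sampleDev (D := D) α).measurable
  have hc := (continuous_const_smul ((k : ℝ) / n) (T := Matrix (Fin d) (Fin d) ℝ)).measurable
  have h : iIndepFun (fun (i : Fin n) (v : Fin n → EuclideanSpace ℝ (Fin d)) => v i)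
      (Measure.pi fun _ : Fin n => D) :=
    iIndepFun_pi (X := fun _ x => x) fun _ => aemeasurable_id
  have hdisj : Disjoint (s.biUnion B) (B i) := by
    refine (Finset.disjoint_biUnion_left _ _ _).2 fun a ha => Finset.disjoint_left.2 fun j ha' hj => ?_
    have := (hB.existsUnique_mem j).unique ha' hj
    exact hi (this ▸ ha)
  have h2 := (h.indepFun_finset _ _ hdisj measurable_pi_apply).comp
    (φ := fun y (j : s) => ((k : ℝ) / n) • ∑ l : B j,
      sampleDev D α (y ⟨l, Finset.mem_biUnion.2 ⟨j, j.2, l.2⟩⟩))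
    (ψ := fun y => ((k : ℝ) / n) • ∑ l, sampleDev D α (y l))
    (measurable_pi_lambda _ fun j => hc.comp
      (Finset.measurable_fun_sum _ fun l _ => hm.comp (measurable_pi_apply _)))
    (hc.comp (Finset.measurable_fun_sum _ fun l _ => hm.comp (measurable_pi_apply l)))
  refine h2.congr (Eventually.of_forall fun v => funext fun j => ?_)
    (Eventually.of_forall fun v => ?_)
  · change _ = bucketDev D α k (B j) v
    rw [bucketDev_eq_smul_sum α hn (hB.card_mul j), ← Finset.sum_coe_sort]
    rfl
  · rw [bucketDev_eq_smul_sum α hn (hB.card_mul i), ← Finset.sum_coe_sort]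
    rfl

theorem isCompactRV_pseudoMax_devPoly (hd : 0 < d) (hn : 0 < n) (α τ : ℝ)
    {B : Fin k → Finset (Fin n)} (hB : IsEquipartition B) :
    IsCompactRV fun v => pseudoMax (2 * 4) (devPoly D α τ B v) := by
  simp only [devPoly_eq_formPoly]
  exact (IsCompactRV.finsetSum (fun i => (Matrix.isCompactRV_truncMatrix
    (isCompactRV_bucketDev α hn (hB.card_mul i)) τ).comp Matrix.continuous_kronecker_self)
    Finset.univ).comp (continuous_pseudoMax_formPoly hd)

theorem isGreatest_pseudoMax_devPoly (hd : 0 < d) (α τ : ℝ) (B : Fin k → Finset (Fin n))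
    (v : Fin n → EuclideanSpace ℝ (Fin d)) :
    IsGreatest (pseudoValues (2 * 4) (devPoly D α τ B v))
      (pseudoMax (2 * 4) (devPoly D α τ B v)) := by
  rw [devPoly_eq_formPoly]
  exact isGreatest_pseudoMax hd (totalDegree_formPoly_tensorVars_le _)

/-- The truncation is Z or 0, and the value at Z is nonnegative. The condition r ≠ 0 ensures that
the power of the zero matrix vanishes. The loss of centring is harmless, as only upper bounds on
these moments are needed. -/
theorem integral_map_quadPoly_truncMatrix_le (hn : 0 < n) (α τ : ℝ) {B : Finset (Fin n)}
    (hB : B.card * k = n) {E : MvPolynomial (Fin d) ℝ →ₗ[ℝ] ℝ}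
    (hE : IsSpherePseudoexpectation (2 * 4) E) {r : ℕ} (hr : r ≠ 0) :
    ∫ v, E (quadPoly (truncMatrix τ (bucketDev D α k B v) ^ r) ^ 2)
        ∂(Measure.pi fun _ : Fin n => D)
      ≤ ∫ v, E (quadPoly (bucketDev D α k B v ^ r) ^ 2) ∂(Measure.pi fun _ : Fin n => D) := by
  have hZ := isCompactRV_bucketDev (D := D) (k := k) α hn hB
  refine integral_mono
    (((Matrix.isCompactRV_truncMatrix hZ τ).comp
      (continuous_map_quadPoly_sq E (continuous_pow r))).integrable _)
    ((hZ.comp (continuous_map_quadPoly_sq E (continuous_pow r))).integrable _) fun v => ?_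
  rcases Matrix.truncMatrix_eq_or τ (bucketDev D α k B v) with h | h
  · simp only [h, le_refl]
  · simp only [h, zero_pow hr]
    have h0 : quadPoly (0 : Matrix (Fin d) (Fin d) ℝ) = 0 := by simp [quadPoly]
    rw [h0, zero_pow two_ne_zero, map_zero]
    refine hE.sq_nonneg _ ?_
    have := totalDegree_quadPoly_le (bucketDev D α k B v ^ r)
    omega

theorem integral_pseudoMax_devPoly_le_of_le (hd : 0 < d) (hn : 0 < n) (hL : 0 < L)
    (hD : IsNice D L) (α τ : ℝ) {B : Fin k → Finset (Fin n)} (hB : IsEquipartition B) {η : ℝ}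
    (hη : 0 < η) (hητ : η * τ ^ 2 ≤ 1 / 2) :
    ∫ v, pseudoMax (2 * 4) (devPoly D α τ B v) ∂(Measure.pi fun _ : Fin n => D)
      ≤ k * ((k : ℝ) / n * (L * spectralNorm₂ (covMatrix D) ^ 2)
          + 2 * η * (64 * ((k : ℝ) / n
            * (L * (covMatrix D).trace * spectralNorm₂ (covMatrix D))) ^ 2))
        + 2 * Real.log d / η := by
  simp only [devPoly_eq_formPoly]
  have hZ := fun i => Matrix.isCompactRV_truncMatrix
    (isCompactRV_bucketDev (D := D) α hn (hB.card_mul i)) τ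
  have hZs : ∀ i v, (truncMatrix τ (bucketDev D α k (B i) v)).IsSymm := fun i v =>
    (isSymm_bucketDev α hn (hB.card_mul i) v).truncMatrix τ
  have hZ2 : ∀ i v, ((τ ^ 2) • (1 : Matrix (Fin d) (Fin d) ℝ)
      - truncMatrix τ (bucketDev D α k (B i) v) ^ 2).PosSemidef := fun i v => by
    have := (Matrix.posSemidef_sq_smul_one_sub_sq_iff (hZs i v) (abs_nonneg τ)).2
      (Matrix.spectralNorm₂_truncMatrix_le τ _)
    rwa [sq_abs] at this
  have hφ : Measurable fun Z : Matrix (Fin d) (Fin d) ℝ =>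
      (truncMatrix τ Z).kronecker (truncMatrix τ Z) :=
    Matrix.continuous_kronecker_self.measurable.comp (Matrix.measurable_truncMatrix τ)
  have h := integral_pseudoMax_formPoly_sum_le hd (μ := Measure.pi fun _ : Fin n => D)
    (A := fun i v => (truncMatrix τ (bucketDev D α k (B i) v)).kronecker
      (truncMatrix τ (bucketDev D α k (B i) v)))
    (fun i => (hZ i).comp Matrix.continuous_kronecker_self)
    (fun i v => (hZs i v).kronecker (hZs i v))
    (fun s i hi => (indepFun_bucketDev α hn hB s i hi).comp
      (φ := fun z j => (truncMatrix τ (z j)).kronecker (truncMatrix τ (z j)))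
      (measurable_pi_lambda _ fun j => hφ.comp (measurable_pi_apply j)) hφ)
    hη hητ (sq_nonneg τ)
    (fun i v => by
      rw [Matrix.kronecker_pow_two]
      exact Matrix.posSemidef_smul_one_sub_kronecker_self ((hZs i v).posSemidef_sq) (sq_nonneg τ)
        (hZ2 i v))
    (c₁ := (k : ℝ) / n * (L * spectralNorm₂ (covMatrix D) ^ 2))
    (c₂ := 64 * ((k : ℝ) / n * (L * (covMatrix D).trace * spectralNorm₂ (covMatrix D))) ^ 2)
    (fun E hE i => by
      have := (integral_map_quadPoly_truncMatrix_le hn α τ (hB.card_mul i) hE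
        one_ne_zero).trans (by
          simpa only [pow_one] using
            integral_map_quadPoly_bucketDev_sq_le hD α hE hL hn (hB.card_mul i))
      simpa only [formPoly_kronecker, ← pow_two, pow_one] using this)
    (fun E hE i => by
      have := (integral_map_quadPoly_truncMatrix_le hn α τ (hB.card_mul i) hE
        two_ne_zero).trans
          (integral_map_quadPoly_bucketDev_sq_sq_le hD α hE hL hn (hB.card_mul i))
      simpa only [Matrix.kronecker_pow_two, formPoly_kronecker, ← pow_two] using this)
  simpa using h

theorem integral_pseudoMax_devPoly_le (hd : 0 < d) (hn : 0 < n) (hL : 0 < L)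
    (hD : IsNice D L) (α τ : ℝ) {B : Fin k → Finset (Fin n)} (hB : IsEquipartition B) :
    ∫ v, pseudoMax (2 * 4) (devPoly D α τ B v) ∂(Measure.pi fun _ : Fin n => D)
      ≤ 32 * (1 / (n : ℝ) * (k : ℝ) ^ (3 / 2 : ℝ) * L * (covMatrix D).trace
          * spectralNorm₂ (covMatrix D) * √(Real.log d))
        + 32 * ((k : ℝ) ^ 2 / n * L * spectralNorm₂ (covMatrix D) ^ 2)
        + 32 * (τ ^ 2 * Real.log d) := by
  set lam := spectralNorm₂ (covMatrix D) with hlam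
  set T := (covMatrix D).trace with hT
  have hlam0 : 0 ≤ lam := norm_nonneg _
  have hT0 : 0 ≤ T := hD.posSemidef_covMatrix.trace_nonneg
  have hlog : 0 ≤ Real.log d := Real.log_natCast_nonneg d
  set w := (k : ℝ) / n * (L * T * lam) with hw
  have hw0 : 0 ≤ w := by positivity
  -- Here P is the mean term k·c₁, a collects k·2·64 w² from the variance, and b comes from the
  -- logarithm of the dimension d².
  have h := le_add_mul_sqrt_of_forall_le
    (R := ∫ v, pseudoMax (2 * 4) (devPoly D α τ B v) ∂(Measure.pi fun _ : Fin n => D))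
    (P := (k : ℝ) ^ 2 / n * L * lam ^ 2) (a := 128 * k * w ^ 2) (b := 2 * Real.log d)
    (s := τ ^ 2) (by positivity) (by positivity) (sq_nonneg τ) fun η hη hητ =>
      (integral_pseudoMax_devPoly_le_of_le hd hn hL hD α τ hB hη hητ).trans_eq (by ring)
  have e : √(128 * k * w ^ 2 * (2 * Real.log d)) = 16 * √k * w * √(Real.log d) := by
    rw [show 128 * k * w ^ 2 * (2 * Real.log d) = (16 * w) ^ 2 * (k * Real.log d) by ring,
      Real.sqrt_mul (sq_nonneg _), Real.sqrt_sq (by positivity), Real.sqrt_mul k.cast_nonneg]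
    ring
  have e2 : (k : ℝ) ^ (3 / 2 : ℝ) = k * √k := by
    rw [Real.sqrt_eq_rpow, ← Real.rpow_one_add' k.cast_nonneg (by norm_num)]
    norm_num
  rw [e] at h
  rw [e2]
  have h1 : 0 ≤ (k : ℝ) ^ 2 / n * L * lam ^ 2 := by positivity
  have h2 : 0 ≤ τ ^ 2 * Real.log d := by positivity
  have h3 : 2 * (16 * √(k : ℝ) * w * √(Real.log d))
      = 32 * (1 / (n : ℝ) * (k * √k) * L * T * lam * √(Real.log d)) := by
    rw [hw]; ring
  rw [h3] at h
  linarith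

end DevPoly

end

/-! ### The main theorem. -/

theorem mainTheorem5 :
    ∃ C : ℝ, 0 < C ∧
      ∀ (d n k : ℕ), 0 < d → 0 < n →
      ∀ (L α τ : ℝ), 0 < L → 0 < α →
      ∀ (D : Measure (EuclideanSpace ℝ (Fin d))) [IsProbabilityMeasure D], IsNice D L →
      ∀ (B : Fin k → Finset (Fin n)), IsEquipartition B →
      ∀ {Ω : Type*} [MeasurableSpace Ω] (P : Measure Ω) [IsProbabilityMeasure P]
        (v : Fin n → Ω → EuclideanSpace ℝ (Fin d)),
        (∀ j, HasLaw (v j) D P) → iIndepFun v P →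
        (∀ ω, IsGreatest (pseudoValues 8 (devPoly D α τ B (fun j => v j ω)))
          (pseudoMax 8 (devPoly D α τ B (fun j => v j ω)))) ∧
        Integrable (fun ω => pseudoMax 8 (devPoly D α τ B (fun j => v j ω))) P ∧
        ∫ ω, pseudoMax 8 (devPoly D α τ B (fun j => v j ω)) ∂P ≤
          C * (1 / (n : ℝ) * (k : ℝ) ^ (3 / 2 : ℝ) * L * (covMatrix D).trace
              * spectralNorm₂ (covMatrix D) * Real.sqrt (Real.log d))
            + C * ((k : ℝ) ^ 2 / (n : ℝ) * L * spectralNorm₂ (covMatrix D) ^ 2)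
            + C * (τ ^ 2 * Real.log d) := by
  -- The square-root term gives 2·16 = 32; the other two terms need only 1 and 4.
  refine ⟨32, by norm_num, ?_⟩
  intro d n k hd hn L α τ hL _ D _ hD B hB Ω _ P _ v hv hind
  -- Independence and equal laws identify the joint law with the product measure, on which all
  -- estimates were made.
  have hlaw : P.map (fun ω j => v j ω) = Measure.pi fun _ : Fin n => D := by
    rw [(iIndepFun_iff_map_fun_eq_pi_map fun j => (hv j).aemeasurable).1 hind]
    simp only [(hv _).map_eq]
  have hV : AEMeasurable (fun ω j => v j ω) P := aemeasurable_pi_lambda _ fun j => (hv j).aemeasurable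
  have hG := isCompactRV_pseudoMax_devPoly (D := D) hd hn α τ hB
  refine ⟨fun ω => isGreatest_pseudoMax_devPoly hd α τ B _, ?_, ?_⟩
  · have h := hG.integrable (Measure.pi fun _ : Fin n => D)
    rw [← hlaw] at h
    exact h.comp_aemeasurable hV
  · have h := integral_map (f := fun w => pseudoMax (2 * 4) (devPoly D α τ B w)) hV
      hG.measurable.aestronglyMeasurable
    rw [hlaw] at h
    exact h.symm.trans_le (integral_pseudoMax_devPoly_le hd hn hL hD α τ hB)
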